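/- Let $q\in\mathbb C\setminus\{0\}$ be not a root of unity, and put $[m]=\frac{q^m-q^{-m}}{q-q^{-1}}$. For $s\ge 0$ let $\mathsf M_{s+1}$ be the $U_q(\mathfrak{sl}_2)$-module with basis $e_0,\dots,e_s$ and $K.e_l=q^{s-2l}e_l$, $F.e_l=e_{l+1}$ ($F.e_s=0$), $E.e_l=[l][s-l+1]e_{l-1}$ ($E.e_0=0$). Tensor products are taken with respect to $\Delta(E)=E\otimes K+1\otimes E$, $\Delta(K)=K\otimes K$, $\Delta(F)=F\otimes 1+K^{-1}\otimes F$. For $\varsigma=(s_1,\dots,s_p)$ and $s\ge0$ let $$\mathsf H_\varsigma^{(s)}=\{v\in \mathsf M_{s_p+1}\otimes\cdots\otimes \mathsf M_{s_1+1}: E.v=0,\ K.v=q^s v\}.$$ *Link patterns.* For $\varsigma\in\mathbb Z_{>0}^p$ let $\mathrm{LP}^{(0)}_\varsigma$ be the set of planar link patterns without defects: multisets $\omega$ of links $(a,b)$, $1\le a<b\le p$, such that no two links $(a,b),(a',b')$ satisfy $a<a'<b<b'$ and each index $i$ is an endpoint of exactly $s_i$ links. Put $\mathrm{PP}_N=\mathrm{LP}^{(0)}_{(1,\dots,1)}$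 ($2N$ ones) and $\mathrm{PP}=\bigsqcup_{N\ge0}\mathrm{PP}_N$. For $\omega\in\mathrm{LP}^{(0)}_{\varsigma}$ let $\mathcal S(\omega)\in\mathrm{LP}^{(0)}_{(s_p,s_1,\dots,s_{p-1})}$ be obtained by moving the last index $p$, with its links, to the left of all others and relabelling the indices from left to right by $1,\dots,p$. Let $\alpha(\omega)\in\mathrm{PP}_N$, $2N=\sum_i s_i$, be obtained by splitting each index $i$ into $s_i$ consecutive indices of valence one, distributing its $s_i$ links among them (it is the unique planar pair partition which gives back $\omega$ when each block of $s_i$ indices is glued together). *Vectors.* Let $\hat\pi_j^{(1)}$ be the projection of the $j$-th and $(j+1)$-st tensor components (counted from the right) of $\mathsf M_2^{\otimes 2N}$ onto the trivial subrepresentation $\mathsf M_1\subset\mathsf M_2\otimes\mathsf M_2$, along $\mathsf M_3$, identified with $\mathbb C$ by $(q-q^{-1})^{-1}(e_1\otimes e_0-q\,e_0\otimes e_1)\mapsto 1$. There is a unique collection $(v_\alpha)_{\alpha\in\mathrm{PP}}$ with $v_\alpha\in\mathsf H^{(0)}_{(1,\dots,1)}\subset\mathsf M_2^{\otimes 2N}$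 for $\alpha\in\mathrm{PP}_N$, with $v_\emptyset=1$, and with $\hat\pi_j^{(1)}(v_\alpha)=v_{\alpha/(j,j+1)}$ if $(j,j+1)\in\alpha$ and $\hat\pi_j^{(1)}(v_\alpha)=0$ otherwise, for $1\le j\le 2N-1$, where $\alpha/(j,j+1)$ is $\alpha$ with this link and its endpoints removed and the other indices relabelled. Let $\hat{\mathfrak p}^{(s)}\colon\mathsf M_2^{\otimes s}\to\mathsf M_{s+1}$ be the homomorphism of representations with $e_0\otimes\cdots\otimes e_0\mapsto e_0$. For $\omega\in\mathrm{LP}_\varsigma^{(0)}$ put $$\mathfrak v_\omega=\big(\hat{\mathfrak p}^{(s_p)}\otimes\cdots\otimes\hat{\mathfrak p}^{(s_1)}\big)(v_{\alpha(\omega)}).$$ *The map $S$.* For $v\in\mathsf H^{(0)}_{(\varsigma,s)}$ let $R_+(v)$ be the unique $\tau\in\mathsf H_\varsigma^{(s)}$ with $v=\sum_{l=0}^s(-1)^{s-l}q^{(l+1)(s-l)}\,(e_l\otimes F^{s-l}.\tau)$, and for $v\in\mathsf H^{(0)}_{(s,\varsigma)}$ let $R_-(v)$ be the unique $\tau\in\mathsf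 H_\varsigma^{(s)}$ with $v=\sum_{l=0}^s(-1)^{s-l}q^{(l-1)(s-l)}\,(F^{s-l}.\tau\otimes e_l)$. Put $S^{(s)}=R_-^{-1}\circ R_+\colon\mathsf H^{(0)}_{(\varsigma,s)}\to\mathsf H^{(0)}_{(s,\varsigma)}$. **Statement.** The collection $(v_\alpha)_{\alpha\in\mathrm{PP}}$ exists and is unique. For all $p\ge1$, $\varsigma=(s_1,\dots,s_p)\in\mathbb Z_{>0}^p$ and $\omega\in\mathrm{LP}^{(0)}_\varsigma$ we have $\mathcal S(\omega)\in\mathrm{LP}^{(0)}_{(s_p,s_1,\dots,s_{p-1})}$, $\mathfrak v_\omega\in\mathsf H^{(0)}_\varsigma$, and $$\mathfrak v_{\mathcal S(\omega)}=(-q)^{s_p}\,S^{(s_p)}(\mathfrak v_\omega).$$ -/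

import Mathlib

noncomputable section

namespace QLink

/-- The symmetric `q`-integer `[m] = (q ^ m - q ^ (-m)) / (q - q ^ (-1))`. -/
def qInt (q : ℂ) (m : ℤ) : ℂ := (q ^ m - q ^ (-m)) / (q - q⁻¹)

/-! ### Tensor products of the irreducible representations

A multiindex of valences `(s_1, …, s_p)` is a list `ς`.  The tensor product
`M_{s_p + 1} ⊗ ⋯ ⊗ M_{s_1 + 1}` (in this reverse order) has the basis
`e_{l_p} ⊗ ⋯ ⊗ e_{l_1}` with `0 ≤ l_i ≤ s_i`.  Such a basis vector is encoded by the word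
`[l_1, …, l_p]`, so the head of the list is the rightmost tensorand.  All tensor products are
realised inside the free vector space on words, and the tensor product over the empty multiindex
is the line spanned by the empty word. -/

/-- Formal linear combinations of words of basis labels. -/
abbrev Words : Type := List ℕ →₀ ℂ

/-- The tensor product `M_{s_p + 1} ⊗ ⋯ ⊗ M_{s_1 + 1}` for `ς = [s_1, …, s_p]`: combinations of the
words `[l_1, …, l_p]` with `l_i ≤ s_i` for all `i`. -/
def tens (ς : List ℕ) : Submodule ℂ Words :=
  Finsupp.supported ℂ ℂ {l : List ℕ | List.Forall₂ (fun a s => a ≤ s) l ς}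

/-- `w ↦ w ⊗ e_l`: a new first (rightmost) tensor component. -/
def tensRight (l : ℕ) : Words →ₗ[ℂ] Words :=
  Finsupp.lmapDomain ℂ ℂ (fun w : List ℕ => l :: w)

/-- `w ↦ e_l ⊗ w`: a new last (leftmost) tensor component. -/
def tensLeft (l : ℕ) : Words →ₗ[ℂ] Words :=
  Finsupp.lmapDomain ℂ ℂ (fun w : List ℕ => w ++ [l])

/-- The exponent `∑ i, (s_i - 2 l_i)` of the `K`-eigenvalue of a word. -/
def weight : List ℕ → List ℕ → ℤ
  | s :: ς, l :: w => ((s : ℤ) - 2 * (l : ℤ)) + weight ς w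
  | _, _ => 0

/-- `E` on a basis vector, through `Δ(E) = E ⊗ K + 1 ⊗ E`,
`K.e_l = q ^ (s - 2 l) e_l`, `E.e_l = [l] [s - l + 1] e_{l - 1}` and `E.e_0 = 0`. -/
def eWord (q : ℂ) : List ℕ → List ℕ → Words
  | s :: ς, l :: w =>
      q ^ ((s : ℤ) - 2 * (l : ℤ)) • tensRight l (eWord q ς w) +
        (if l = 0 then 0
          else Finsupp.single ((l - 1) :: w) (qInt q l * qInt q ((s : ℤ) - (l : ℤ) + 1)))
  | _, _ => 0

/-- `F` on a basis vector, through `Δ(F) = F ⊗ 1 + K⁻¹ ⊗ F`, `F.e_l = e_{l + 1}` for `l < s`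
and `F.e_s = 0`. -/
def fWord (q : ℂ) : List ℕ → List ℕ → Words
  | s :: ς, l :: w =>
      tensRight l (fWord q ς w) +
        (if l < s then Finsupp.single ((l + 1) :: w) (q ^ (-weight ς w)) else 0)
  | _, _ => 0

/-- The action of the generator `E` of `U_q(sl_2)` on the tensor product with multiindex `ς`. -/
def actE (q : ℂ) (ς : List ℕ) : Words →ₗ[ℂ] Words :=
  Finsupp.linearCombination ℂ (eWord q ς)

/-- The action of the generator `F`. -/
def actF (q : ℂ) (ς : List ℕ) : Words →ₗ[ℂ] Words :=
  Finsupp.linearCombination ℂ (fWord q ς)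

/-- The action of the generator `K`, with `Δ(K) = K ⊗ K`. -/
def actK (q : ℂ) (ς : List ℕ) : Words →ₗ[ℂ] Words :=
  Finsupp.linearCombination ℂ (fun w => Finsupp.single w (q ^ weight ς w))

/-- The space `H_ς^{(s)}` of highest weight vectors of weight `q ^ s`:
`E.v = 0` and `K.v = q ^ s v`. -/
def hwSpace (q : ℂ) (ς : List ℕ) (s : ℕ) : Submodule ℂ Words :=
  tens ς ⊓ LinearMap.ker (actE q ς) ⊓ LinearMap.ker (actK q ς - q ^ s • LinearMap.id)

/-! ### The maps `R_+`, `R_-` and `S` -/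

/-- The inverse of `R_+ : H_{(ς, s)}^{(0)} → H_ς^{(s)}`, that is,
`τ ↦ ∑ l ≤ s, (-1) ^ (s - l) q ^ ((l + 1) (s - l)) (e_l ⊗ F ^ (s - l).τ)`. -/
def rPlusInv (q : ℂ) (ς : List ℕ) (s : ℕ) (τ : Words) : Words :=
  ∑ l ∈ Finset.range (s + 1),
    ((-1 : ℂ) ^ (s - l) * q ^ ((l + 1) * (s - l))) • tensLeft l ((actF q ς ^ (s - l)) τ)

/-- The map `R_+ : H_{(ς, s)}^{(0)} → H_ς^{(s)}`: `R_+(v)` is the (unique) `τ ∈ H_ς^{(s)}` with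
`v = ∑ l ≤ s, (-1) ^ (s - l) q ^ ((l + 1) (s - l)) (e_l ⊗ F ^ (s - l).τ)`. -/
def rPlus (q : ℂ) (ς : List ℕ) (s : ℕ) (v : Words) : Words :=
  Classical.epsilon fun τ => τ ∈ hwSpace q ς s ∧ v = rPlusInv q ς s τ

/-- The inverse of `R_- : H_{(s, ς)}^{(0)} → H_ς^{(s)}`.  Here `R_-(v)` is the unique
`τ ∈ H_ς^{(s)}` with `v = ∑ l ≤ s, (-1) ^ (s - l) q ^ ((l - 1) (s - l)) (F ^ (s - l).τ ⊗ e_l)`,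
so its inverse sends `τ` to this sum. -/
def rMinusInv (q : ℂ) (ς : List ℕ) (s : ℕ) (τ : Words) : Words :=
  ∑ l ∈ Finset.range (s + 1),
    ((-1 : ℂ) ^ (s - l) * q ^ (((l : ℤ) - 1) * ((s : ℤ) - (l : ℤ)))) •
      tensRight l ((actF q ς ^ (s - l)) τ)

/-- The cyclic permutation `S^{(s)} = R_-⁻¹ ∘ R_+ : H_{(ς, s)}^{(0)} → H_{(s, ς)}^{(0)}` of the
tensor components. -/
def cyc (q : ℂ) (ς : List ℕ) (s : ℕ) (v : Words) : Words :=
  rMinusInv q ς s (rPlus q ς s v)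

/-! ### Planar link patterns -/

/-- A collection (with multiplicities) of links `(a, b)` and defects `c`. -/
@[ext]
structure Diagram where
  links : Multiset (ℕ × ℕ)
  defects : Multiset ℕ

instance : Inhabited Diagram := ⟨⟨0, 0⟩⟩

/-- The set `LP_ς^{(s)}` of planar link patterns of points `1, …, p` with index valences
`ς = [s_1, …, s_p]` and with `s` defects. -/
def LP (ς : List ℕ) (s : ℕ) : Set Diagram :=
  {ω | (∀ L ∈ ω.links, 1 ≤ L.1 ∧ L.1 < L.2 ∧ L.2 ≤ ς.length) ∧
    (∀ c ∈ ω.defects, 1 ≤ c ∧ c ≤ ς.length) ∧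
    ω.defects.card = s ∧
    (∀ i : Fin ς.length,
      ω.links.countP (fun L => L.1 = (i : ℕ) + 1 ∨ L.2 = (i : ℕ) + 1) +
        ω.defects.count ((i : ℕ) + 1) = ς.get i) ∧
    (∀ L ∈ ω.links, ∀ c ∈ ω.defects, ¬ (L.1 < c ∧ c < L.2)) ∧
    (∀ L ∈ ω.links, ∀ L' ∈ ω.links, ¬ (L.1 < L'.1 ∧ L'.1 < L.2 ∧ L.2 < L'.2))}

/-- The set `PP_N` of planar pair partitions of `2 N` points. -/
def PP (N : ℕ) : Set Diagram := LP (List.replicate (2 * N) 1) 0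

/-- The combinatorial map `ℛ_+`: the last index `m` is removed, and the links attached to it
become defects. -/
def patPlus (m : ℕ) (ω : Diagram) : Diagram where
  links := ω.links.filter (fun L => L.2 ≠ m)
  defects := ω.defects + (ω.links.filter (fun L => L.2 = m)).map Prod.fst

/-- The combinatorial map `ℛ_-⁻¹`: the indices are shifted by one, and the defects are connected to
a new index `1` on the left of all others. -/
def patMinusInv (ω : Diagram) : Diagram where
  links := ω.links.map (fun L => (L.1 + 1, L.2 + 1)) + ω.defects.map (fun c => (1, c + 1))
  defects := 0

/-- The cyclic rotation `𝒮 = ℛ_-⁻¹ ∘ ℛ_+` of link patterns of the points `1, …, m` without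
defects. -/
def patCyc (m : ℕ) (ω : Diagram) : Diagram := patMinusInv (patPlus m ω)

/-- The removal `α / (j, j + 1)` of a link of a pair partition, with its endpoints; the other
indices are relabelled from left to right. -/
def removeLink (j : ℕ) (α : Diagram) : Diagram where
  links := (α.links.erase (j, j + 1)).map
    (fun L => (if j + 1 < L.1 then L.1 - 2 else L.1, if j + 1 < L.2 then L.2 - 2 else L.2))
  defects := 0

/-- When each index `i` is split into `s_i` new indices, labelled from left to right by
`1, 2, …`, the new index `x` comes from the index `block ς x`. -/
def block : List ℕ → ℕ → ℕ
  | [], _ => 1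
  | s :: ς, x => if x ≤ s then 1 else block ς (x - s) + 1

/-- The planar pair partition `α(ω)` obtained from a link pattern `ω ∈ LP_ς^{(0)}` by splitting
each index `i` into `s_i` indices of valence one and distributing the `s_i` links of `i` among
them: it is the only planar pair partition that becomes `ω` when the new indices are
glued together again. -/
def openUp (ς : List ℕ) (ω : Diagram) : Diagram :=
  Classical.epsilon fun α => α ∈ LP (List.replicate ς.sum 1) 0 ∧
    α.links.map (fun L => (block ς L.1, block ς L.2)) = ω.links

/-! ### The basis vectors of the trivial subrepresentation -/

/-- The projection `M_2 ⊗ M_2 → M_1 = ℂ` on the basis vector `e_b ⊗ e_a`.  It vanishes on the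
subrepresentation `M_3` spanned by `e_0 ⊗ e_0`, `e_1 ⊗ e_0 + q⁻¹ e_0 ⊗ e_1`, `e_1 ⊗ e_1`, and
sends the vector `(e_1 ⊗ e_0 - q e_0 ⊗ e_1) / (q - q⁻¹)`, which spans the trivial
subrepresentation, to `1`. -/
def capCoef (q : ℂ) : ℕ → ℕ → ℂ
  | 0, 1 => (q - q⁻¹) / (q * qInt q 2)
  | 1, 0 => -(q - q⁻¹) / qInt q 2
  | _, _ => 0

/-- The projection of the tensor components `j` and `j + 1` of `M_2 ⊗ ⋯ ⊗ M_2` to `M_1 = ℂ`. -/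
def capProj (q : ℂ) (j : ℕ) : Words →ₗ[ℂ] Words :=
  Finsupp.linearCombination ℂ fun w =>
    Finsupp.single (w.take (j - 1) ++ w.drop (j + 1)) (capCoef q (w.getD (j - 1) 0) (w.getD j 0))

/-- The system of equations for the vectors `v_α`, with `α` a planar pair partition: `E.v_α = 0`,
`K.v_α = v_α`, the projection to `M_1` of the components `j`, `j + 1` is `v_{α / (j, j + 1)}` if
`(j, j + 1) ∈ α` and zero otherwise, and `v_∅ = 1`.  The family is indexed by planar pair
partitions; the value at any other diagram is set to zero. -/
structure IsPairFamily (q : ℂ) (v : Diagram → Words) : Prop where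
  off : ∀ α, (∀ N, α ∉ PP N) → v α = 0
  mem : ∀ N, ∀ α ∈ PP N, v α ∈ hwSpace q (List.replicate (2 * N) 1) 0
  proj_of_mem : ∀ N, ∀ α ∈ PP N, ∀ j, 1 ≤ j → j + 1 ≤ 2 * N → (j, j + 1) ∈ α.links →
    capProj q j (v α) = v (removeLink j α)
  proj_of_notMem : ∀ N, ∀ α ∈ PP N, ∀ j, 1 ≤ j → j + 1 ≤ 2 * N → (j, j + 1) ∉ α.links →
    capProj q j (v α) = 0
  empty : v ⟨0, 0⟩ = Finsupp.single [] 1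

/-- The vectors `v_α` for planar pair partitions `α`: the solution of the system above. -/
def pairVec (q : ℂ) : Diagram → Words := Classical.epsilon (IsPairFamily q)

/-- The coefficient of the basis vector `e_{l_s} ⊗ ⋯ ⊗ e_{l_1}` under the projection
`M_2 ⊗ ⋯ ⊗ M_2 → M_{s + 1}`. -/
def topCoef (q : ℂ) : List ℕ → ℂ
  | [] => 1
  | l :: w => topCoef q w *
      (if l = 0 then q ^ w.sum * qInt q ((w.length : ℤ) + 1 - (w.sum : ℤ)) else 1) /
        qInt q ((w.length : ℤ) + 1)

/-- The projection from `M_2 ⊗ ⋯ ⊗ M_2` (`s` factors) to its subrepresentation of highest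
dimension, identified with `M_{s + 1}` through `F ^ l.(e_0 ⊗ ⋯ ⊗ e_0) ↦ e_l`.  It is the only
homomorphism of representations `M_2 ⊗ ⋯ ⊗ M_2 → M_{s + 1}` that sends `e_0 ⊗ ⋯ ⊗ e_0`
to `e_0`; see the lemmas below. -/
def topProj (q : ℂ) : Words →ₗ[ℂ] Words :=
  Finsupp.linearCombination ℂ fun w => Finsupp.single [w.sum] (topCoef q w)

/-! The next lemmas show that `topProj` restricted to `M_2 ⊗ ⋯ ⊗ M_2` (`s` factors) commutes with
the generators `E`, `F`, `K` (the target being `M_{s + 1}`) and sends `e_0 ⊗ ⋯ ⊗ e_0` to `e_0`, and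
that the coefficients in `capCoef` are as described. -/

theorem qInt_den_ne (q : ℂ) (hq0 : q ≠ 0) (hq : ∀ m : ℤ, m ≠ 0 → q ^ m ≠ 1) : q - q⁻¹ ≠ 0 := by
  intro h
  apply hq 2 (by norm_num)
  have h1 : q = q⁻¹ := sub_eq_zero.mp h
  have h2 : q ^ 2 = 1 := by
    rw [pow_two]; nth_rewrite 2 [h1]; exact mul_inv_cancel₀ hq0
  exact_mod_cast h2

theorem qInt_ne_zero (q : ℂ) (hq0 : q ≠ 0) (hq : ∀ m : ℤ, m ≠ 0 → q ^ m ≠ 1) (m : ℤ) (hm : m ≠ 0) :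
    qInt q m ≠ 0 := by
  unfold qInt
  refine div_ne_zero ?_ (qInt_den_ne q hq0 hq)
  intro h
  apply hq (2 * m) (by omega)
  have h1 : q ^ m = q ^ (-m) := sub_eq_zero.mp h
  rw [two_mul, zpow_add₀ hq0]
  nth_rewrite 2 [h1]
  rw [← zpow_add₀ hq0]; simp

theorem qInt_add_one (q : ℂ) (hq0 : q ≠ 0) (hd : q - q⁻¹ ≠ 0) (m : ℤ) :
    q⁻¹ * qInt q m + q ^ m = qInt q (m + 1) := by
  unfold qInt
  have h : q ^ (m + 1) = q ^ m * q := zpow_add_one₀ hq0 m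
  have h' : q ^ (-(m + 1)) = q ^ (-m) * q⁻¹ := by
    rw [show -(m + 1) = -m - 1 by ring, zpow_sub_one₀ hq0]
  rw [h, h', ← mul_right_inj' hd, mul_add, mul_left_comm, mul_div_cancel₀ _ hd,
    mul_div_cancel₀ _ hd]
  ring

theorem qInt_add_one' (q : ℂ) (hq0 : q ≠ 0) (hd : q - q⁻¹ ≠ 0) (m : ℤ) :
    q * qInt q m + q ^ (-m) = qInt q (m + 1) := by
  unfold qInt
  have h : q ^ (m + 1) = q ^ m * q := zpow_add_one₀ hq0 m
  have h' : q ^ (-(m + 1)) = q ^ (-m) * q⁻¹ := by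
    rw [show -(m + 1) = -m - 1 by ring, zpow_sub_one₀ hq0]
  rw [h, h', ← mul_right_inj' hd, mul_add, mul_left_comm, mul_div_cancel₀ _ hd,
    mul_div_cancel₀ _ hd]
  ring

/-- The linear extension of `topCoef`. -/
def topFun (q : ℂ) : Words →ₗ[ℂ] ℂ := Finsupp.linearCombination ℂ (topCoef q)

theorem topFun_tensRight (q : ℂ) (x n : ℕ) (m : ℤ) (u : Words)
    (hu : u ∈ Finsupp.supported ℂ ℂ {l : List ℕ | l.length = n ∧ (l.sum : ℤ) = m}) :
    topFun q (tensRight x u) =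
      (if x = 0 then q ^ m * qInt q ((n : ℤ) + 1 - m) else 1) / qInt q ((n : ℤ) + 1) *
        topFun q u := by
  rw [Finsupp.supported_eq_span_single] at hu
  induction hu using Submodule.span_induction with
  | mem y hy =>
    obtain ⟨l, ⟨h1, h2⟩, rfl⟩ := hy
    subst h1; subst h2
    simp [topFun, tensRight, Finsupp.lmapDomain_apply, topCoef, -Nat.cast_list_sum]
    split_ifs <;> ring
  | zero => simp
  | add a b _ _ ha hb => rw [map_add, map_add, map_add, ha, hb]; ring
  | smul c a _ ha => rw [map_smul, map_smul, map_smul, ha]; simp only [smul_eq_mul]; ring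

theorem topProj_eq (q : ℂ) (m : ℕ) (u : Words)
    (hu : u ∈ Finsupp.supported ℂ ℂ {l : List ℕ | l.sum = m}) :
    topProj q u = Finsupp.single [m] (topFun q u) := by
  rw [Finsupp.supported_eq_span_single] at hu
  induction hu using Submodule.span_induction with
  | mem y hy =>
    obtain ⟨l, h1, rfl⟩ := hy
    have h1 : l.sum = m := h1
    subst h1
    simp [topFun, topProj]
  | zero => simp
  | add a b _ _ ha hb => rw [map_add, map_add, ha, hb, Finsupp.single_add]
  | smul c a _ ha => rw [map_smul, map_smul, ha]; simp

theorem tensRight_supported (x : ℕ) (A B : Set (List ℕ)) (u : Words)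
    (hu : u ∈ Finsupp.supported ℂ ℂ A) (h : ∀ l ∈ A, x :: l ∈ B) :
    tensRight x u ∈ Finsupp.supported ℂ ℂ B := by
  have h1 : tensRight x u ∈ (Finsupp.supported ℂ ℂ A).map (tensRight x) :=
    Submodule.mem_map_of_mem hu
  unfold tensRight at h1 ⊢
  rw [Finsupp.lmapDomain_supported] at h1
  refine Finsupp.supported_mono ?_ h1
  rintro _ ⟨l, hl, rfl⟩
  exact h l hl

theorem fWord_supported (q : ℂ) (ς w : List ℕ) (h : w.length = ς.length) :
    fWord q ς w ∈ Finsupp.supported ℂ ℂ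
      {l : List ℕ | l.length = ς.length ∧ (l.sum : ℤ) = (w.sum : ℤ) + 1} := by
  induction ς generalizing w with
  | nil => simp [fWord]
  | cons s ς ih =>
    cases w with
    | nil => simp at h
    | cons x w =>
      simp only [List.length_cons, Nat.add_right_cancel_iff] at h
      unfold fWord
      refine Submodule.add_mem _ (tensRight_supported x _ _ _ (ih w h) ?_) ?_
      · rintro l ⟨h1, h2⟩
        refine ⟨by simp [h1], ?_⟩
        simp only [List.sum_cons]; omega
      · split_ifs
        · refine Finsupp.single_mem_supported ℂ _ ⟨by simp [h], ?_⟩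
          simp only [List.sum_cons]; omega
        · exact Submodule.zero_mem _

theorem eWord_supported (q : ℂ) (ς w : List ℕ) (h : w.length = ς.length) :
    eWord q ς w ∈ Finsupp.supported ℂ ℂ
      {l : List ℕ | l.length = ς.length ∧ (l.sum : ℤ) = (w.sum : ℤ) - 1} := by
  induction ς generalizing w with
  | nil => simp [eWord]
  | cons s ς ih =>
    cases w with
    | nil => simp at h
    | cons x w =>
      simp only [List.length_cons, Nat.add_right_cancel_iff] at h
      unfold eWord
      refine Submodule.add_mem _ (Submodule.smul_mem _ _
        (tensRight_supported x _ _ _ (ih w h) ?_)) ?_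
      · rintro l ⟨h1, h2⟩
        refine ⟨by simp [h1], ?_⟩
        simp only [List.sum_cons]; omega
      · split_ifs with h0
        · exact Submodule.zero_mem _
        · refine Finsupp.single_mem_supported ℂ _ ⟨by simp [h], ?_⟩
          simp only [List.sum_cons]; omega

theorem weight_replicate (n : ℕ) (w : List ℕ) (h : w.length = n) :
    weight (List.replicate n 1) w = (n : ℤ) - 2 * (w.sum : ℤ) := by
  induction n generalizing w with
  | zero => simp at h; subst h; simp [weight]
  | succ n ih =>
    cases w with
    | nil => simp at h
    | cons x w =>
      simp only [List.length_cons, Nat.add_right_cancel_iff] at h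
      simp only [List.replicate_succ, weight, ih w h, List.sum_cons]
      push_cast; ring

theorem topFun_fWord (q : ℂ) (hq0 : q ≠ 0) (hd : q - q⁻¹ ≠ 0) (n : ℕ)
    (w : List ℕ) (h : List.Forall₂ (fun a s => a ≤ s) w (List.replicate n 1)) :
    w.sum ≤ n ∧ w.length = n ∧ topFun q (fWord q (List.replicate n 1) w) =
      if w.sum < n then topCoef q w else 0 := by
  induction n generalizing w with
  | zero => simp at h; subst h; simp [fWord]
  | succ n ih =>
    cases w with
    | nil => simp [List.replicate_succ] at h
    | cons x w =>
      simp only [List.replicate_succ, List.forall₂_cons] at h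
      obtain ⟨hx, hw⟩ := h
      obtain ⟨h1, h2, h3⟩ := ih w hw
      refine ⟨by simp only [List.sum_cons]; omega, by simp [h2], ?_⟩
      have hs := fWord_supported q (List.replicate n 1) w (by simp [h2])
      simp only [List.length_replicate] at hs
      simp only [List.replicate_succ, fWord, map_add]
      rw [topFun_tensRight q x n _ _ hs, h3, weight_replicate n w h2]
      have hone : qInt q 1 = 1 := by simp [qInt, div_self hd]
      interval_cases x
      · have h4 : List.sum (0 :: w) < n + 1 := by simp; omega
        simp only [if_pos h4]
        simp only [if_true, zero_add, Nat.lt_one_iff, topFun, Finsupp.linearCombination_single,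
          smul_eq_mul, topCoef, one_ne_zero, if_false, h2]
        have key := qInt_add_one' q hq0 hd ((n : ℤ) - w.sum)
        have e1 : q ^ ((w.sum : ℤ) + 1) = q ^ w.sum * q := by
          rw [zpow_add_one₀ hq0, zpow_natCast]
        have e2 : q ^ (-((n : ℤ) - 2 * w.sum)) = q ^ w.sum * q ^ (-((n : ℤ) - w.sum)) := by
          rw [← zpow_natCast q w.sum, ← zpow_add₀ hq0]; congr 1; ring
        rw [e1, e2, show (n : ℤ) + 1 - ((w.sum : ℤ) + 1) = n - w.sum by ring,
          show (n : ℤ) + 1 - (w.sum : ℤ) = n - w.sum + 1 by ring, ← key]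
        by_cases hk : w.sum < n
        · rw [if_pos hk]; ring
        · have : (n : ℤ) - w.sum = 0 := by omega
          rw [if_neg hk, this]
          simp [qInt]; ring
      · by_cases hk : w.sum < n
        · have hk' : List.sum (1 :: w) < n + 1 := by rw [List.sum_cons]; omega
          rw [if_pos hk, if_pos hk']
          simp [topCoef, h2]; ring
        · have hk' : ¬ List.sum (1 :: w) < n + 1 := by rw [List.sum_cons]; omega
          rw [if_neg hk, if_neg hk']
          simp

theorem topFun_eWord (q : ℂ) (hq0 : q ≠ 0) (hd : q - q⁻¹ ≠ 0) (n : ℕ)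
    (w : List ℕ) (h : List.Forall₂ (fun a s => a ≤ s) w (List.replicate n 1)) :
    w.length = n ∧ topFun q (eWord q (List.replicate n 1) w) =
      qInt q w.sum * qInt q ((n : ℤ) - w.sum + 1) * topCoef q w := by
  induction n generalizing w with
  | zero => simp at h; subst h; simp [eWord, qInt]
  | succ n ih =>
    cases w with
    | nil => simp [List.replicate_succ] at h
    | cons x w =>
      simp only [List.replicate_succ, List.forall₂_cons] at h
      obtain ⟨hx, hw⟩ := h
      obtain ⟨h2, h3⟩ := ih w hw
      refine ⟨by simp [h2], ?_⟩
      have hs := eWord_supported q (List.replicate n 1) w (by simp [h2])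
      simp only [List.length_replicate] at hs
      simp only [List.replicate_succ, eWord, map_add, map_smul]
      rw [topFun_tensRight q x n _ _ hs, h3]
      have hone : qInt q 1 = 1 := by simp [qInt, div_self hd]
      have e1 : q ^ ((w.sum : ℤ) - 1) = q ^ w.sum * q⁻¹ := by
        rw [zpow_sub_one₀ hq0, zpow_natCast]
      interval_cases x
      · simp only [if_true, map_zero, add_zero, smul_eq_mul, topCoef, h2, List.sum_cons, zero_add]
        rw [e1, show (n : ℤ) + 1 - ((w.sum : ℤ) - 1) = ((n + 1 : ℕ) : ℤ) - w.sum + 1 by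
          push_cast; ring, show (n : ℤ) + 1 - (w.sum : ℤ) = n - w.sum + 1 by ring]
        have : q ^ (((1 : ℕ) : ℤ) - 2 * ((0 : ℕ) : ℤ)) = q := by simp
        rw [this]
        field_simp
      · have key := qInt_add_one q hq0 hd (w.sum : ℤ)
        have : q ^ (((1 : ℕ) : ℤ) - 2 * ((1 : ℕ) : ℤ)) = q⁻¹ := by
          rw [show ((1 : ℕ) : ℤ) - 2 * ((1 : ℕ) : ℤ) = -1 by norm_num, zpow_neg_one]
        rw [this]
        simp only [one_ne_zero, if_false, smul_eq_mul, topFun, Finsupp.linearCombination_single,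
          topCoef, h2, List.sum_cons, Nat.sub_self, if_true]
        rw [show ((1 + w.sum : ℕ) : ℤ) = (w.sum : ℤ) + 1 by push_cast; ring, ← key,
          show ((n + 1 : ℕ) : ℤ) - ((w.sum : ℤ) + 1) + 1 = n - w.sum + 1 by push_cast; ring,
          show (n : ℤ) + 1 - (w.sum : ℤ) = n - w.sum + 1 by ring, zpow_natCast]
        simp [hone]
        ring

theorem topProj_actF (q : ℂ) (hq0 : q ≠ 0) (hq : ∀ m : ℤ, m ≠ 0 → q ^ m ≠ 1) (s : ℕ) (v : Words)
    (hv : v ∈ tens (List.replicate s 1)) :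
    topProj q (actF q (List.replicate s 1) v) = actF q [s] (topProj q v) := by
  unfold tens at hv
  rw [Finsupp.supported_eq_span_single] at hv
  induction hv using Submodule.span_induction with
  | mem y hy =>
    obtain ⟨w, hw, rfl⟩ := hy
    obtain ⟨h1, h2, h3⟩ := topFun_fWord q hq0 (qInt_den_ne q hq0 hq) s w hw
    have hs := fWord_supported q (List.replicate s 1) w (by simp [h2])
    have hs' := topProj_eq q (w.sum + 1) _ (Finsupp.supported_mono (t := {l | l.sum = w.sum + 1})
      (by rintro l ⟨_, h⟩; simp only [Set.mem_ofPred_eq]; omega) hs)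
    simp only [actF, Finsupp.linearCombination_single, one_smul, hs', h3]
    by_cases hk : w.sum < s <;> simp [topProj, fWord, hk, weight]
  | zero => simp
  | add a b _ _ ha hb => simp only [map_add, ha, hb]
  | smul c a _ ha => simp only [map_smul, ha]

theorem topProj_actE (q : ℂ) (hq0 : q ≠ 0) (hq : ∀ m : ℤ, m ≠ 0 → q ^ m ≠ 1) (s : ℕ) (v : Words)
    (hv : v ∈ tens (List.replicate s 1)) :
    topProj q (actE q (List.replicate s 1) v) = actE q [s] (topProj q v) := by
  unfold tens at hv
  rw [Finsupp.supported_eq_span_single] at hv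
  induction hv using Submodule.span_induction with
  | mem y hy =>
    obtain ⟨w, hw, rfl⟩ := hy
    obtain ⟨h2, h3⟩ := topFun_eWord q hq0 (qInt_den_ne q hq0 hq) s w hw
    have hs := eWord_supported q (List.replicate s 1) w (by simp [h2])
    by_cases h0 : w.sum = 0
    · have hz : eWord q (List.replicate s 1) w = 0 := by
        have : {l : List ℕ | l.length = (List.replicate s 1).length ∧
            (l.sum : ℤ) = (w.sum : ℤ) - 1} = ∅ := by
          ext l; simp only [Set.mem_ofPred_eq, Set.mem_empty_iff_false, iff_false]; omega
        rw [this, Finsupp.supported_empty] at hs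
        simpa using hs
      simp [actE, hz, topProj, h0, eWord]
    · have hs' := topProj_eq q (w.sum - 1) _ (Finsupp.supported_mono
        (t := {l | l.sum = w.sum - 1})
        (by rintro l ⟨_, h⟩; simp only [Set.mem_ofPred_eq]; omega) hs)
      simp only [actE, Finsupp.linearCombination_single, one_smul, hs', h3]
      simp only [topProj, Finsupp.linearCombination_single, one_smul, eWord, h0, if_false,
        map_zero, smul_zero, zero_add, Finsupp.smul_single, smul_eq_mul]
      congr 1
      ring
  | zero => simp
  | add a b _ _ ha hb => simp only [map_add, ha, hb]
  | smul c a _ ha => simp only [map_smul, ha]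

theorem topProj_actK (q : ℂ) (s : ℕ) (v : Words) (hv : v ∈ tens (List.replicate s 1)) :
    topProj q (actK q (List.replicate s 1) v) = actK q [s] (topProj q v) := by
  unfold tens at hv
  rw [Finsupp.supported_eq_span_single] at hv
  induction hv using Submodule.span_induction with
  | mem y hy =>
    obtain ⟨w, hw, rfl⟩ := hy
    have h2 : w.length = s := by simpa using hw.length_eq
    simp [topProj, actK, weight_replicate s w h2, weight, mul_comm]
  | zero => simp
  | add a b _ _ ha hb => simp only [map_add, ha, hb]
  | smul c a _ ha => simp only [map_smul, ha]

theorem topProj_zero (q : ℂ) (hq0 : q ≠ 0) (hq : ∀ m : ℤ, m ≠ 0 → q ^ m ≠ 1) (s : ℕ) :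
    topProj q (Finsupp.single (List.replicate s 0) 1) = Finsupp.single [0] 1 := by
  have h : topCoef q (List.replicate s 0) = 1 := by
    induction s with
    | zero => rfl
    | succ n ih =>
      simp only [List.replicate_succ, topCoef, ih]
      simpa using div_self (qInt_ne_zero q hq0 hq ((n : ℤ) + 1) (by omega))
  simp [topProj, h]

theorem capCoef_spec (q : ℂ) (hq0 : q ≠ 0) (hq : ∀ m : ℤ, m ≠ 0 → q ^ m ≠ 1) :
    capCoef q 0 0 = 0 ∧ capCoef q 1 1 = 0 ∧ capCoef q 0 1 + q⁻¹ * capCoef q 1 0 = 0 ∧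
      (capCoef q 0 1 - q * capCoef q 1 0) / (q - q⁻¹) = 1 := by
  have hd := qInt_den_ne q hq0 hq
  have h2 := qInt_ne_zero q hq0 hq 2 (by norm_num)
  refine ⟨rfl, rfl, ?_, ?_⟩
  · simp only [capCoef]; field_simp; ring
  · have h3 : qInt q 2 = q⁻¹ + q := by
      have := qInt_add_one q hq0 hd 1
      rw [show qInt q 1 = 1 by simp [qInt, div_self hd]] at this
      simpa using this.symm
    have h4 : capCoef q 0 1 - q * capCoef q 1 0 = (q - q⁻¹) * ((q⁻¹ + q) / qInt q 2) := by
      simp only [capCoef]; field_simp; ring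
    rw [h4, ← h3, div_self h2, mul_one, div_self hd]

/-- The projection `M_2 ⊗ ⋯ ⊗ M_2 → M_{s_p + 1} ⊗ ⋯ ⊗ M_{s_1 + 1}` on a basis vector: the tensor
product of the projections of consecutive blocks of `s_1, …, s_p` components. -/
def blockWord (q : ℂ) : List ℕ → List ℕ → Words
  | [], _ => Finsupp.single [] 1
  | s :: ς, w => topCoef q (w.take s) • tensRight (w.take s).sum (blockWord q ς (w.drop s))

/-- The projection `M_2 ⊗ ⋯ ⊗ M_2 → M_{s_p + 1} ⊗ ⋯ ⊗ M_{s_1 + 1}`. -/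
def blockProj (q : ℂ) (ς : List ℕ) : Words →ₗ[ℂ] Words :=
  Finsupp.linearCombination ℂ (blockWord q ς)

/-- The basis vector of `H_ς^{(0)}` indexed by a link pattern `ω ∈ LP_ς^{(0)}`: the image of
`v_{α(ω)}` under the projection to `M_{s_p + 1} ⊗ ⋯ ⊗ M_{s_1 + 1}`. -/
def basisVec (q : ℂ) (ς : List ℕ) (ω : Diagram) : Words :=
  blockProj q ς (pairVec q (openUp ς ω))

end QLink

end

noncomputable section

namespace QLink

/-! ### Quantum integers -/

/-! The map $S^{(s)}$ is a twisted rotation. An invariant vector is killed by $F$ as well as by $E$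
(`actF_eq_zero`). Reading $F.v=0$ off in the leftmost component gives a recursion expressing every
slice of $v$ through its top slice, and its solution is the formula defining $R_+^{-1}$
(`exists_rPlusInv`). The formulas for $R_+^{-1}$ and $R_-^{-1}$ differ only in the place of $e_l$
and in a power of $q$, so $(-q)^sS^{(s)}$ acts on $\mathsf H^{(0)}_{(\varsigma,s)}$ as `rot`: apply
$(-1)^sK^{-1}$ to the leftmost component and move it to the right (`smul_cyc`).

The scalars of `rot` are multiplicative over a block of components of valence one. Hence the block
projection turns $s$ rotations by one component into one rotation of a component of valence $s$
(`blockProj_rot_pow`). On the combinatorial side, opening up the rotated pattern is the same as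
rotating $\alpha(\omega)$ by $s$ points (`openUp_twist`). What remains is the case of pair
partitions and one step, `pairVec_twist`, proved by induction on the number of links. Both sides are
invariant, and `rot` carries the projection at $j$ to the projection at $j+1$, so their projections
at all positions except the first agree by induction. This is enough with at least four components
(`eq_zero_of_capProj_of_two_le`); for two components `rot` fixes the invariant line.

Uniqueness of the $v_\alpha$ rests on the fact that an invariant vector with all neighbour
projections zero vanishes: it is $q$-symmetric, so it would lie in the top summand of $\mathsf
M_2^{\otimes n}$, which for $n>0$ contains no invariants (`Exchange.eq_zero`). For existence, each
planar pairing defines a functional by contracting along its links. These functionals vanish on the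
image of $F$, and every vector of weight zero is invariant modulo that image, so they can be
evaluated on basis words. There they are triangular for the sum of the left endpoints, which gives a
dual basis of invariants (`exists_dual`). Its members solve the projection equations because the
functionals separate invariants and factor through the neighbour projections. -/

theorem qInt_zero (q : ℂ) : qInt q 0 = 0 := by simp [qInt]

theorem qInt_one (q : ℂ) (hd : q - q⁻¹ ≠ 0) : qInt q 1 = 1 := by simp [qInt, div_self hd]

theorem qInt_add (q : ℂ) (hq0 : q ≠ 0) (a b : ℤ) :
    q ^ a * qInt q b + q ^ (-b) * qInt q a = qInt q (a + b) := by
  simp only [qInt, neg_add, zpow_add₀ hq0, zpow_neg]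
  have ha := zpow_ne_zero a hq0
  have hb := zpow_ne_zero b hq0
  generalize q ^ a = A at *
  generalize q ^ b = B at *
  rw [← mul_div_assoc, ← mul_div_assoc, ← add_div]
  congr 1
  field_simp
  ring

/-- The commutator of $E$ and $F$ on $e_x$ in a single factor $\mathsf M_{s+1}$. -/
theorem qInt_mul_sub (q : ℂ) (hq0 : q ≠ 0) (hd : q - q⁻¹ ≠ 0) (x s : ℤ) :
    qInt q (x + 1) * qInt q (s - x) - qInt q x * qInt q (s - x + 1) = qInt q (s - 2 * x) := by
  have e1 : q ^ (s - 2 * x) = q ^ s / (q ^ x * q ^ x) := by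
    rw [zpow_sub₀ hq0, two_mul, zpow_add₀ hq0]
  simp only [qInt, zpow_neg, e1, zpow_sub₀ hq0, zpow_add₀ hq0, zpow_one]
  have ha := zpow_ne_zero x hq0
  have hb := zpow_ne_zero s hq0
  generalize q ^ x = A at *
  generalize q ^ s = B at *
  have hq2 : q ^ 2 - 1 ≠ 0 := by
    intro h; apply hd; field_simp; rw [h, mul_zero]
  field_simp
  ring

/-- The induction step in the formula for $E^mF$; it is `qInt_mul_sub` with negated arguments. -/
theorem qInt_mul_add (q : ℂ) (hq0 : q ≠ 0) (hd : q - q⁻¹ ≠ 0) (n m : ℤ) :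
    qInt q (n + 2 * m) + qInt q m * qInt q (n + m - 1) = qInt q (m + 1) * qInt q (n + m) := by
  have := qInt_mul_sub q hq0 hd (-m - n) (-n)
  have hneg : ∀ a, qInt q (-a) = -qInt q a := by
    intro a; simp only [qInt, neg_neg]; rw [← neg_div]; congr 1; ring
  rw [show -m - n + 1 = -(n + m - 1) by ring, show -n - (-m - n) = m by ring,
    show -m - n = -(n + m) by ring, hneg, hneg,
    show -n - 2 * -(n + m) = n + 2 * m by ring] at this
  linear_combination -this

/-! ### Linear maps on words -/

theorem eqOn_supported {M : Type*} [AddCommMonoid M] [Module ℂ M] (f g : Words →ₗ[ℂ] M)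
    (S : Set (List ℕ)) (h : ∀ w ∈ S, f (Finsupp.single w 1) = g (Finsupp.single w 1))
    {v : Words} (hv : v ∈ Finsupp.supported ℂ ℂ S) : f v = g v := by
  rw [Finsupp.supported_eq_span_single] at hv
  refine LinearMap.eqOn_span (f := f) (g := g) ?_ hv
  rintro _ ⟨w, hw, rfl⟩
  exact h w hw

theorem mapsTo_supported {M : Type*} [AddCommMonoid M] [Module ℂ M] (f : Words →ₗ[ℂ] M)
    (P : Submodule ℂ M) (S : Set (List ℕ)) (h : ∀ w ∈ S, f (Finsupp.single w 1) ∈ P)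
    {v : Words} (hv : v ∈ Finsupp.supported ℂ ℂ S) : f v ∈ P := by
  rw [Finsupp.supported_eq_span_single] at hv
  have : Submodule.span ℂ ((fun i => Finsupp.single i (1 : ℂ)) '' S) ≤ P.comap f := by
    rw [Submodule.span_le]
    rintro _ ⟨w, hw, rfl⟩
    exact h w hw
  exact this hv

/-- The labels of the word `w` are admissible for the valences `ς`. -/
abbrev Adm (w ς : List ℕ) : Prop := List.Forall₂ (fun a s => a ≤ s) w ς

theorem Adm.append_inv {ς₁ ς₂ w : List ℕ} (h : Adm w (ς₁ ++ ς₂)) :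
    ∃ w₁ w₂, w = w₁ ++ w₂ ∧ Adm w₁ ς₁ ∧ Adm w₂ ς₂ := by
  induction ς₁ generalizing w with
  | nil => exact ⟨[], w, rfl, List.Forall₂.nil, h⟩
  | cons s ς ih =>
    cases h with
    | cons ha h =>
      obtain ⟨w₁, w₂, rfl, h1, h2⟩ := ih h
      exact ⟨_ :: w₁, w₂, rfl, List.Forall₂.cons ha h1, h2⟩

theorem Adm.exists_cons {s : ℕ} {ς w : List ℕ} (h : Adm w (s :: ς)) :
    ∃ x w', w = x :: w' ∧ x ≤ s ∧ Adm w' ς := by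
  obtain _ | ⟨hx, hw⟩ := h
  exact ⟨_, _, rfl, hx, hw⟩

/-- The weight space of the tensor product. -/
def wtSp (ς : List ℕ) (n : ℤ) : Submodule ℂ Words :=
  Finsupp.supported ℂ ℂ {w | Adm w ς ∧ weight ς w = n}

theorem single_mem_wtSp {ς w : List ℕ} {n : ℤ} (h : Adm w ς) (hn : weight ς w = n) (c : ℂ) :
    Finsupp.single w c ∈ wtSp ς n := Finsupp.single_mem_supported ℂ _ ⟨h, hn⟩

theorem eqOn_wtSp {M : Type*} [AddCommMonoid M] [Module ℂ M] (f g : Words →ₗ[ℂ] M)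
    {ς : List ℕ} {n : ℤ} {v : Words} (hv : v ∈ wtSp ς n)
    (h : ∀ w, Adm w ς → weight ς w = n → f (Finsupp.single w 1) = g (Finsupp.single w 1)) :
    f v = g v := eqOn_supported f g _ (fun w hw => h w hw.1 hw.2) hv

@[simp] theorem tensRight_single (l : ℕ) (w : List ℕ) (c : ℂ) :
    tensRight l (Finsupp.single w c) = Finsupp.single (l :: w) c := by
  simp [tensRight, Finsupp.lmapDomain_apply]

@[simp] theorem tensLeft_single (l : ℕ) (w : List ℕ) (c : ℂ) :
    tensLeft l (Finsupp.single w c) = Finsupp.single (w ++ [l]) c := by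
  simp [tensLeft, Finsupp.lmapDomain_apply]

@[simp] theorem actE_single (q : ℂ) (ς w : List ℕ) (c : ℂ) :
    actE q ς (Finsupp.single w c) = c • eWord q ς w := by simp [actE]

@[simp] theorem actF_single (q : ℂ) (ς w : List ℕ) (c : ℂ) :
    actF q ς (Finsupp.single w c) = c • fWord q ς w := by simp [actF]

/-- `w ↦ w ⊗ e_{w₁}`: new first (rightmost) tensor components. -/
def appendRight (w₁ : List ℕ) : Words →ₗ[ℂ] Words :=
  Finsupp.lmapDomain ℂ ℂ (fun w : List ℕ => w₁ ++ w)

/-- `w ↦ e_{w₂} ⊗ w`: new last (leftmost) tensor components. -/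
def appendLeft (w₂ : List ℕ) : Words →ₗ[ℂ] Words :=
  Finsupp.lmapDomain ℂ ℂ (fun w : List ℕ => w ++ w₂)

@[simp] theorem appendRight_single (w₁ w : List ℕ) (c : ℂ) :
    appendRight w₁ (Finsupp.single w c) = Finsupp.single (w₁ ++ w) c := by
  simp [appendRight, Finsupp.lmapDomain_apply]

@[simp] theorem appendLeft_single (w₂ w : List ℕ) (c : ℂ) :
    appendLeft w₂ (Finsupp.single w c) = Finsupp.single (w ++ w₂) c := by
  simp [appendLeft, Finsupp.lmapDomain_apply]

theorem appendLeft_singleton (l : ℕ) : appendLeft [l] = tensLeft l := rfl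

theorem eq_of_eq_single {M : Type*} [AddCommMonoid M] [Module ℂ M] (f g : Words →ₗ[ℂ] M)
    (h : ∀ w, f (Finsupp.single w 1) = g (Finsupp.single w 1)) (u : Words) : f u = g u :=
  LinearMap.congr_fun (Finsupp.lhom_ext' fun w => LinearMap.ext_ring (h w)) u

theorem appendRight_cons (l : ℕ) (w : List ℕ) (u : Words) :
    appendRight (l :: w) u = tensRight l (appendRight w u) :=
  eq_of_eq_single (appendRight (l :: w)) (tensRight l ∘ₗ appendRight w) (by simp) u

theorem appendRight_nil (u : Words) : appendRight [] u = u :=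
  eq_of_eq_single (appendRight []) LinearMap.id (by simp) u

theorem appendLeft_tensRight (l : ℕ) (w : List ℕ) (u : Words) :
    appendLeft w (tensRight l u) = tensRight l (appendLeft w u) :=
  eq_of_eq_single (appendLeft w ∘ₗ tensRight l) (tensRight l ∘ₗ appendLeft w) (by simp) u

/-! ### The generators on tensor products -/

theorem weight_append {ς₁ w₁ : List ℕ} (h : w₁.length = ς₁.length) (ς₂ w₂ : List ℕ) :
    weight (ς₁ ++ ς₂) (w₁ ++ w₂) = weight ς₁ w₁ + weight ς₂ w₂ := by
  induction ς₁ generalizing w₁ with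
  | nil => simp at h; subst h; simp [weight]
  | cons s ς ih =>
    cases w₁ with
    | nil => simp at h
    | cons x w => simp only [List.cons_append, weight, ih (by simpa using h), add_assoc]

/-- Coassociativity: the recursive definition peels off one factor, whereas the block projections
need the coproduct for two blocks of factors. -/
theorem eWord_append (q : ℂ) (hq0 : q ≠ 0) {ς₁ w₁ : List ℕ} (h : w₁.length = ς₁.length)
    (ς₂ w₂ : List ℕ) :
    eWord q (ς₁ ++ ς₂) (w₁ ++ w₂) =
      q ^ weight ς₁ w₁ • appendRight w₁ (eWord q ς₂ w₂) + appendLeft w₂ (eWord q ς₁ w₁) := by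
  induction ς₁ generalizing w₁ with
  | nil => simp at h; subst h; simp [weight, eWord, appendRight_nil]
  | cons s ς ih =>
    cases w₁ with
    | nil => simp at h
    | cons x w =>
      simp only [List.cons_append, eWord, ih (w₁ := w) (by simpa using h), weight, map_add,
        map_smul, appendRight_cons, appendLeft_tensRight, smul_add, smul_smul, zpow_add₀ hq0,
        add_assoc]
      congr 2
      split_ifs <;> simp [-Finsupp.single_mul]

theorem fWord_append (q : ℂ) (hq0 : q ≠ 0) {ς₁ w₁ : List ℕ} (h : w₁.length = ς₁.length)
    (ς₂ w₂ : List ℕ) :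
    fWord q (ς₁ ++ ς₂) (w₁ ++ w₂) =
      appendRight w₁ (fWord q ς₂ w₂) + q ^ (-weight ς₂ w₂) • appendLeft w₂ (fWord q ς₁ w₁) := by
  induction ς₁ generalizing w₁ with
  | nil => simp at h; subst h; simp [fWord, appendRight_nil]
  | cons s ς ih =>
    cases w₁ with
    | nil => simp at h
    | cons x w =>
      have hw : w.length = ς.length := by simpa using h
      simp only [List.cons_append, fWord, ih (w₁ := w) hw, map_add,
        map_smul, appendRight_cons, appendLeft_tensRight, smul_add,
        add_assoc, weight_append hw, neg_add]
      congr 2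
      split_ifs
      · simp [zpow_add₀ hq0, mul_comm]
      · simp

theorem actE_tensRight (q : ℂ) (s : ℕ) (ς : List ℕ) (x : ℕ) (u : Words) :
    actE q (s :: ς) (tensRight x u) = q ^ ((s : ℤ) - 2 * x) • tensRight x (actE q ς u) +
      (if x = 0 then 0 else qInt q x * qInt q ((s : ℤ) - x + 1)) • tensRight (x - 1) u := by
  refine eq_of_eq_single (actE q (s :: ς) ∘ₗ tensRight x)
    (q ^ ((s : ℤ) - 2 * x) • (tensRight x ∘ₗ actE q ς) +
      (if x = 0 then 0 else qInt q x * qInt q ((s : ℤ) - x + 1)) • tensRight (x - 1)) ?_ u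
  intro w
  simp only [LinearMap.comp_apply, tensRight_single, actE_single, one_smul, eWord,
    LinearMap.add_apply, LinearMap.smul_apply]
  split_ifs <;> simp

/-- A weight vector is required because $K^{-1}$ must act on the remaining factors by a scalar. -/
theorem actF_tensRight (q : ℂ) (s : ℕ) (ς : List ℕ) (x : ℕ) {m : ℤ} {u : Words}
    (hu : u ∈ wtSp ς m) :
    actF q (s :: ς) (tensRight x u) = tensRight x (actF q ς u) +
      (if x < s then q ^ (-m) else 0) • tensRight (x + 1) u := by
  refine eqOn_supported (actF q (s :: ς) ∘ₗ tensRight x)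
    (tensRight x ∘ₗ actF q ς + (if x < s then q ^ (-m) else 0) • tensRight (x + 1)) _ ?_ hu
  rintro w ⟨-, hw⟩
  simp only [LinearMap.comp_apply, tensRight_single, actF_single, one_smul, fWord,
    LinearMap.add_apply, LinearMap.smul_apply, hw]
  split_ifs <;> simp

theorem tensRight_mem_wtSp {ς : List ℕ} {m n : ℤ} {s x : ℕ} {u : Words} (hx : x ≤ s)
    (hu : u ∈ wtSp ς m) (hn : s - 2 * x + m = n) : tensRight x u ∈ wtSp (s :: ς) n := by
  refine tensRight_supported x _ _ _ hu ?_
  rintro w ⟨h1, h2⟩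
  exact ⟨List.Forall₂.cons hx h1, by simp only [weight, h2, hn]⟩

theorem eWord_mem (q : ℂ) {ς w : List ℕ} (h : Adm w ς) :
    eWord q ς w ∈ wtSp ς (weight ς w + 2) := by
  induction h with
  | nil => simp [eWord]
  | @cons x s w ς hx hw ih =>
    refine Submodule.add_mem _ (Submodule.smul_mem _ _
      (tensRight_mem_wtSp hx ih (by simp only [weight]; ring))) ?_
    split_ifs with h0
    · exact Submodule.zero_mem _
    · refine single_mem_wtSp (List.Forall₂.cons (by omega) hw) ?_ _
      simp only [weight]; omega

theorem fWord_mem (q : ℂ) {ς w : List ℕ} (h : Adm w ς) :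
    fWord q ς w ∈ wtSp ς (weight ς w - 2) := by
  induction h with
  | nil => simp [fWord]
  | @cons x s w ς hx hw ih =>
    refine Submodule.add_mem _ (tensRight_mem_wtSp hx ih (by simp only [weight]; ring)) ?_
    split_ifs with h0
    · refine single_mem_wtSp (List.Forall₂.cons (by omega) hw) ?_ _
      simp only [weight]; push_cast; ring
    · exact Submodule.zero_mem _

theorem actE_mem (q : ℂ) {ς : List ℕ} {n : ℤ} {u : Words} (hu : u ∈ wtSp ς n) :
    actE q ς u ∈ wtSp ς (n + 2) := by
  refine mapsTo_supported _ _ _ ?_ hu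
  rintro w ⟨h1, rfl⟩
  simpa using eWord_mem q h1

theorem actF_mem (q : ℂ) {ς : List ℕ} {n : ℤ} {u : Words} (hu : u ∈ wtSp ς n) :
    actF q ς u ∈ wtSp ς (n - 2) := by
  refine mapsTo_supported _ _ _ ?_ hu
  rintro w ⟨h1, rfl⟩
  simpa using fWord_mem q h1

/-- Induction on the number of factors: the mixed terms cancel (`key2`), and the two diagonal
commutators combine by `qInt_add` (`key`). -/
theorem commutator_word (q : ℂ) (hq0 : q ≠ 0) (hd : q - q⁻¹ ≠ 0) {ς w : List ℕ} (h : Adm w ς) :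
    actE q ς (fWord q ς w) =
      actF q ς (eWord q ς w) + qInt q (weight ς w) • Finsupp.single w 1 := by
  induction h with
  | nil => simp [fWord, eWord, weight, qInt_zero]
  | @cons x s w ς hx hw ih =>
    set m := weight ς w with hm
    have hF : fWord q (s :: ς) (x :: w) = tensRight x (fWord q ς w) +
        (if x < s then q ^ (-m) else 0) • tensRight (x + 1) (Finsupp.single w 1) := by
      simp only [fWord]; split_ifs <;> simp [hm]
    have hE : eWord q (s :: ς) (x :: w) = q ^ ((s : ℤ) - 2 * x) • tensRight x (eWord q ς w) +
        (if x = 0 then 0 else qInt q x * qInt q ((s : ℤ) - x + 1)) •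
          tensRight (x - 1) (Finsupp.single w 1) := by
      simp only [eWord]; split_ifs <;> simp
    have hw1 : Finsupp.single w 1 ∈ wtSp ς m := single_mem_wtSp hw hm.symm 1
    rw [hF, hE, map_add, map_add, map_smul, map_smul, map_smul, actE_tensRight, actE_tensRight,
      actF_tensRight q s ς x (eWord_mem q hw), actF_tensRight q s ς (x - 1) hw1, ih, actE_single,
      actF_single, ← hm, one_smul, one_smul]
    have hs1 : Finsupp.single (x :: w) (1 : ℂ) = tensRight x (Finsupp.single w 1) := by simp
    rw [hs1]
    simp only [weight, ← hm, Nat.add_sub_cancel, Nat.cast_add, Nat.cast_one, Nat.succ_ne_zero,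
      if_false, map_add, map_smul, smul_add, smul_smul]
    have hx0 : x ≠ 0 → x - 1 + 1 = x := fun h => by omega
    -- At the ends $x=0$ and $x=s$ the truncated actions of $E$ and $F$ agree with the general
    -- formula because $[0]=0$.
    have key : q ^ ((s : ℤ) - 2 * x) * qInt q m + (if x < s then q ^ (-m) else 0) *
        (qInt q (x + 1) * qInt q ((s : ℤ) - (x + 1) + 1)) =
        (if x = 0 then 0 else qInt q x * qInt q ((s : ℤ) - x + 1)) *
          (if x - 1 < s then q ^ (-m) else 0) + qInt q (s - 2 * x + m) := by
      have h1 := qInt_mul_sub q hq0 hd x s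
      have h2 := qInt_add q hq0 ((s : ℤ) - 2 * x) m
      rw [← h2, ← h1, show (s : ℤ) - (x + 1) + 1 = s - x by ring]
      by_cases h3 : x = 0
      · subst h3
        by_cases h4 : 0 < s
        · simp [h4, qInt_zero]
        · have : s = 0 := by omega
          subst this; simp [qInt_zero]
      · have h5 : x - 1 < s := by omega
        by_cases h4 : x < s
        · simp only [h3, h4, h5, if_true, if_false]; ring
        · have : x = s := by omega
          subst this
          simp only [h3, h4, h5, if_true, if_false, sub_self, qInt_zero]; ring
    -- Raising the label $x$ and applying $E$ to the other factors both shift the exponent by $-2$.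
    have key2 : (if x < s then q ^ (-m) else 0) * q ^ ((s : ℤ) - 2 * (x + 1)) =
        q ^ ((s : ℤ) - 2 * x) * (if x < s then q ^ (-(m + 2)) else 0) := by
      split_ifs
      · rw [← zpow_add₀ hq0, ← zpow_add₀ hq0]; congr 1; ring
      · simp
    by_cases h0 : x = 0
    · subst h0
      simp only [if_true, zero_smul, add_zero, zero_mul, zero_add] at key key2 ⊢
      rw [key2, ← key]
      module
    · rw [hx0 h0, key2]
      linear_combination (norm := module) key • tensRight x (Finsupp.single w 1)

/-! ### Highest weight vectors -/

theorem finite_adm (ς : List ℕ) : {w | Adm w ς}.Finite := by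
  induction ς with
  | nil => refine (Set.finite_singleton []).subset ?_; intro w hw; simpa using hw
  | cons s ς ih =>
    refine ((Set.finite_Iic s).image2 List.cons ih).subset ?_
    rintro w hw
    cases hw with
    | cons h1 h2 => exact ⟨_, h1, _, h2, rfl⟩

instance finiteDimensional_wtSp (ς : List ℕ) (n : ℤ) : FiniteDimensional ℂ (wtSp ς n) := by
  have : Finite {w | Adm w ς ∧ weight ς w = n} := ((finite_adm ς).subset fun _ h => h.1).to_subtype
  exact Module.Finite.equiv (Finsupp.supportedEquivFinsupp (R := ℂ) (M := ℂ)
    {w | Adm w ς ∧ weight ς w = n}).symm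

theorem abs_weight_le {ς w : List ℕ} (h : Adm w ς) : |weight ς w| ≤ ς.sum := by
  induction h with
  | nil => simp [weight]
  | @cons x s w ς hx hw ih =>
    rw [abs_le] at ih ⊢
    simp only [weight, List.sum_cons, Nat.cast_add]
    constructor <;> omega

theorem eq_zero_of_mem_wtSp {ς : List ℕ} {n : ℤ} (hn : (ς.sum : ℤ) < |n|) {u : Words}
    (hu : u ∈ wtSp ς n) : u = 0 := by
  have : {w | Adm w ς ∧ weight ς w = n} = ∅ := by
    ext w
    simp only [Set.mem_ofPred_eq, Set.mem_empty_iff_false, iff_false]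
    rintro ⟨h1, rfl⟩
    exact absurd (abs_weight_le h1) (not_le.mpr hn)
  rw [wtSp, this, Finsupp.supported_empty] at hu
  simpa using hu

theorem commutator (q : ℂ) (hq0 : q ≠ 0) (hd : q - q⁻¹ ≠ 0) {ς : List ℕ} {n : ℤ} {u : Words}
    (hu : u ∈ wtSp ς n) : actE q ς (actF q ς u) = actF q ς (actE q ς u) + qInt q n • u := by
  refine eqOn_supported (actE q ς ∘ₗ actF q ς) (actF q ς ∘ₗ actE q ς + qInt q n • LinearMap.id)
    _ ?_ hu
  rintro w ⟨h1, rfl⟩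
  simpa using commutator_word q hq0 hd h1

theorem actE_pow_mem (q : ℂ) {ς : List ℕ} {n : ℤ} {u : Words} (hu : u ∈ wtSp ς n) (m : ℕ) :
    (actE q ς ^ m) u ∈ wtSp ς (n + 2 * m) := by
  induction m with
  | zero => simpa using hu
  | succ m ih =>
    rw [pow_succ', Module.End.mul_apply]
    have := actE_mem q ih
    rwa [show n + 2 * m + 2 = n + 2 * (m + 1 : ℕ) by push_cast; ring] at this

theorem actF_pow_mem (q : ℂ) {ς : List ℕ} {n : ℤ} {u : Words} (hu : u ∈ wtSp ς n) (m : ℕ) :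
    (actF q ς ^ m) u ∈ wtSp ς (n - 2 * m) := by
  induction m with
  | zero => simpa using hu
  | succ m ih =>
    rw [pow_succ', Module.End.mul_apply]
    have := actF_mem q ih
    rwa [show n - 2 * m - 2 = n - 2 * (m + 1 : ℕ) by push_cast; ring] at this

theorem actE_pow_actF (q : ℂ) (hq0 : q ≠ 0) (hd : q - q⁻¹ ≠ 0) {ς : List ℕ} {n : ℤ} {u : Words}
    (hu : u ∈ wtSp ς n) (m : ℕ) :
    (actE q ς ^ (m + 1)) (actF q ς u) = actF q ς ((actE q ς ^ (m + 1)) u) +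
      (qInt q (m + 1) * qInt q (n + m)) • (actE q ς ^ m) u := by
  induction m with
  | zero => simpa [qInt_one q hd] using commutator q hq0 hd hu
  | succ m ih =>
    have h1 := commutator q hq0 hd (actE_pow_mem q hu (m + 1))
    have h2 := qInt_mul_add q hq0 hd n (m + 1)
    have h3 : ∀ (k : ℕ) v, (actE q ς ^ (k + 1)) v = actE q ς ((actE q ς ^ k) v) := by
      intro k v; rw [pow_succ', Module.End.mul_apply]
    rw [h3 (m + 1), ih, map_add, h1, map_smul, ← h3, ← h3, add_assoc, ← add_smul]
    congr 2
    push_cast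
    rw [← h2]
    congr 3
    ring

/-- Take the least power of $E$ that kills $u$. If it were $E^{m+1}$, then `actE_pow_actF` would
give $[m+1][n+m]E^mu=0$ with both quantum integers nonzero, against minimality. -/
theorem actE_actF_injective (q : ℂ) (hq0 : q ≠ 0) (hq : ∀ m : ℤ, m ≠ 0 → q ^ m ≠ 1) {ς : List ℕ}
    {n : ℤ} (hn : 0 < n) {u : Words} (hu : u ∈ wtSp ς n) (h : actE q ς (actF q ς u) = 0) :
    u = 0 := by
  have hd := qInt_den_ne q hq0 hq
  have hex : ∃ m, (actE q ς ^ m) u = 0 := by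
    refine ⟨ς.sum, eq_zero_of_mem_wtSp ?_ (actE_pow_mem q hu _)⟩
    rw [abs_of_pos (by omega)]; omega
  classical
  obtain ⟨hm, hmin⟩ := (Nat.find_eq_iff hex).mp rfl
  cases hf : Nat.find hex with
  | zero => simpa [hf] using hm
  | succ m =>
    rw [hf] at hm hmin
    exfalso
    have h1 := actE_pow_actF q hq0 hd hu m
    rw [hm, pow_succ, Module.End.mul_apply, h, map_zero, map_zero, zero_add] at h1
    rcases smul_eq_zero.mp h1.symm with h2 | h2
    · rcases mul_eq_zero.mp h2 with h3 | h3
      · exact qInt_ne_zero q hq0 hq _ (by omega) h3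
      · exact qInt_ne_zero q hq0 hq _ (by omega) h3
    · exact hmin m (Nat.lt_succ_self m) h2

/-- Every vector of weight zero is a sum of a highest weight vector and a vector in the image
of `F`. -/
theorem exists_actE_sub_actF (q : ℂ) (hq0 : q ≠ 0) (hq : ∀ m : ℤ, m ≠ 0 → q ^ m ≠ 1)
    {ς : List ℕ} {w : Words} (hw : w ∈ wtSp ς 0) :
    ∃ u ∈ wtSp ς 2, actE q ς (w - actF q ς u) = 0 := by
  have hmaps : ∀ u ∈ wtSp ς 2, (actE q ς ∘ₗ actF q ς) u ∈ wtSp ς 2 := by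
    intro u hu
    simpa using actE_mem q (actF_mem q hu)
  -- On the finite-dimensional space of weight 2 the map $EF$ is injective, hence surjective, so
  -- $E.w=EF.u$ can be solved without appeal to complete reducibility.
  let T := (actE q ς ∘ₗ actF q ς).restrict hmaps
  have hinj : Function.Injective T := by
    rintro ⟨u, hu⟩ ⟨u', hu'⟩ h
    have h1 : actE q ς (actF q ς u) = actE q ς (actF q ς u') := congrArg Subtype.val h
    exact Subtype.ext (sub_eq_zero.mp (actE_actF_injective q hq0 hq two_pos
      (Submodule.sub_mem _ hu hu') (by rw [map_sub, map_sub, h1, sub_self])))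
  have hE : actE q ς w ∈ wtSp ς 2 := by simpa using actE_mem q hw
  obtain ⟨⟨u, hu⟩, h⟩ := LinearMap.surjective_of_injective (K := ℂ) (V := wtSp ς 2)
    (f := T) hinj ⟨_, hE⟩
  have h1 : actE q ς (actF q ς u) = actE q ς w := congrArg Subtype.val h
  exact ⟨u, hu, by rw [map_sub, h1, sub_self]⟩

theorem actE_actF_pow (q : ℂ) (hq0 : q ≠ 0) (hd : q - q⁻¹ ≠ 0) {ς : List ℕ} {u : Words}
    (hu : u ∈ wtSp ς 0) (h : actE q ς u = 0) (m : ℕ) :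
    actE q ς ((actF q ς ^ (m + 1)) u) = (qInt q (m + 1) * qInt q (-m)) • (actF q ς ^ m) u := by
  induction m with
  | zero => simpa [h, qInt_zero] using commutator q hq0 hd hu
  | succ m ih =>
    have h1 := commutator q hq0 hd (actF_pow_mem q hu (m + 1))
    have h2 := qInt_mul_sub q hq0 hd (m + 1) 0
    rw [pow_succ', Module.End.mul_apply, h1, ih, map_smul, ← Module.End.mul_apply, ← pow_succ',
      ← add_smul]
    congr 1
    push_cast
    rw [show (0 : ℤ) - 2 * (m + 1) = 0 - 2 * (m + 1) by ring] at h2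
    rw [← h2, zero_sub, show -((m : ℤ) + 1) + 1 = -m by ring]
    ring

/-- Large powers of $F$ kill $u$ by weight. As $EF^{m+1}u=[m+1][-m]F^mu$ with nonzero coefficient
for $m\ge1$, the vanishing descends to $F.u=0$. -/
theorem actF_eq_zero (q : ℂ) (hq0 : q ≠ 0) (hq : ∀ m : ℤ, m ≠ 0 → q ^ m ≠ 1) {ς : List ℕ}
    {u : Words} (hu : u ∈ wtSp ς 0) (h : actE q ς u = 0) : actF q ς u = 0 := by
  have hd := qInt_den_ne q hq0 hq
  have hex : ∃ m, (actF q ς ^ (m + 1)) u = 0 := by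
    refine ⟨ς.sum, eq_zero_of_mem_wtSp ?_ (actF_pow_mem q hu _)⟩
    rw [abs_of_neg (by omega)]; omega
  classical
  obtain ⟨hm, hmin⟩ := (Nat.find_eq_iff hex).mp rfl
  cases hf : Nat.find hex with
  | zero => simpa [hf] using hm
  | succ m =>
    rw [hf] at hm hmin
    exfalso
    have h1 := actE_actF_pow q hq0 hd hu h (m + 1)
    rw [hm, map_zero] at h1
    rcases smul_eq_zero.mp h1.symm with h2 | h2
    · rcases mul_eq_zero.mp h2 with h3 | h3
      · exact qInt_ne_zero q hq0 hq _ (by omega) h3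
      · exact qInt_ne_zero q hq0 hq _ (by omega) h3
    · exact hmin m (Nat.lt_succ_self m) h2

theorem actK_apply (q : ℂ) (ς : List ℕ) (v : Words) (w : List ℕ) :
    actK q ς v w = q ^ weight ς w * v w := by
  refine eq_of_eq_single (Finsupp.lapply w ∘ₗ actK q ς) (q ^ weight ς w • Finsupp.lapply w) ?_ v
  intro w'
  simp only [actK, LinearMap.comp_apply, Finsupp.linearCombination_single, one_smul,
    Finsupp.lapply_apply, LinearMap.smul_apply, smul_eq_mul, Finsupp.single_apply]
  split_ifs with h
  · simp [h]
  · simp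

/-- Since $q$ is not a root of unity, the eigenvalue of $K$ determines the integer weight. -/
theorem mem_hwSpace_iff (q : ℂ) (hq0 : q ≠ 0) (hq : ∀ m : ℤ, m ≠ 0 → q ^ m ≠ 1) (ς : List ℕ)
    (s : ℕ) (v : Words) : v ∈ hwSpace q ς s ↔ v ∈ wtSp ς s ∧ actE q ς v = 0 := by
  simp only [hwSpace, Submodule.mem_inf, LinearMap.mem_ker, tens, wtSp, Finsupp.mem_supported]
  constructor
  · rintro ⟨⟨h1, h2⟩, h3⟩
    refine ⟨fun w hw => ⟨h1 hw, ?_⟩, h2⟩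
    have h4 := DFunLike.congr_fun h3 w
    simp only [LinearMap.sub_apply, LinearMap.smul_apply, LinearMap.id_apply, Finsupp.sub_apply,
      actK_apply, Finsupp.smul_apply, smul_eq_mul, Finsupp.coe_zero, Pi.zero_apply] at h4
    have hw0 : v w ≠ 0 := by simpa using hw
    rw [← sub_mul] at h4
    have h5 := sub_eq_zero.mp ((mul_eq_zero.mp h4).resolve_right hw0)
    by_contra hne
    apply hq (weight ς w - s) (by omega)
    rw [zpow_sub₀ hq0, h5, zpow_natCast, div_self (pow_ne_zero _ hq0)]
  · rintro ⟨h1, h2⟩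
    refine ⟨⟨fun w hw => (h1 hw).1, h2⟩, ?_⟩
    ext w
    simp only [LinearMap.sub_apply, LinearMap.smul_apply, LinearMap.id_apply, Finsupp.sub_apply,
      actK_apply, Finsupp.smul_apply, smul_eq_mul, Finsupp.coe_zero, Pi.zero_apply]
    by_cases hw : v w = 0
    · simp [hw]
    · have : weight ς w = s := (h1 (by simpa using hw)).2
      rw [this, zpow_natCast, sub_self]

/-! ### Projections of neighbouring tensor components -/

@[simp] theorem capProj_single (q : ℂ) (j : ℕ) (w : List ℕ) (c : ℂ) :
    capProj q j (Finsupp.single w c) = Finsupp.single (w.take (j - 1) ++ w.drop (j + 1))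
      (c * capCoef q (w.getD (j - 1) 0) (w.getD j 0)) := by simp [capProj]

theorem capProj_tensRight (q : ℂ) (j x : ℕ) (hj : 1 ≤ j) (u : Words) :
    capProj q (j + 1) (tensRight x u) = tensRight x (capProj q j u) := by
  obtain ⟨j, rfl⟩ := Nat.exists_eq_add_of_le' hj
  refine eq_of_eq_single (capProj q (j + 1 + 1) ∘ₗ tensRight x) (tensRight x ∘ₗ capProj q (j + 1))
    ?_ u
  intro w
  simp

theorem capProj_one (q : ℂ) (a b : ℕ) (u : Words) :
    capProj q 1 (tensRight a (tensRight b u)) = capCoef q a b • u := by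
  refine eq_of_eq_single (capProj q 1 ∘ₗ tensRight a ∘ₗ tensRight b)
    (capCoef q a b • LinearMap.id) ?_ u
  intro w
  simp

theorem capProj_word_mem (q : ℂ) (j n : ℕ) (hj : 1 ≤ j) (hn : j ≤ n + 1) {w : List ℕ}
    (h : Adm w (List.replicate (n + 2) 1)) :
    capProj q j (Finsupp.single w 1) ∈
      wtSp (List.replicate n 1) (weight (List.replicate (n + 2) 1) w) := by
  induction j, hj using Nat.le_induction generalizing n w with
  | base =>
    simp only [List.replicate_succ] at h
    obtain ⟨a, w, rfl, ha, hw⟩ := h.exists_cons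
    obtain ⟨b, w, rfl, hb, hw⟩ := hw.exists_cons
    rw [← tensRight_single, ← tensRight_single, capProj_one]
    have h1 : weight (List.replicate (n + 2) 1) (a :: b :: w) =
        2 - 2 * (a : ℤ) - 2 * b + weight (List.replicate n 1) w := by
      simp only [List.replicate_succ, weight]; push_cast; ring
    by_cases hab : a + b = 1
    · refine Submodule.smul_mem _ _ (single_mem_wtSp hw ?_ 1)
      rw [h1]; omega
    · have : capCoef q a b = 0 := by interval_cases a <;> interval_cases b <;> simp_all [capCoef]
      simp [this]
  | succ j hj ih =>
    obtain ⟨n, rfl⟩ : ∃ k, n = k + 1 := ⟨n - 1, by omega⟩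
    rw [List.replicate_succ] at h ⊢
    obtain ⟨a, w, rfl, ha, hw⟩ := h.exists_cons
    rw [← tensRight_single, capProj_tensRight q j _ hj]
    exact tensRight_mem_wtSp ha (ih n (by omega) hw) rfl

theorem capProj_mem (q : ℂ) {j n : ℕ} (hj : 1 ≤ j) (hn : j ≤ n + 1) {m : ℤ} {u : Words}
    (hu : u ∈ wtSp (List.replicate (n + 2) 1) m) : capProj q j u ∈ wtSp (List.replicate n 1) m := by
  refine mapsTo_supported _ _ _ ?_ hu
  rintro w ⟨h1, rfl⟩
  exact capProj_word_mem q j n hj hn h1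

/-- Induction on $j$ reduces to the first two factors. There only the labels $1,1$ need a relation
between the coefficients, the third one in `capCoef_spec`. -/
theorem capProj_eWord (q : ℂ) (hq0 : q ≠ 0) (hq : ∀ m : ℤ, m ≠ 0 → q ^ m ≠ 1) (j n : ℕ)
    (hj : 1 ≤ j) (hn : j ≤ n + 1) {w : List ℕ} (h : Adm w (List.replicate (n + 2) 1)) :
    capProj q j (actE q (List.replicate (n + 2) 1) (Finsupp.single w 1)) =
      actE q (List.replicate n 1) (capProj q j (Finsupp.single w 1)) := by
  induction j, hj using Nat.le_induction generalizing n w with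
  | base =>
    simp only [List.replicate_succ] at h ⊢
    obtain ⟨a, w, rfl, ha, hw⟩ := h.exists_cons
    obtain ⟨b, w, rfl, hb, hw⟩ := hw.exists_cons
    obtain ⟨h00, h11, h01, -⟩ := capCoef_spec q hq0 hq
    have h1 := qInt_one q (qInt_den_ne q hq0 hq)
    simp only [← tensRight_single, actE_tensRight, map_add, map_smul, capProj_one, smul_add,
      smul_smul]
    interval_cases a <;> interval_cases b <;>
      simp [h00, h11, h1, mul_inv_cancel₀ hq0, inv_mul_cancel₀ hq0, -Finsupp.single_mul]
    have : q⁻¹ * capCoef q 1 0 + capCoef q 0 1 = 0 := by rw [← h01]; ring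
    rw [← Finsupp.single_add, this, Finsupp.single_zero]
  | succ j hj ih =>
    obtain ⟨n, rfl⟩ : ∃ k, n = k + 1 := ⟨n - 1, by omega⟩
    rw [List.replicate_succ] at h
    obtain ⟨a, w, rfl, ha, hw⟩ := h.exists_cons
    rw [List.replicate_succ, List.replicate_succ (n := n), ← tensRight_single, actE_tensRight,
      map_add, map_smul, map_smul, capProj_tensRight q j _ hj, capProj_tensRight q j _ hj,
      ih n (by omega) hw, capProj_tensRight q j _ hj, actE_tensRight]

theorem capProj_actE (q : ℂ) (hq0 : q ≠ 0) (hq : ∀ m : ℤ, m ≠ 0 → q ^ m ≠ 1) {j n : ℕ}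
    (hj : 1 ≤ j) (hn : j ≤ n + 1) {m : ℤ} {u : Words}
    (hu : u ∈ wtSp (List.replicate (n + 2) 1) m) :
    capProj q j (actE q (List.replicate (n + 2) 1) u) =
      actE q (List.replicate n 1) (capProj q j u) := by
  rw [← LinearMap.comp_apply, ← LinearMap.comp_apply]
  refine eqOn_wtSp _ _ hu fun w hw _ => ?_
  rw [LinearMap.comp_apply, LinearMap.comp_apply]
  exact capProj_eWord q hq0 hq j n hj hn hw

/-- As for $E$, with the labels $0,0$ now the only ones that use the relation from `capCoef_spec`.
-/
theorem capProj_fWord (q : ℂ) (hq0 : q ≠ 0) (hq : ∀ m : ℤ, m ≠ 0 → q ^ m ≠ 1) (j n : ℕ)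
    (hj : 1 ≤ j) (hn : j ≤ n + 1) {w : List ℕ} (h : Adm w (List.replicate (n + 2) 1)) :
    capProj q j (actF q (List.replicate (n + 2) 1) (Finsupp.single w 1)) =
      actF q (List.replicate n 1) (capProj q j (Finsupp.single w 1)) := by
  induction j, hj using Nat.le_induction generalizing n w with
  | base =>
    simp only [List.replicate_succ] at h ⊢
    obtain ⟨a, w, rfl, ha, hw⟩ := h.exists_cons
    obtain ⟨b, w, rfl, hb, hw⟩ := hw.exists_cons
    obtain ⟨h00, h11, h01, -⟩ := capCoef_spec q hq0 hq
    have h1 := single_mem_wtSp hw rfl 1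
    have h2 := tensRight_mem_wtSp (ς := List.replicate n 1) (s := 1) hb h1 rfl
    simp only [← tensRight_single, actF_tensRight q 1 _ _ h1, actF_tensRight q 1 _ _ h2, map_add,
      map_smul, capProj_one, smul_smul]
    interval_cases a <;> interval_cases b <;> simp [h00, h11, -Finsupp.single_mul]
    have : q ^ (-weight (List.replicate n 1) w) * capCoef q 0 1 +
        q ^ (-weight (List.replicate n 1) w + -1) * capCoef q 1 0 = 0 := by
      rw [zpow_add₀ hq0, zpow_neg_one, mul_assoc, ← mul_add, h01, mul_zero]
    rw [zpow_neg] at this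
    rw [← Finsupp.single_add, this, Finsupp.single_zero]
  | succ j hj ih =>
    obtain ⟨n, rfl⟩ : ∃ k, n = k + 1 := ⟨n - 1, by omega⟩
    rw [List.replicate_succ] at h
    obtain ⟨a, w, rfl, ha, hw⟩ := h.exists_cons
    rw [List.replicate_succ, List.replicate_succ (n := n), ← tensRight_single,
      actF_tensRight q 1 _ _ (single_mem_wtSp hw rfl 1),
      map_add, map_smul, capProj_tensRight q j _ hj, capProj_tensRight q j _ hj,
      ih n (by omega) hw, capProj_tensRight q j _ hj,
      actF_tensRight q 1 _ _ (capProj_word_mem q j n hj (by omega) hw)]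

theorem capProj_actF (q : ℂ) (hq0 : q ≠ 0) (hq : ∀ m : ℤ, m ≠ 0 → q ^ m ≠ 1) {j n : ℕ}
    (hj : 1 ≤ j) (hn : j ≤ n + 1) {m : ℤ} {u : Words}
    (hu : u ∈ wtSp (List.replicate (n + 2) 1) m) :
    capProj q j (actF q (List.replicate (n + 2) 1) u) =
      actF q (List.replicate n 1) (capProj q j u) := by
  rw [← LinearMap.comp_apply, ← LinearMap.comp_apply]
  refine eqOn_wtSp _ _ hu fun w hw _ => ?_
  rw [LinearMap.comp_apply, LinearMap.comp_apply]
  exact capProj_fWord q hq0 hq j n hj hn hw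

/-! ### Vectors with vanishing projections -/

/-- The coefficient of `e_x` in the first (rightmost) tensor component. -/
def headSlice (x : ℕ) : Words →ₗ[ℂ] Words :=
  Finsupp.lcomapDomain (fun w : List ℕ => x :: w) (List.cons_injective)

theorem headSlice_apply (x : ℕ) (v : Words) (w : List ℕ) : headSlice x v w = v (x :: w) := rfl

theorem headSlice_tensRight (x y : ℕ) (v : Words) :
    headSlice x (tensRight y v) = if x = y then v else 0 := by
  have : headSlice x ∘ₗ tensRight y = if x = y then LinearMap.id else 0 := by
    refine LinearMap.ext (eq_of_eq_single _ _ fun w => ?_)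
    ext w'
    simp only [LinearMap.comp_apply, tensRight_single, headSlice_apply, Finsupp.single_apply,
      List.cons.injEq]
    by_cases hxy : x = y
    · simp [hxy, Finsupp.single_apply]
    · simp [hxy, Ne.symm hxy]
  rw [← LinearMap.comp_apply, this]
  split_ifs <;> rfl

theorem headSlice_mem {ς : List ℕ} {s x : ℕ} {n : ℤ} {v : Words} (hv : v ∈ wtSp (s :: ς) n) :
    headSlice x v ∈ wtSp ς (n - (s - 2 * x)) := by
  refine mapsTo_supported _ _ _ ?_ hv
  rintro w ⟨hw, rfl⟩
  obtain _ | ⟨hy, hw⟩ := hw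
  rw [← tensRight_single, headSlice_tensRight]
  split_ifs with h
  · subst h
    exact single_mem_wtSp hw (by simp only [weight]; ring) 1
  · exact Submodule.zero_mem _

theorem eq_tensRight_headSlice {ς : List ℕ} {v : Words} {n : ℤ} (hv : v ∈ wtSp (1 :: ς) n) :
    v = tensRight 0 (headSlice 0 v) + tensRight 1 (headSlice 1 v) := by
  refine eqOn_wtSp LinearMap.id
    (tensRight 0 ∘ₗ headSlice 0 + tensRight 1 ∘ₗ headSlice 1) hv fun w hw _ => ?_
  obtain ⟨x, w, rfl, hx, hw⟩ := hw.exists_cons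
  rw [← tensRight_single]
  simp only [LinearMap.id_apply, LinearMap.add_apply, LinearMap.comp_apply, headSlice_tensRight]
  interval_cases x <;> simp

/-- The coefficients get multiplied by `q` when neighbouring labels `1, 0` are exchanged. -/
def Exchange (q : ℂ) (h : Words) : Prop :=
  ∀ u v : List ℕ, h (u ++ 0 :: 1 :: v) = q * h (u ++ 1 :: 0 :: v)

theorem Exchange.slice {q : ℂ} {h : Words} (hh : Exchange q h) (x : ℕ) :
    Exchange q (headSlice x h) := fun u v => hh (x :: u) v

theorem capProj_apply (q : ℂ) {n : ℕ} {m : ℤ} {h : Words} (hh : h ∈ wtSp (List.replicate n 1) m)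
    {u v : List ℕ} (huv : u.length + v.length + 2 = n) :
    capProj q (u.length + 1) h (u ++ v) =
      capCoef q 0 1 * h (u ++ 0 :: 1 :: v) + capCoef q 1 0 * h (u ++ 1 :: 0 :: v) := by
  refine eqOn_wtSp (Finsupp.lapply (u ++ v) ∘ₗ capProj q (u.length + 1))
    (capCoef q 0 1 • Finsupp.lapply (u ++ 0 :: 1 :: v) +
      capCoef q 1 0 • Finsupp.lapply (u ++ 1 :: 0 :: v)) hh fun w hw _ => ?_
  have hrep : List.replicate n 1 =
      List.replicate u.length 1 ++ (1 :: 1 :: List.replicate v.length 1) := by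
    rw [← huv, ← List.replicate_succ, ← List.replicate_succ, List.replicate_append_replicate]
    congr 1
  rw [hrep] at hw
  obtain ⟨u', w', rfl, hu', hw'⟩ := hw.append_inv
  obtain ⟨a, w', rfl, ha, hw'⟩ := hw'.exists_cons
  obtain ⟨b, v', rfl, hb, hv'⟩ := hw'.exists_cons
  have hul : u'.length = u.length := by simpa using hu'.length_eq
  have e1 : (u' ++ a :: b :: v').take u.length = u' := by rw [← hul]; simp
  have e2 : (u' ++ a :: b :: v').drop (u.length + 1 + 1) = v' := by
    rw [← hul, add_assoc, List.drop_append]; simp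
  have e3 : (u' ++ a :: b :: v').getD u.length 0 = a := by
    rw [← hul, List.getD_append_right _ _ _ _ le_rfl]; simp
  have e4 : (u' ++ a :: b :: v').getD (u.length + 1) 0 = b := by
    rw [← hul, List.getD_append_right _ _ _ _ (Nat.le_succ _)]; simp
  simp only [LinearMap.comp_apply, capProj_single, Nat.add_sub_cancel, e1, e2, e3, e4,
    LinearMap.add_apply, LinearMap.smul_apply, Finsupp.lapply_apply, one_mul, smul_eq_mul]
  have e5 : ∀ x : List ℕ, (u' ++ v' = u ++ v ↔ u' = u ∧ v' = v) ∧
      (∀ c d, u' ++ a :: b :: v' = u ++ c :: d :: v ↔ u' = u ∧ a = c ∧ b = d ∧ v' = v) := by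
    intro _
    refine ⟨⟨fun h => List.append_inj h hul, by rintro ⟨rfl, rfl⟩; rfl⟩, fun c d =>
      ⟨fun h => ?_, by rintro ⟨rfl, rfl, rfl, rfl⟩; rfl⟩⟩
    simpa using List.append_inj h hul
  simp only [Finsupp.single_apply, (e5 []).1, (e5 []).2]
  by_cases h1 : u' = u <;> by_cases h2 : v' = v <;> simp only [h1, h2, true_and, false_and,
    and_false, if_false, and_true, mul_zero, add_zero, if_true]
  interval_cases a <;> interval_cases b <;> simp [capCoef]

/-- Each coefficient of the projection is a combination of two coefficients of $h$ that differ by an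
exchange of neighbouring labels; its vanishing is $q$-symmetry. -/
theorem exchange_of_capProj (q : ℂ) (hq0 : q ≠ 0) (hq : ∀ m : ℤ, m ≠ 0 → q ^ m ≠ 1) {n : ℕ} {m : ℤ}
    {h : Words} (hh : h ∈ wtSp (List.replicate n 1) m)
    (hc : ∀ j, 1 ≤ j → j + 1 ≤ n → capProj q j h = 0) : Exchange q h := by
  intro u v
  by_cases huv : u.length + v.length + 2 = n
  · have h1 := capProj_apply q hh huv
    rw [hc _ (by omega) (by omega), Finsupp.coe_zero, Pi.zero_apply] at h1
    obtain ⟨-, -, h01, h02⟩ := capCoef_spec q hq0 hq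
    have h3 : capCoef q 0 1 = -(q⁻¹ * capCoef q 1 0) := eq_neg_of_add_eq_zero_left h01
    have h4 : capCoef q 1 0 ≠ 0 := by
      intro h0; rw [h3, h0] at h02; simp at h02
    rw [h3] at h1
    have h5 : capCoef q 1 0 * (h (u ++ 0 :: 1 :: v) - q * h (u ++ 1 :: 0 :: v)) = 0 := by
      have := congrArg (fun x => -q * x) h1
      simp only [mul_zero] at this
      rw [this]; field_simp; ring
    exact sub_eq_zero.mp ((mul_eq_zero.mp h5).resolve_left h4)
  · have h0 : ∀ a b, h (u ++ a :: b :: v) = 0 := by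
      intro a b
      by_contra hne
      have := (hh (Finsupp.mem_support_iff.mpr hne)).1.length_eq
      simp at this
      omega
    rw [h0, h0, mul_zero]

/-- Moving the label $1$ past $i$ labels $0$ contributes $q^i$ by symmetry, and the action of $K$ on
those $i$ factors contributes another $q^i$. -/
theorem Exchange.actE_apply {q : ℂ} (hd : q - q⁻¹ ≠ 0) {n : ℕ} {m : ℤ} {h : Words}
    (hx : Exchange q h) (hh : h ∈ wtSp (List.replicate (n + 1) 1) m) :
    actE q (List.replicate (n + 1) 1) h (List.replicate (n + 1) 0) =
      (∑ i ∈ Finset.range (n + 1), (q ^ 2) ^ i) * h (1 :: List.replicate n 0) := by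
  induction n generalizing m h with
  | zero =>
    rw [List.replicate_succ] at hh
    have h1 : ∀ v, actE q [] v = 0 := fun v =>
      eq_of_eq_single (actE q []) 0 (by simp [eWord]) v
    conv_lhs => rw [eq_tensRight_headSlice hh]
    simp only [List.replicate_succ, List.replicate_zero]
    rw [map_add, actE_tensRight, actE_tensRight, ← headSlice_apply]
    simp [headSlice_tensRight, h1, qInt_one q hd, headSlice_apply]
  | succ n ih =>
    rw [List.replicate_succ] at hh
    conv_lhs => rw [eq_tensRight_headSlice hh]
    rw [List.replicate_succ, map_add, actE_tensRight, actE_tensRight,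
      List.replicate_succ (a := 0), ← headSlice_apply]
    have h1 := ih (hx.slice 0) (headSlice_mem hh)
    have h2 : headSlice 0 h (1 :: List.replicate n 0) = q * h (1 :: List.replicate (n + 1) 0) := by
      rw [headSlice_apply, List.replicate_succ]
      exact hx [] _
    simp only [map_add, map_smul, headSlice_tensRight, one_ne_zero, if_false, if_true]
    simp only [Nat.cast_zero, mul_zero, sub_zero, Nat.cast_one, zpow_one, 
      zero_ne_one, if_false, zero_smul, smul_zero, add_zero, zero_add, sub_self,
      qInt_one q hd, one_mul, one_smul, Finsupp.add_apply, Finsupp.smul_apply, smul_eq_mul]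
    rw [h1, h2, Finset.sum_range_succ' _ (n + 1)]
    simp only [pow_succ _ (_ : ℕ), ← Finset.sum_mul, headSlice_apply]
    simp
    ring

theorem geom_sum_ne_zero (q : ℂ) (hq : ∀ m : ℤ, m ≠ 0 → q ^ m ≠ 1) (n : ℕ) :
    ∑ i ∈ Finset.range (n + 1), (q ^ 2) ^ i ≠ 0 := by
  intro h
  have h1 := geom_sum_mul (q ^ 2) (n + 1)
  rw [h, zero_mul, ← pow_mul] at h1
  refine hq (2 * (n + 1) : ℕ) (by omega) ?_
  rw [zpow_natCast]
  exact (sub_eq_zero.mp h1.symm)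

/-- A $q$-symmetric vector lies in the top summand, whose only highest weight is $n$. The weight $k$
is left general because the induction passes to the two slices by the first label, of weights
$k\pm1$. -/
theorem Exchange.eq_zero {q : ℂ} (hq0 : q ≠ 0) (hq : ∀ m : ℤ, m ≠ 0 → q ^ m ≠ 1) {n : ℕ} {k : ℤ}
    {h : Words} (hx : Exchange q h) (hk : k < n) (hh : h ∈ wtSp (List.replicate n 1) k)
    (hE : actE q (List.replicate n 1) h = 0) : h = 0 := by
  have hd := qInt_den_ne q hq0 hq
  induction n generalizing k h with
  | zero => exact eq_zero_of_mem_wtSp (by simp; omega) hh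
  | succ n ih =>
    have hE' := hE
    rw [List.replicate_succ] at hh hE'
    have hdec := eq_tensRight_headSlice hh
    have hm1 : headSlice 1 h ∈ wtSp (List.replicate n 1) (k + 1) := by
      have := headSlice_mem (x := 1) hh
      rwa [show k - (((1 : ℕ) : ℤ) - 2 * ((1 : ℕ) : ℤ)) = k + 1 by push_cast; ring] at this
    have hm0 : headSlice 0 h ∈ wtSp (List.replicate n 1) (k - 1) := by
      have := headSlice_mem (x := 0) hh
      rwa [show k - (((1 : ℕ) : ℤ) - 2 * ((0 : ℕ) : ℤ)) = k - 1 by push_cast; ring] at this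
    rw [hdec, map_add, actE_tensRight, actE_tensRight] at hE'
    have h1 : headSlice 1 h = 0 := by
      rcases lt_trichotomy (k + 1) n with hlt | heq | hgt
      · refine ih (hx.slice 1) hlt hm1 ?_
        have := congrArg (headSlice 1) hE'
        simpa [headSlice_tensRight, hq0] using this
      -- The borderline weight, out of reach of the induction: the slice is supported on the
      -- all-zero word, and `actE_apply` with $E.h=0$ kills that coefficient.
      · have h2 := hx.actE_apply hd (by rwa [List.replicate_succ])
        rw [hE, Finsupp.coe_zero, Pi.zero_apply] at h2
        have h3 := (mul_eq_zero.mp h2.symm).resolve_left (geom_sum_ne_zero q hq n)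
        ext w
        by_contra hne
        obtain ⟨hw, hwt⟩ := hm1 (Finsupp.mem_support_iff.mpr hne)
        have hl : w.length = n := by simpa using hw.length_eq
        rw [weight_replicate n w hl, heq] at hwt
        have hs : w.sum = 0 := by omega
        have hw0 : w = List.replicate n 0 :=
          List.eq_replicate_iff.mpr ⟨hl, fun b hb => List.sum_eq_zero_iff.mp hs b hb⟩
        exact hne (by rw [hw0]; exact h3)
      · refine eq_zero_of_mem_wtSp ?_ hm1
        simp only [List.sum_replicate, smul_eq_mul, mul_one]
        exact lt_of_lt_of_le hgt (le_abs_self _)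
    have h0 : headSlice 0 h = 0 := by
      refine ih (hx.slice 0) (by push_cast at hk; omega) hm0 ?_
      have := congrArg (headSlice 0) hE'
      simpa [headSlice_tensRight, hq0, h1] using this
    rw [hdec, h0, h1]
    simp

/-- An invariant vector is determined by its projections. -/
theorem eq_zero_of_capProj (q : ℂ) (hq0 : q ≠ 0) (hq : ∀ m : ℤ, m ≠ 0 → q ^ m ≠ 1) {n : ℕ}
    (hn : 0 < n) {h : Words} (hh : h ∈ wtSp (List.replicate n 1) 0)
    (hE : actE q (List.replicate n 1) h = 0)
    (hc : ∀ j, 1 ≤ j → j + 1 ≤ n → capProj q j h = 0) : h = 0 :=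
  (exchange_of_capProj q hq0 hq hh hc).eq_zero hq0 hq (by exact_mod_cast hn) hh hE

/-- Projections at disjoint positions commute; removing the first two components lowers the later
position by two. -/
theorem capProj_capProj_one (q : ℂ) {n k : ℕ} (hk : 1 ≤ k) {m : ℤ} {h : Words}
    (hh : h ∈ wtSp (List.replicate (n + 2) 1) m) :
    capProj q k (capProj q 1 h) = capProj q 1 (capProj q (k + 2) h) := by
  rw [← LinearMap.comp_apply, ← LinearMap.comp_apply]
  refine eqOn_wtSp _ _ hh fun w hw _ => ?_
  simp only [List.replicate_succ] at hw
  obtain ⟨a, w, rfl, ha, hw⟩ := hw.exists_cons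
  obtain ⟨b, w, rfl, hb, hw⟩ := hw.exists_cons
  rw [LinearMap.comp_apply, LinearMap.comp_apply, ← tensRight_single, ← tensRight_single,
    capProj_one, capProj_tensRight q (k + 1) _ (by omega), capProj_tensRight q k _ hk,
    capProj_one, map_smul]

/-- An invariant vector with at least four tensor components is determined by its projections
except the first one. -/
theorem eq_zero_of_capProj_of_two_le (q : ℂ) (hq0 : q ≠ 0) (hq : ∀ m : ℤ, m ≠ 0 → q ^ m ≠ 1)
    {n : ℕ} (hn : 0 < n) {h : Words} (hh : h ∈ wtSp (List.replicate (n + 2) 1) 0)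
    (hE : actE q (List.replicate (n + 2) 1) h = 0)
    (hc : ∀ j, 2 ≤ j → j + 1 ≤ n + 2 → capProj q j h = 0) : h = 0 := by
  refine eq_zero_of_capProj q hq0 hq (by omega) hh hE fun j hj hj' => ?_
  rcases hj.eq_or_lt with rfl | hj2
  -- The first projection of $h$ is itself invariant, and all its projections come from those of $h$
  -- at positions $\ge3$. Here $n>0$ matters: with two components only the first projection exists.
  · refine eq_zero_of_capProj q hq0 hq hn (capProj_mem q le_rfl (by omega) hh) ?_ fun k hk hk' => ?_
    · rw [← capProj_actE q hq0 hq le_rfl (by omega) hh, hE, map_zero]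
    · rw [capProj_capProj_one q hk hh, hc (k + 2) (by omega) (by omega), map_zero]
  · exact hc j hj2 hj'

/-! ### Planar multisets of links -/

/-- The endpoints of a multiset of links. -/
def ends (M : Multiset (ℕ × ℕ)) : Multiset ℕ := M.map Prod.fst + M.map Prod.snd

/-- A planar multiset of links with endpoints `D`. -/
structure IsPattern (D : Multiset ℕ) (M : Multiset (ℕ × ℕ)) : Prop where
  lt : ∀ L ∈ M, L.1 < L.2
  ends_eq : ends M = D
  planar : ∀ L ∈ M, ∀ L' ∈ M, ¬ (L.1 < L'.1 ∧ L'.1 < L.2 ∧ L.2 < L'.2)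

theorem ends_cons (a b : ℕ) (M : Multiset (ℕ × ℕ)) :
    ends ((a, b) ::ₘ M) = a ::ₘ b ::ₘ ends M := by
  simp only [ends, Multiset.map_cons, Multiset.cons_add, Multiset.add_cons]
  exact Multiset.cons_swap _ _ _

theorem ends_map (f : ℕ → ℕ) (M : Multiset (ℕ × ℕ)) :
    ends (M.map (Prod.map f f)) = (ends M).map f := by
  simp [ends, Multiset.map_map]

theorem fst_mem_ends {M : Multiset (ℕ × ℕ)} {L : ℕ × ℕ} (h : L ∈ M) : L.1 ∈ ends M :=
  Multiset.mem_add.mpr (Or.inl (Multiset.mem_map_of_mem _ h))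

theorem snd_mem_ends {M : Multiset (ℕ × ℕ)} {L : ℕ × ℕ} (h : L ∈ M) : L.2 ∈ ends M :=
  Multiset.mem_add.mpr (Or.inr (Multiset.mem_map_of_mem _ h))

theorem mem_ends {M : Multiset (ℕ × ℕ)} {x : ℕ} (h : x ∈ ends M) :
    (∃ y, (x, y) ∈ M) ∨ ∃ y, (y, x) ∈ M := by
  simp only [ends, Multiset.mem_add, Multiset.mem_map] at h
  rcases h with ⟨⟨a, b⟩, h, rfl⟩ | ⟨⟨a, b⟩, h, rfl⟩
  · exact Or.inl ⟨_, h⟩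
  · exact Or.inr ⟨_, h⟩

theorem IsPattern.of_cons {D : Multiset ℕ} {L : ℕ × ℕ} {M : Multiset (ℕ × ℕ)}
    (h : IsPattern D (L ::ₘ M)) : IsPattern (ends M) M :=
  ⟨fun L' h' => h.lt L' (Multiset.mem_cons_of_mem h'), rfl,
    fun L₁ h₁ L₂ h₂ => h.planar L₁ (Multiset.mem_cons_of_mem h₁) L₂ (Multiset.mem_cons_of_mem h₂)⟩

/-- A shortest link of a planar pattern has no endpoints strictly between its ends. -/
theorem IsPattern.exists_short {D : Multiset ℕ} {M : Multiset (ℕ × ℕ)} (h : IsPattern D M)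
    (h0 : M ≠ 0) : ∃ a b, (a, b) ∈ M ∧ ∀ x ∈ D, ¬ (a < x ∧ x < b) := by
  classical
  obtain ⟨L₀, hL₀⟩ := Multiset.exists_mem_of_ne_zero h0
  obtain ⟨⟨a, b⟩, hab, hmin⟩ := M.toFinset.exists_min_image (fun L => L.2 - L.1)
    ⟨L₀, Multiset.mem_toFinset.mpr hL₀⟩
  rw [Multiset.mem_toFinset] at hab
  refine ⟨a, b, hab, ?_⟩
  rintro x hx ⟨h1, h2⟩
  rw [← h.ends_eq] at hx
  rcases mem_ends hx with ⟨y, hy⟩ | ⟨y, hy⟩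
  -- By planarity a link with an end strictly between $a$ and $b$ stays within $[a,b]$, so it would
  -- be shorter than $(a,b)$.
  · have h3 := hmin _ (Multiset.mem_toFinset.mpr hy)
    have h4 := h.planar _ hab _ hy
    have h5 := h.lt _ hy
    simp only at h3 h4 h5
    omega
  · have h3 := hmin _ (Multiset.mem_toFinset.mpr hy)
    have h4 := h.planar _ hy _ hab
    have h5 := h.lt _ hy
    simp only at h3 h4 h5
    omega

/-- A planar pattern is determined by its left and right endpoints. -/
theorem IsPattern.eq_of_map_eq {D D' : Multiset ℕ} {M M' : Multiset (ℕ × ℕ)} (h : IsPattern D M)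
    (h' : IsPattern D' M') (h1 : M.map Prod.fst = M'.map Prod.fst)
    (h2 : M.map Prod.snd = M'.map Prod.snd) : M = M' := by
  induction hn : Multiset.card M generalizing M M' D D' with
  | zero =>
    rw [Multiset.card_eq_zero] at hn
    subst hn
    exact (Multiset.map_eq_zero.mp h1.symm).symm
  | succ n ih =>
    obtain ⟨a, b, hab, hmin⟩ := h.exists_short (by rintro rfl; simp at hn)
    have hlt : a < b := h.lt _ hab
    have hD : D = D' := by rw [← h.ends_eq, ← h'.ends_eq, ends, ends, h1, h2]
    subst hD
    obtain ⟨⟨a', y⟩, hy, ha⟩ := Multiset.mem_map.mp (h1 ▸ Multiset.mem_map_of_mem Prod.fst hab)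
    obtain ⟨⟨x, b'⟩, hx, hb⟩ := Multiset.mem_map.mp (h2 ▸ Multiset.mem_map_of_mem Prod.snd hab)
    simp only at ha hb
    subst ha hb
    -- In $M'$ the point $a'$ is joined to $y\ge b'$ and $b'$ to $x\le a'$. If both inequalities
    -- were strict, these two links would cross.
    have hmem : (a', b') ∈ M' := by
      have e1 := hmin y (h'.ends_eq ▸ snd_mem_ends hy)
      have e2 := hmin x (h'.ends_eq ▸ fst_mem_ends hx)
      have e3 := h'.lt _ hy
      have e4 := h'.lt _ hx
      have e5 := h'.planar _ hx _ hy
      simp only at e3 e4 e5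
      by_cases e6 : y = b'
      · exact e6 ▸ hy
      · by_cases e7 : x = a'
        · exact e7 ▸ hx
        · omega
    obtain ⟨N, rfl⟩ := Multiset.exists_cons_of_mem hab
    obtain ⟨N', rfl⟩ := Multiset.exists_cons_of_mem hmem
    simp only [Multiset.map_cons, Multiset.cons_inj_right] at h1 h2
    rw [ih h.of_cons h'.of_cons h1 h2 (by simpa using hn)]

/-- The points `1, …, n`. -/
def pts (n : ℕ) : Multiset ℕ := (Multiset.range n).map Nat.succ

@[simp] theorem mem_pts {n x : ℕ} : x ∈ pts n ↔ 1 ≤ x ∧ x ≤ n := by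
  simp only [pts, Multiset.mem_map, Multiset.mem_range]
  constructor
  · rintro ⟨a, h, rfl⟩; omega
  · rintro ⟨h1, h2⟩; exact ⟨x - 1, by omega, by omega⟩

theorem nodup_pts (n : ℕ) : (pts n).Nodup := (Multiset.nodup_range n).map Nat.succ_injective

theorem card_pts (n : ℕ) : Multiset.card (pts n) = n := by simp [pts]

theorem pts_add (m n : ℕ) : pts (m + n) = pts m + (pts n).map (m + ·) := by
  simp [pts, Multiset.range_add, Multiset.map_map, Nat.add_assoc]

theorem two_mul_card {n : ℕ} {M : Multiset (ℕ × ℕ)} (h : IsPattern (pts n) M) :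
    2 * Multiset.card M = n := by
  have := congrArg Multiset.card h.ends_eq
  rw [card_pts, ends, Multiset.card_add, Multiset.card_map, Multiset.card_map] at this
  omega

/-! ### Insertion and removal of links between neighbouring points -/

/-- The relabelling of points when the points `j`, `j + 1` are inserted. -/
def up (j x : ℕ) : ℕ := if x < j then x else x + 2

/-- The relabelling of points when the points `j`, `j + 1` are removed. -/
def down (j x : ℕ) : ℕ := if j + 1 < x then x - 2 else x

theorem up_strictMono (j : ℕ) : StrictMono (up j) := by
  intro a b h; unfold up; split_ifs <;> omega

theorem up_ne (j x : ℕ) : up j x ≠ j ∧ up j x ≠ j + 1 := by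
  unfold up; split_ifs <;> omega

theorem down_up (j x : ℕ) : down j (up j x) = x := by
  unfold up down; split_ifs <;> omega

theorem up_down {j x : ℕ} (h : x ≠ j) (h' : x ≠ j + 1) : up j (down j x) = x := by
  unfold up down; split_ifs <;> omega

theorem pts_add_two {n j : ℕ} (h1 : 1 ≤ j) (h2 : j ≤ n + 1) :
    pts (n + 2) = j ::ₘ (j + 1) ::ₘ (pts n).map (up j) := by
  have hnot : ∀ y, y ∈ (pts n).map (up j) → y ≠ j ∧ y ≠ j + 1 := by
    intro y hy
    obtain ⟨x, -, rfl⟩ := Multiset.mem_map.mp hy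
    exact up_ne j x
  refine (Multiset.Nodup.ext (nodup_pts _) ?_).mpr ?_
  · simp only [Multiset.nodup_cons, Multiset.mem_cons, not_or]
    exact ⟨⟨by omega, fun h => (hnot _ h).1 rfl⟩, fun h => (hnot _ h).2 rfl,
      (nodup_pts n).map (up_strictMono j).injective⟩
  · intro x
    simp only [Multiset.mem_cons, Multiset.mem_map, mem_pts]
    constructor
    · intro h
      by_cases e1 : x = j
      · exact Or.inl e1
      by_cases e2 : x = j + 1
      · exact Or.inr (Or.inl e2)
      refine Or.inr (Or.inr ⟨down j x, ?_, up_down e1 e2⟩)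
      unfold down; split_ifs <;> omega
    · rintro (rfl | rfl | ⟨a, h, rfl⟩)
      · omega
      · omega
      · unfold up; split_ifs <;> omega

/-- The insertion of a link `(j, j + 1)`. -/
def insertLink (j : ℕ) (M : Multiset (ℕ × ℕ)) : Multiset (ℕ × ℕ) :=
  (j, j + 1) ::ₘ M.map (Prod.map (up j) (up j))

theorem mem_insertLink (j : ℕ) (M : Multiset (ℕ × ℕ)) : (j, j + 1) ∈ insertLink j M :=
  Multiset.mem_cons_self _ _

theorem removeLink_insertLink (j : ℕ) (M : Multiset (ℕ × ℕ)) :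
    removeLink j ⟨insertLink j M, 0⟩ = ⟨M, 0⟩ := by
  have h : (fun L : ℕ × ℕ => (if j + 1 < L.1 then L.1 - 2 else L.1,
      if j + 1 < L.2 then L.2 - 2 else L.2)) ∘ Prod.map (up j) (up j) = id := by
    funext L
    exact Prod.ext (down_up j L.1) (down_up j L.2)
  simp only [removeLink, insertLink, Multiset.erase_cons_head, Multiset.map_map, h,
    Multiset.map_id]

theorem insertLink_injective (j : ℕ) : Function.Injective (insertLink j) := by
  intro M M' h
  have := removeLink_insertLink j M
  rw [h, removeLink_insertLink] at this
  exact congrArg Diagram.links this.symm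

theorem isPattern_insertLink {n j : ℕ} (h1 : 1 ≤ j) (h2 : j ≤ n + 1) {M : Multiset (ℕ × ℕ)} :
    IsPattern (pts (n + 2)) (insertLink j M) ↔ IsPattern (pts n) M := by
  have hmono := up_strictMono j
  have hmem : ∀ L ∈ M, Prod.map (up j) (up j) L ∈ insertLink j M := fun L hL =>
    Multiset.mem_cons_of_mem (Multiset.mem_map_of_mem _ hL)
  constructor
  · rintro ⟨a1, a2, a3⟩
    refine ⟨fun L hL => hmono.lt_iff_lt.mp (a1 _ (hmem L hL)), ?_, fun L hL L' hL' h => ?_⟩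
    · rw [insertLink, ends_cons, ends_map, pts_add_two h1 h2, Multiset.cons_inj_right,
        Multiset.cons_inj_right] at a2
      exact Multiset.map_injective hmono.injective a2
    · exact a3 _ (hmem L hL) _ (hmem L' hL') ⟨hmono h.1, hmono h.2.1, hmono h.2.2⟩
  · rintro ⟨a1, a2, a3⟩
    have hcase : ∀ L ∈ insertLink j M, L = (j, j + 1) ∨
        ∃ L' ∈ M, Prod.map (up j) (up j) L' = L := by
      intro L hL
      rcases Multiset.mem_cons.mp hL with h | h
      · exact Or.inl h
      · exact Or.inr (Multiset.mem_map.mp h)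
    refine ⟨fun L hL => ?_, ?_, fun L hL L' hL' h => ?_⟩
    · rcases hcase L hL with rfl | ⟨L₀, h₀, rfl⟩
      · simp
      · exact hmono (a1 L₀ h₀)
    · rw [insertLink, ends_cons, ends_map, pts_add_two h1 h2, a2]
    · rcases hcase L hL with rfl | ⟨L₀, h₀, rfl⟩
      · simp only at h; omega
      · rcases hcase L' hL' with rfl | ⟨L₁, h₁, rfl⟩
        · simp only at h; omega
        · exact a3 L₀ h₀ L₁ h₁ ⟨hmono.lt_iff_lt.mp h.1, hmono.lt_iff_lt.mp h.2.1,
            hmono.lt_iff_lt.mp h.2.2⟩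

theorem IsPattern.exists_insertLink {n j : ℕ} {M : Multiset (ℕ × ℕ)}
    (h : IsPattern (pts (n + 2)) M) (hj : (j, j + 1) ∈ M) :
    1 ≤ j ∧ j ≤ n + 1 ∧ ∃ M', IsPattern (pts n) M' ∧ M = insertLink j M' := by
  have e1 := h.ends_eq ▸ fst_mem_ends hj
  have e2 := h.ends_eq ▸ snd_mem_ends hj
  simp only [mem_pts] at e1 e2
  have h1 : 1 ≤ j := e1.1
  have h2 : j ≤ n + 1 := by omega
  refine ⟨h1, h2, ?_⟩
  obtain ⟨N, rfl⟩ := Multiset.exists_cons_of_mem hj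
  have hnd := h.ends_eq.symm ▸ nodup_pts (n + 2)
  rw [ends_cons, Multiset.nodup_cons, Multiset.nodup_cons, Multiset.mem_cons, not_or] at hnd
  have hne : ∀ x ∈ ends N, x ≠ j ∧ x ≠ j + 1 := fun x hx =>
    ⟨fun e => hnd.1.2 (e ▸ hx), fun e => hnd.2.1 (e ▸ hx)⟩
  have hN : (j, j + 1) ::ₘ N = insertLink j (N.map (Prod.map (down j) (down j))) := by
    rw [insertLink, Multiset.map_map]
    congr 1
    conv_lhs => rw [← Multiset.map_id N]
    refine Multiset.map_congr rfl fun L hL => ?_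
    have f1 := hne _ (fst_mem_ends hL)
    have f2 := hne _ (snd_mem_ends hL)
    exact Prod.ext (up_down f1.1 f1.2).symm (up_down f2.1 f2.2).symm
  exact ⟨_, (isPattern_insertLink h1 h2).mp (hN ▸ h), hN⟩

/-! ### Gluing of neighbouring points -/

theorem IsPattern.map {n : ℕ} {f : ℕ → ℕ} (hf : Monotone f) {M : Multiset (ℕ × ℕ)}
    (h : IsPattern (pts n) M) (hlt : ∀ L ∈ M, f L.1 < f L.2) :
    IsPattern ((pts n).map f) (M.map (Prod.map f f)) := by
  refine ⟨fun L hL => ?_, by rw [ends_map, h.ends_eq], fun L hL L' hL' hc => ?_⟩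
  · obtain ⟨L₀, h₀, rfl⟩ := Multiset.mem_map.mp hL
    exact hlt L₀ h₀
  · obtain ⟨L₀, h₀, rfl⟩ := Multiset.mem_map.mp hL
    obtain ⟨L₁, h₁, rfl⟩ := Multiset.mem_map.mp hL'
    exact h.planar L₀ h₀ L₁ h₁ ⟨hf.reflect_lt hc.1, hf.reflect_lt hc.2.1, hf.reflect_lt hc.2.2⟩

/-- Take a shortest link $(a,b)$ and the last $j$ with $f(j)=a$. The next value $f(j+1)$ lies in
$(a,b]$ and is an endpoint, so it equals $b$. -/
theorem IsPattern.exists_neighbours {n : ℕ} {f : ℕ → ℕ} (hf : Monotone f) {M : Multiset (ℕ × ℕ)}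
    (h : IsPattern ((pts n).map f) M) (h0 : M ≠ 0) :
    ∃ j, 1 ≤ j ∧ j + 1 ≤ n ∧ (f j, f (j + 1)) ∈ M := by
  obtain ⟨a, b, hab, hmin⟩ := h.exists_short h0
  have hlt : a < b := h.lt _ hab
  obtain ⟨i, hi, hia⟩ := Multiset.mem_map.mp (h.ends_eq ▸ fst_mem_ends hab)
  obtain ⟨k, hk, hkb⟩ := Multiset.mem_map.mp (h.ends_eq ▸ snd_mem_ends hab)
  simp only [mem_pts] at hi hk hia hkb
  set j := Nat.findGreatest (fun x => f x = a) n with hj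
  have hja : f j = a := Nat.findGreatest_spec (P := fun x => f x = a) hi.2 hia
  have hij : i ≤ j := Nat.le_findGreatest hi.2 hia
  have hjk : j < k := hf.reflect_lt (by omega)
  have hj1 : f (j + 1) ≠ a := Nat.findGreatest_is_greatest (P := fun x => f x = a) (n := n)
    (Nat.lt_succ_self _) (by omega)
  have hmem : f (j + 1) ∈ (pts n).map f :=
    Multiset.mem_map_of_mem _ (mem_pts.mpr ⟨by omega, by omega⟩)
  have h1 := hmin _ hmem
  have h2 := hf (Nat.le_succ j)
  have h3 := hf (show j + 1 ≤ k from hjk)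
  have hb : f (j + 1) = b := by
    simp only [Nat.succ_eq_add_one] at h2
    omega
  exact ⟨j, by omega, by omega, by rw [hja, hb]; exact hab⟩

theorem IsPattern.exists_neighbour_link {n : ℕ} {M : Multiset (ℕ × ℕ)}
    (h : IsPattern (pts n) M) (hn : n ≠ 0) : ∃ j, (j, j + 1) ∈ M := by
  have h0 : M ≠ 0 := by
    rintro rfl
    have := two_mul_card h
    simp at this
    omega
  obtain ⟨j, -, -, hj⟩ := IsPattern.exists_neighbours (n := n) monotone_id (by simpa using h) h0
  exact ⟨j, hj⟩

/-- A short link lifts to neighbours $j,j+1$; what is left is a pattern glued by $f\circ$ `up j`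
from two points fewer. The induction is therefore over all monotone $f$, not just over block maps.
-/
theorem exists_glue {n : ℕ} {f : ℕ → ℕ} (hf : Monotone f) {M : Multiset (ℕ × ℕ)}
    (h : IsPattern ((pts n).map f) M) :
    ∃ α, IsPattern (pts n) α ∧ α.map (Prod.map f f) = M := by
  induction n using Nat.strong_induction_on generalizing f M with
  | _ n ih =>
    by_cases h0 : M = 0
    · subst h0
      have hn : n = 0 := by
        have := congrArg Multiset.card h.ends_eq
        simpa [ends, card_pts] using this.symm
      subst hn
      exact ⟨0, ⟨by simp, by simp [ends, pts], by simp⟩, by simp⟩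
    · obtain ⟨j, hj1, hj2, hj⟩ := h.exists_neighbours hf h0
      obtain ⟨n, rfl⟩ : ∃ m, n = m + 2 := ⟨n - 2, by omega⟩
      obtain ⟨N, rfl⟩ := Multiset.exists_cons_of_mem hj
      have hN : ends N = (pts n).map (f ∘ up j) := by
        have := h.ends_eq
        rw [ends_cons, pts_add_two hj1 (by omega), Multiset.map_cons, Multiset.map_cons,
          Multiset.cons_inj_right, Multiset.cons_inj_right] at this
        rw [this, Multiset.map_map]
      obtain ⟨α, hα, rfl⟩ := ih n (by omega) (hf.comp (up_strictMono j).monotone)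
        (hN ▸ h.of_cons)
      refine ⟨insertLink j α, (isPattern_insertLink hj1 (by omega)).mpr hα, ?_⟩
      rw [insertLink, Multiset.map_cons, Multiset.map_map]
      rfl

/-- The given link lifts to some $(x',y')$ with $x'\le j<j+1\le y'$. If $j+1$ opened a link or $j$
closed one, that link would cross $(x',y')$ or share an end with it, as no link collapses under $f$.
So $j$ opens and $j+1$ closes, and planarity joins them. -/
theorem mem_of_glue_mem {n j : ℕ} {f : ℕ → ℕ} (hf : Monotone f) {α : Multiset (ℕ × ℕ)}
    (h : IsPattern (pts n) α) (hlt : ∀ L ∈ α, f L.1 < f L.2) (h1 : 1 ≤ j) (h2 : j + 1 ≤ n)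
    (hj : (f j, f (j + 1)) ∈ α.map (Prod.map f f)) : (j, j + 1) ∈ α := by
  have huniq : ∀ L ∈ α, ∀ L' ∈ α, (L.1 = L'.1 ∨ L.2 = L'.2 ∨ L.1 = L'.2) → L = L' := by
    intro L hL L' hL' hc
    by_contra hne
    obtain ⟨N, rfl⟩ := Multiset.exists_cons_of_mem hL
    have hL'' : L' ∈ N := (Multiset.mem_cons.mp hL').resolve_left (Ne.symm hne)
    have hnd := h.ends_eq.symm ▸ nodup_pts n
    rw [← Prod.mk.eta (p := L), ends_cons, Multiset.nodup_cons, Multiset.nodup_cons,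
      Multiset.mem_cons, not_or] at hnd
    have f1 := fst_mem_ends hL''
    have f2 := snd_mem_ends hL''
    rcases hc with hc | hc | hc
    · rw [hc] at hnd; exact hnd.1.2 f1
    · rw [hc] at hnd; exact hnd.2.1 f2
    · rw [hc] at hnd; exact hnd.1.2 f2
  obtain ⟨⟨x', y'⟩, hL, he⟩ := Multiset.mem_map.mp hj
  simp only [Prod.map, Prod.mk.injEq] at he
  have hlt' := hlt _ hL
  simp only at hlt'
  have hx' : x' < j + 1 := hf.reflect_lt (by omega)
  have hy' : j < y' := hf.reflect_lt (by omega)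
  have hjm : j ∈ ends α := h.ends_eq ▸ mem_pts.mpr ⟨h1, by omega⟩
  have hjm1 : j + 1 ∈ ends α := h.ends_eq ▸ mem_pts.mpr ⟨by omega, h2⟩
  rcases mem_ends hjm with ⟨y, hy⟩ | ⟨x, hx⟩
  · rcases mem_ends hjm1 with ⟨z, hz⟩ | ⟨x, hx⟩
    · exfalso
      have a1 := hlt _ hz
      simp only at a1
      have a2 : y' < z := hf.reflect_lt (by omega)
      have a3 := h.planar _ hL _ hz
      have a4 := huniq _ hz _ hL
      simp only [Prod.mk.injEq] at a3 a4
      omega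
    · have a1 := h.planar _ hx _ hy
      have a2 := h.lt _ hx
      have a3 := h.lt _ hy
      have a4 := huniq _ hx _ hy
      simp only [Prod.mk.injEq] at a1 a2 a3 a4
      by_cases a5 : x = j
      · exact a5 ▸ hx
      · omega
  · exfalso
    have a1 := hlt _ hx
    simp only at a1
    have a2 : x < x' := hf.reflect_lt (by omega)
    have a3 := h.planar _ hx _ hL
    have a4 := huniq _ hL _ hx
    have a5 := h.lt _ hx
    simp only [Prod.mk.injEq] at a3 a4 a5
    omega

/-- Both pairings contain the same neighbour link by `mem_of_glue_mem`; remove it and induct. This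
is what makes $\alpha(\omega)$ well defined. -/
theorem glue_injective {n : ℕ} {f : ℕ → ℕ} (hf : Monotone f) {α α' : Multiset (ℕ × ℕ)}
    (h : IsPattern (pts n) α) (h' : IsPattern (pts n) α') (hlt : ∀ L ∈ α, f L.1 < f L.2)
    (he : α.map (Prod.map f f) = α'.map (Prod.map f f)) : α = α' := by
  induction n using Nat.strong_induction_on generalizing f α α' with
  | _ n ih =>
    by_cases h0 : α = 0
    · subst h0
      exact (Multiset.map_eq_zero.mp he.symm).symm
    · obtain ⟨j, hj1, hj2, hj⟩ := (h.map hf hlt).exists_neighbours hf (by simpa using h0)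
      have hlt' : ∀ L ∈ α', f L.1 < f L.2 := by
        intro L hL
        obtain ⟨L', h1, h2⟩ := Multiset.mem_map.mp (he ▸ Multiset.mem_map_of_mem (Prod.map f f) hL)
        have := hlt L' h1
        simp only [Prod.map, Prod.mk.injEq] at h2
        omega
      have hm := mem_of_glue_mem hf h hlt hj1 hj2 hj
      have hm' := mem_of_glue_mem hf h' hlt' hj1 hj2 (he ▸ hj)
      obtain ⟨n, rfl⟩ : ∃ m, n = m + 2 := ⟨n - 2, by omega⟩
      obtain ⟨-, -, β, hβ, rfl⟩ := h.exists_insertLink hm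
      obtain ⟨-, -, β', hβ', rfl⟩ := h'.exists_insertLink hm'
      rw [insertLink, insertLink, Multiset.map_cons, Multiset.map_cons, Multiset.cons_inj_right,
        Multiset.map_map, Multiset.map_map] at he
      rw [ih n (by omega) (hf.comp (up_strictMono j).monotone) hβ hβ' (fun L hL => hlt _
        (Multiset.mem_cons_of_mem (Multiset.mem_map_of_mem _ hL))) he]

/-- Finiteness permits the sums over pairings in the inversion of the triangular system. -/
theorem finite_isPattern (N : ℕ) : {M | IsPattern (pts (2 * N)) M}.Finite := by
  induction N with
  | zero =>
    refine (Set.finite_singleton 0).subset fun M hM => ?_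
    have := two_mul_card hM
    simpa using this
  | succ N ih =>
    refine ((Set.finite_Iic (2 * N + 1)).image2 insertLink ih).subset fun M hM => ?_
    obtain ⟨j, hj⟩ := hM.exists_neighbour_link (by omega)
    obtain ⟨-, h2, M', hM', rfl⟩ := hM.exists_insertLink hj
    exact ⟨j, h2, M', hM', rfl⟩

/-! ### Link patterns -/

/-- The points of a link pattern, each repeated according to its valence. -/
def degs : List ℕ → Multiset ℕ
  | [] => 0
  | s :: ς => Multiset.replicate s 1 + (degs ς).map Nat.succ

theorem mem_degs {ς : List ℕ} {x : ℕ} (h : x ∈ degs ς) : 1 ≤ x ∧ x ≤ ς.length := by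
  induction ς generalizing x with
  | nil => simp [degs] at h
  | cons s ς ih =>
    simp only [degs, Multiset.mem_add, Multiset.mem_replicate, Multiset.mem_map] at h
    rcases h with ⟨-, rfl⟩ | ⟨y, hy, rfl⟩
    · simp
    · have := ih hy
      simp only [List.length_cons]; omega

theorem count_degs (ς : List ℕ) (i : Fin ς.length) :
    (degs ς).count ((i : ℕ) + 1) = ς.get i := by
  induction ς with
  | nil => exact i.elim0
  | cons s ς ih =>
    rw [degs, Multiset.count_add]
    refine Fin.cases ?_ (fun i => ?_) i
    · have : Multiset.count 1 ((degs ς).map Nat.succ) = 0 := by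
        rw [Multiset.count_eq_zero, Multiset.mem_map]
        rintro ⟨y, hy, h⟩
        have := mem_degs hy
        omega
      simp [this]
    · have h1 : ((i.succ : Fin (ς.length + 1)) : ℕ) + 1 = Nat.succ ((i : ℕ) + 1) := rfl
      have h2 : Multiset.count (Nat.succ ((i : ℕ) + 1)) (Multiset.replicate s 1) = 0 := by
        rw [Multiset.count_replicate, if_neg (by omega)]
      rw [h1, h2, Multiset.count_map_eq_count' _ _ Nat.succ_injective, ih i, zero_add]
      rfl

theorem count_ends {M : Multiset (ℕ × ℕ)} (h : ∀ L ∈ M, L.1 < L.2) (i : ℕ) :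
    (ends M).count i = M.countP (fun L => L.1 = i ∨ L.2 = i) := by
  induction M using Multiset.induction with
  | empty => simp [ends]
  | cons L M ih =>
    obtain ⟨a, b⟩ := L
    have hab := h _ (Multiset.mem_cons_self _ _)
    simp only at hab
    rw [ends_cons, Multiset.count_cons, Multiset.count_cons, Multiset.countP_cons,
      ih fun L hL => h L (Multiset.mem_cons_of_mem hL)]
    split_ifs <;> omega

/-- The valence conditions become one equality of multisets of endpoints; a link counts once at each
end because its two ends differ. -/
theorem mem_LP_iff {ς : List ℕ} {ω : Diagram} :
    ω ∈ LP ς 0 ↔ ω.defects = 0 ∧ IsPattern (degs ς) ω.links := by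
  constructor
  · rintro ⟨h1, -, h3, h4, -, h6⟩
    have hd := Multiset.card_eq_zero.mp h3
    refine ⟨hd, fun L hL => (h1 L hL).2.1, ?_, h6⟩
    ext i
    by_cases hi : 1 ≤ i ∧ i ≤ ς.length
    · have h5 := h4 ⟨i - 1, by omega⟩
      have h7 := count_degs ς ⟨i - 1, by omega⟩
      rw [hd, Multiset.count_zero, add_zero, ← h7] at h5
      simp only [Nat.sub_add_cancel hi.1] at h5
      rw [count_ends fun L hL => (h1 L hL).2.1]
      convert h5
    · have e1 : i ∉ degs ς := fun h => hi (mem_degs h)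
      have e2 : i ∉ ends ω.links := by
        intro h
        rcases mem_ends h with ⟨y, hy⟩ | ⟨y, hy⟩ <;>
          (have := h1 _ hy; simp only at this; omega)
      rw [Multiset.count_eq_zero_of_notMem e1, Multiset.count_eq_zero_of_notMem e2]
  · rintro ⟨hd, h⟩
    refine ⟨fun L hL => ?_, by simp [hd], by simp [hd], fun i => ?_, by simp [hd], h.planar⟩
    · have e1 := mem_degs (h.ends_eq ▸ fst_mem_ends hL)
      have e2 := mem_degs (h.ends_eq ▸ snd_mem_ends hL)
      exact ⟨e1.1, h.lt L hL, e2.2⟩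
    · have h5 := count_ends h.lt ((i : ℕ) + 1)
      rw [h.ends_eq, count_degs] at h5
      rw [hd, Multiset.count_zero, add_zero, h5]

theorem degs_append_singleton (ς : List ℕ) (s : ℕ) :
    degs (ς ++ [s]) = degs ς + Multiset.replicate s (ς.length + 1) := by
  induction ς with
  | nil => simp [degs]
  | cons r ς ih =>
    rw [List.cons_append, degs, ih, degs, Multiset.map_add, Multiset.map_replicate, add_assoc]
    rfl

theorem degs_replicate (n : ℕ) : degs (List.replicate n 1) = pts n := by
  induction n with
  | zero => simp [degs, pts]
  | succ n ih =>
    rw [List.replicate_succ, degs, ih, add_comm n 1, pts_add]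
    simp only [Nat.add_comm 1]
    rfl

theorem mem_PP_iff {N : ℕ} {α : Diagram} :
    α ∈ PP N ↔ α.defects = 0 ∧ IsPattern (pts (2 * N)) α.links := by
  rw [PP, mem_LP_iff, degs_replicate]

theorem block_monotone (ς : List ℕ) : Monotone (block ς) := by
  induction ς with
  | nil => exact monotone_const
  | cons s ς ih =>
    intro x y h
    simp only [block]
    split_ifs
    · exact le_rfl
    · omega
    · omega
    · exact Nat.succ_le_succ (ih (by omega))

theorem map_block (ς : List ℕ) : (pts ς.sum).map (block ς) = degs ς := by
  induction ς with
  | nil => simp [pts, degs]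
  | cons s ς ih =>
    rw [List.sum_cons, pts_add, degs, Multiset.map_add, ← ih, Multiset.map_map, Multiset.map_map]
    congr 1
    · rw [Multiset.eq_replicate]
      refine ⟨by rw [Multiset.card_map, card_pts], fun b hb => ?_⟩
      obtain ⟨x, hx, rfl⟩ := Multiset.mem_map.mp hb
      simp only [block, if_pos (mem_pts.mp hx).2]
    · refine Multiset.map_congr rfl fun x hx => ?_
      have := mem_pts.mp hx
      simp only [Function.comp_apply, block]
      rw [if_neg (by omega), Nat.add_sub_cancel_left]

theorem block_le (ς : List ℕ) {x : ℕ} (h1 : 1 ≤ x) (h2 : x ≤ ς.sum) :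
    1 ≤ block ς x ∧ block ς x ≤ ς.length :=
  mem_degs (map_block ς ▸ Multiset.mem_map_of_mem _ (mem_pts.mpr ⟨h1, h2⟩))

theorem block_append_of_le (ς : List ℕ) (s : ℕ) {x : ℕ} (h1 : 1 ≤ x) (h2 : x ≤ ς.sum) :
    block (ς ++ [s]) x = block ς x := by
  induction ς generalizing x with
  | nil => rw [List.sum_nil] at h2; omega
  | cons r ς ih =>
    rw [List.sum_cons] at h2
    rw [List.cons_append, block, block]
    by_cases hx : x ≤ r
    · rw [if_pos hx, if_pos hx]
    · rw [if_neg hx, if_neg hx, ih (by omega) (by omega)]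

theorem block_append_of_lt (ς : List ℕ) (s : ℕ) {x : ℕ} (h1 : ς.sum < x) (h2 : x ≤ ς.sum + s) :
    block (ς ++ [s]) x = ς.length + 1 := by
  induction ς generalizing x with
  | nil =>
    rw [List.sum_nil] at h2
    rw [List.nil_append, block, if_pos (by omega), List.length_nil]
  | cons r ς ih =>
    rw [List.sum_cons] at h1 h2
    rw [List.cons_append, block, if_neg (by omega), ih (by omega) (by omega), List.length_cons]

theorem exists_openUp {ς : List ℕ} {M : Multiset (ℕ × ℕ)} (h : IsPattern (degs ς) M) :
    ∃ A, IsPattern (pts ς.sum) A ∧ A.map (Prod.map (block ς) (block ς)) = M ∧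
      openUp ς ⟨M, 0⟩ = ⟨A, 0⟩ := by
  rw [← map_block] at h
  obtain ⟨A, hA, hAM⟩ := exists_glue (block_monotone ς) h
  have hspec := Classical.epsilon_spec (p := fun α : Diagram =>
    α ∈ LP (List.replicate ς.sum 1) 0 ∧
      α.links.map (fun L => (block ς L.1, block ς L.2)) = M)
    ⟨⟨A, 0⟩, mem_LP_iff.mpr ⟨rfl, by rwa [degs_replicate]⟩, hAM⟩
  change openUp ς ⟨M, 0⟩ ∈ _ ∧ (openUp ς ⟨M, 0⟩).links.map _ = M at hspec
  obtain ⟨h1, h2⟩ := hspec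
  obtain ⟨h3, h4⟩ := mem_LP_iff.mp h1
  rw [degs_replicate] at h4
  exact ⟨_, h4, h2, Diagram.ext rfl h3⟩

/-- Identifies the chosen value of `openUp` with any explicit candidate, through uniqueness of the
splitting. -/
theorem openUp_eq {ς : List ℕ} {M A : Multiset (ℕ × ℕ)} (h : IsPattern (degs ς) M)
    (hA : IsPattern (pts ς.sum) A) (hAM : A.map (Prod.map (block ς) (block ς)) = M) :
    openUp ς ⟨M, 0⟩ = ⟨A, 0⟩ := by
  obtain ⟨B, hB, hBM, h1⟩ := exists_openUp h
  have hlt : ∀ L ∈ B, block ς L.1 < block ς L.2 := fun L hL =>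
    h.lt _ (hBM ▸ Multiset.mem_map_of_mem (Prod.map (block ς) (block ς)) hL)
  rw [h1, glue_injective (block_monotone ς) hB hA hlt (hBM.trans hAM.symm)]

/-! ### Rotation of link patterns -/

/-- The link with given endpoints. -/
def sortLink (L : ℕ × ℕ) : ℕ × ℕ := (min L.1 L.2, max L.1 L.2)

/-- The relabelling of links by a map of their endpoints. -/
def twist (g : ℕ → ℕ) (M : Multiset (ℕ × ℕ)) : Multiset (ℕ × ℕ) :=
  M.map (fun L => sortLink (g L.1, g L.2))

/-- The cyclic rotation of the points `1, …, n`. -/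
def cycPt (n x : ℕ) : ℕ := if x = n then 1 else x + 1

theorem sortLink_map_sortLink (g : ℕ → ℕ) (L : ℕ × ℕ) :
    sortLink (g (sortLink L).1, g (sortLink L).2) = sortLink (g L.1, g L.2) := by
  rcases le_total L.1 L.2 with h | h
  · simp [sortLink, min_eq_left h, max_eq_right h]
  · simp [sortLink, min_eq_right h, max_eq_left h, min_comm, max_comm]

theorem map_sortLink {f : ℕ → ℕ} (hf : Monotone f) (L : ℕ × ℕ) :
    Prod.map f f (sortLink L) = sortLink (f L.1, f L.2) :=
  Prod.ext (hf.map_min) (hf.map_max)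

theorem sortLink_of_lt {L : ℕ × ℕ} (h : L.1 < L.2) : sortLink L = L :=
  Prod.ext (min_eq_left h.le) (max_eq_right h.le)

theorem twist_twist (g h : ℕ → ℕ) (M : Multiset (ℕ × ℕ)) :
    twist g (twist h M) = twist (g ∘ h) M := by
  rw [twist, twist, twist, Multiset.map_map]
  exact Multiset.map_congr rfl fun L _ => sortLink_map_sortLink g (h L.1, h L.2)

theorem iterate_twist (g : ℕ → ℕ) {M : Multiset (ℕ × ℕ)} (h : ∀ L ∈ M, L.1 < L.2) (k : ℕ) :
    (twist g)^[k] M = twist (g^[k]) M := by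
  induction k with
  | zero =>
    rw [Function.iterate_zero, Function.iterate_zero, id, twist]
    conv_lhs => rw [← Multiset.map_id M]
    exact Multiset.map_congr rfl fun L hL => (sortLink_of_lt (h L hL)).symm
  | succ k ih =>
    rw [Function.iterate_succ_apply', ih, twist_twist, ← Function.iterate_succ']

theorem ends_twist (g : ℕ → ℕ) (M : Multiset (ℕ × ℕ)) : ends (twist g M) = (ends M).map g := by
  induction M using Multiset.induction with
  | empty => simp [twist, ends]
  | cons L M ih =>
    obtain ⟨a, b⟩ := L
    have h1 : twist g ((a, b) ::ₘ M) = (min (g a) (g b), max (g a) (g b)) ::ₘ twist g M :=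
      Multiset.map_cons _ _ _
    rw [h1, ends_cons, ends_cons, ih, Multiset.map_cons, Multiset.map_cons]
    rcases le_total (g a) (g b) with h | h
    · rw [min_eq_left h, max_eq_right h]
    · rw [min_eq_right h, max_eq_left h, Multiset.cons_swap]

theorem sortLink_cycPt {n : ℕ} {L : ℕ × ℕ} (h : L.1 < L.2) (h2 : L.2 ≤ n) :
    sortLink (cycPt n L.1, cycPt n L.2) =
      if L.2 = n then (1, L.1 + 1) else (L.1 + 1, L.2 + 1) := by
  have h1 : L.1 ≠ n := by omega
  unfold cycPt sortLink
  by_cases h3 : L.2 = n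
  · simp [h1, h3]
  · simp [h1, h3, h.le]

/-- Cutting the last index into defects and reconnecting them at the front is a relabelling of
endpoints by `cycPt`, and that form can be iterated. -/
theorem patCyc_eq {n : ℕ} {M : Multiset (ℕ × ℕ)} (h : ∀ L ∈ M, L.1 < L.2 ∧ L.2 ≤ n) :
    patCyc n ⟨M, 0⟩ = ⟨twist (cycPt n) M, 0⟩ := by
  refine Diagram.ext ?_ rfl
  simp only [patCyc, patMinusInv, patPlus, zero_add, Multiset.map_map, twist]
  conv_rhs => rw [← Multiset.filter_add_not (fun L : ℕ × ℕ => L.2 = n) M, add_comm,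
    Multiset.map_add]
  congr 1
  · refine Multiset.map_congr rfl fun L hL => ?_
    obtain ⟨h1, h2⟩ := Multiset.mem_filter.mp hL
    rw [sortLink_cycPt (h L h1).1 (h L h1).2, if_neg h2]
  · refine Multiset.map_congr rfl fun L hL => ?_
    obtain ⟨h1, h2⟩ := Multiset.mem_filter.mp hL
    rw [sortLink_cycPt (h L h1).1 (h L h1).2, if_pos h2]
    rfl

theorem IsPattern.twist {n : ℕ} {D : Multiset ℕ} {M : Multiset (ℕ × ℕ)} (h : IsPattern D M)
    (hD : ∀ x ∈ D, 1 ≤ x ∧ x ≤ n) : IsPattern (D.map (cycPt n)) (twist (cycPt n) M) := by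
  have hb : ∀ L ∈ M, 1 ≤ L.1 ∧ L.1 < L.2 ∧ L.2 ≤ n := fun L hL =>
    ⟨(hD _ (h.ends_eq ▸ fst_mem_ends hL)).1, h.lt L hL, (hD _ (h.ends_eq ▸ snd_mem_ends hL)).2⟩
  have hmem : ∀ L ∈ QLink.twist (cycPt n) M, ∃ L' ∈ M,
      L = if L'.2 = n then (1, L'.1 + 1) else (L'.1 + 1, L'.2 + 1) := by
    intro L hL
    obtain ⟨L', h1, rfl⟩ := Multiset.mem_map.mp hL
    exact ⟨L', h1, sortLink_cycPt (hb L' h1).2.1 (hb L' h1).2.2⟩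
  refine ⟨fun L hL => ?_, by rw [ends_twist, h.ends_eq], fun L hL L' hL' hc => ?_⟩
  · obtain ⟨L, h1, rfl⟩ := hmem L hL
    have := hb L h1
    split_ifs <;> simp only <;> omega
  · obtain ⟨L, h1, rfl⟩ := hmem L hL
    obtain ⟨L', h2, rfl⟩ := hmem L' hL'
    have e1 := hb L h1
    have e2 := hb L' h2
    -- Planarity is needed in both orders: a link ending at $n$ begins at $1$ after rotation, which
    -- can exchange the roles of the two links.
    have e3 := h.planar L h1 L' h2
    have e4 := h.planar L' h2 L h1
    split_ifs at hc <;> simp only at hc <;> omega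

theorem degs_cycPt (ς : List ℕ) (s : ℕ) :
    (degs (ς ++ [s])).map (cycPt (ς.length + 1)) = degs (s :: ς) := by
  rw [degs_append_singleton, degs, Multiset.map_add, Multiset.map_replicate, add_comm]
  congr 1
  · simp [cycPt]
  · refine Multiset.map_congr rfl fun x hx => ?_
    have := mem_degs hx
    rw [cycPt, if_neg (by omega)]

theorem pts_cycPt {n : ℕ} (hn : n ≠ 0) : (pts n).map (cycPt n) = pts n := by
  obtain ⟨n, rfl⟩ := Nat.exists_eq_succ_of_ne_zero hn
  have h := degs_cycPt (List.replicate n 1) 1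
  rw [List.length_replicate, ← List.replicate_succ, ← List.replicate_succ', degs_replicate] at h
  exact h

theorem IsPattern.twist_pts {n : ℕ} {M : Multiset (ℕ × ℕ)} (h : IsPattern (pts n) M) :
    IsPattern (pts n) (QLink.twist (cycPt n) M) := by
  by_cases hn : n = 0
  · subst hn
    have := two_mul_card h
    have hM : M = 0 := by simpa using this
    subst hM
    exact h
  · have := h.twist fun x hx => mem_pts.mp hx
    rwa [pts_cycPt hn] at this

theorem IsPattern.iterate_twist_pts {n : ℕ} {M : Multiset (ℕ × ℕ)} (h : IsPattern (pts n) M)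
    (k : ℕ) : IsPattern (pts n) ((QLink.twist (cycPt n))^[k] M) := by
  induction k with
  | zero => exact h
  | succ k ih => rw [Function.iterate_succ_apply']; exact ih.twist_pts

theorem iterate_cycPt {n k x : ℕ} (hk : k ≤ n) (h2 : x ≤ n) :
    (cycPt n)^[k] x = if x + k ≤ n then x + k else x + k - n := by
  induction k with
  | zero => simp [h2]
  | succ k ih =>
    rw [Function.iterate_succ_apply', ih (by omega)]
    unfold cycPt
    split_ifs <;> omega

/-- Moving the $s$ points of the last block to the front one at a time moves the whole index once.
-/
theorem block_iterate_cycPt (ς : List ℕ) (s : ℕ) {x : ℕ} (h1 : 1 ≤ x) (h2 : x ≤ ς.sum + s) :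
    block (s :: ς) ((cycPt (ς.sum + s))^[s] x) =
      cycPt (ς.length + 1) (block (ς ++ [s]) x) := by
  rw [iterate_cycPt (by omega) h2]
  by_cases h3 : x ≤ ς.sum
  · have := block_le ς h1 h3
    rw [if_pos (by omega), block_append_of_le ς s h1 h3, block, if_neg (by omega),
      Nat.add_sub_cancel, cycPt,
      if_neg (by omega)]
  · rw [if_neg (by omega), block_append_of_lt ς s (by omega) h2, block, if_pos (by omega), cycPt,
      if_pos rfl]

theorem openUp_twist {ς : List ℕ} {s : ℕ} {M A : Multiset (ℕ × ℕ)}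
    (h : IsPattern (degs (ς ++ [s])) M) (hA : IsPattern (pts (ς.sum + s)) A)
    (hAM : A.map (Prod.map (block (ς ++ [s])) (block (ς ++ [s]))) = M) :
    openUp (s :: ς) ⟨twist (cycPt (ς.length + 1)) M, 0⟩ =
      ⟨(twist (cycPt (ς.sum + s)))^[s] A, 0⟩ := by
  refine openUp_eq ?_ ?_ ?_
  · have := h.twist (n := ς.length + 1) fun x hx => by simpa using mem_degs hx
    rwa [degs_cycPt] at this
  · rw [List.sum_cons, add_comm]
    exact hA.iterate_twist_pts s
  · rw [iterate_twist _ hA.lt, ← hAM, twist, twist, Multiset.map_map, Multiset.map_map]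
    refine Multiset.map_congr rfl fun L hL => ?_
    have e1 := mem_pts.mp (hA.ends_eq ▸ fst_mem_ends hL)
    have e2 := mem_pts.mp (hA.ends_eq ▸ snd_mem_ends hL)
    simp only [Function.comp_apply, map_sortLink (block_monotone _), Prod.map_fst, Prod.map_snd,
      block_iterate_cycPt ς s e1.1 e1.2, block_iterate_cycPt ς s e2.1 e2.2]

/-- The bound $j\le n$ leaves out $(n+1,n+2)$, which would wrap around to $(1,n+2)$ instead of
remaining a neighbour link. -/
theorem twist_insertLink {n j : ℕ} (h1 : 1 ≤ j) (h2 : j ≤ n) {M : Multiset (ℕ × ℕ)}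
    (h : IsPattern (pts n) M) :
    twist (cycPt (n + 2)) (insertLink j M) = insertLink (j + 1) (twist (cycPt n) M) := by
  have hpt : ∀ x, 1 ≤ x → x ≤ n → cycPt (n + 2) (up j x) = up (j + 1) (cycPt n x) := by
    intro x hx1 hx2
    unfold cycPt up
    split_ifs <;> omega
  rw [twist, twist, insertLink, insertLink, Multiset.map_cons, Multiset.map_map, Multiset.map_map]
  congr 1
  · rw [sortLink_cycPt (by simp) (by simp only; omega), if_neg (by simp only; omega)]
  · refine Multiset.map_congr rfl fun L hL => ?_
    have e1 := mem_pts.mp (h.ends_eq ▸ fst_mem_ends hL)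
    have e2 := mem_pts.mp (h.ends_eq ▸ snd_mem_ends hL)
    simp only [Function.comp_apply, map_sortLink (up_strictMono _).monotone, Prod.map_fst,
      Prod.map_snd,
      hpt _ e1.1 e1.2, hpt _ e2.1 e2.2]

theorem mem_of_mem_twist {n j : ℕ} (hj : 2 ≤ j) {M : Multiset (ℕ × ℕ)} (h : IsPattern (pts n) M)
    (hm : (j, j + 1) ∈ twist (cycPt n) M) : (j - 1, j) ∈ M := by
  obtain ⟨L, hL, he⟩ := Multiset.mem_map.mp hm
  have e2 := mem_pts.mp (h.ends_eq ▸ snd_mem_ends hL)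
  rw [sortLink_cycPt (h.lt L hL) e2.2] at he
  split_ifs at he with h3
  · simp only [Prod.mk.injEq] at he; omega
  · simp only [Prod.mk.injEq] at he
    have : L = (j - 1, j) := Prod.ext (by simp only; omega) (by simp only; omega)
    exact this ▸ hL

/-! ### Invariant functionals -/

/-- The composition of the projections to the trivial subrepresentation along all links. -/
def capAll (q : ℂ) (M : Multiset (ℕ × ℕ)) : Words →ₗ[ℂ] ℂ :=
  Finsupp.linearCombination ℂ fun w =>
    (M.map fun L => capCoef q (w.getD (L.1 - 1) 0) (w.getD (L.2 - 1) 0)).prod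

theorem capAll_single (q : ℂ) (M : Multiset (ℕ × ℕ)) (w : List ℕ) :
    capAll q M (Finsupp.single w 1) =
      (M.map fun L => capCoef q (w.getD (L.1 - 1) 0) (w.getD (L.2 - 1) 0)).prod := by
  simp [capAll]

theorem getD_take_append_drop (w : List ℕ) {n j x : ℕ} (hw : w.length = n + 2) (h1 : 1 ≤ j)
    (h2 : j ≤ n + 1) (hx : 1 ≤ x) :
    (w.take (j - 1) ++ w.drop (j + 1)).getD (x - 1) 0 = w.getD (up j x - 1) 0 := by
  have hl : (w.take (j - 1)).length = j - 1 := by rw [List.length_take]; omega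
  unfold up
  split_ifs with h
  · rw [List.getD_append _ _ _ _ (by omega)]
    simp only [List.getD_eq_getElem?_getD]
    rw [List.getElem?_take_of_lt (by omega)]
  · rw [List.getD_append_right _ _ _ _ (by omega), hl]
    simp only [List.getD_eq_getElem?_getD, List.getElem?_drop]
    congr 2
    omega

/-- Each link contributes one independent factor, so the neighbour link can be contracted first.
This connects the functionals to the projection equations. -/
theorem capAll_insertLink (q : ℂ) {n j : ℕ} (h1 : 1 ≤ j) (h2 : j ≤ n + 1) {M : Multiset (ℕ × ℕ)}
    (hM : IsPattern (pts n) M) {m : ℤ} {u : Words} (hu : u ∈ wtSp (List.replicate (n + 2) 1) m) :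
    capAll q (insertLink j M) u = capAll q M (capProj q j u) := by
  rw [← LinearMap.comp_apply]
  refine eqOn_wtSp _ _ hu fun w hw _ => ?_
  have hl : w.length = n + 2 := by simpa using hw.length_eq
  rw [LinearMap.comp_apply, capProj_single, one_mul, capAll_single, insertLink,
    Multiset.map_cons, Multiset.prod_cons, Multiset.map_map]
  simp only [capAll, Finsupp.linearCombination_single, smul_eq_mul, Nat.add_sub_cancel]
  congr 2
  refine Multiset.map_congr rfl fun L hL => ?_
  have e1 := mem_pts.mp (hM.ends_eq ▸ fst_mem_ends hL)
  have e2 := mem_pts.mp (hM.ends_eq ▸ snd_mem_ends hL)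
  simp only [Function.comp_apply, Prod.map_fst, Prod.map_snd,
    getD_take_append_drop w hl h1 h2 e1.1, getD_take_append_drop w hl h1 h2 e2.1]

/-- The projections commute with $F$; after all links are contracted, $F$ acts on the empty tensor
product, where it is zero. -/
theorem capAll_actF (q : ℂ) (hq0 : q ≠ 0) (hq : ∀ m : ℤ, m ≠ 0 → q ^ m ≠ 1) {N : ℕ}
    {M : Multiset (ℕ × ℕ)} (hM : IsPattern (pts (2 * N)) M) {m : ℤ} {u : Words}
    (hu : u ∈ wtSp (List.replicate (2 * N) 1) m) :
    capAll q M (actF q (List.replicate (2 * N) 1) u) = 0 := by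
  induction N generalizing M u with
  | zero =>
    have h : actF q (List.replicate (2 * 0) 1) u = 0 :=
      eq_of_eq_single (actF q (List.replicate (2 * 0) 1)) 0 (by simp [fWord]) u
    rw [h, map_zero]
  | succ N ih =>
    rw [show 2 * (N + 1) = 2 * N + 2 by ring] at hu hM ⊢
    obtain ⟨j, hj⟩ := hM.exists_neighbour_link (by omega)
    obtain ⟨h1, h2, M, hM', rfl⟩ := hM.exists_insertLink hj
    rw [capAll_insertLink q h1 h2 hM' (actF_mem q hu), capProj_actF q hq0 hq h1 h2 hu]
    exact ih hM' (capProj_mem q h1 h2 hu)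

/-- The space of invariant vectors in `M_2 ⊗ ⋯ ⊗ M_2`. -/
def inv (q : ℂ) (n : ℕ) : Submodule ℂ Words :=
  wtSp (List.replicate n 1) 0 ⊓ LinearMap.ker (actE q (List.replicate n 1))

theorem mem_inv {q : ℂ} {n : ℕ} {v : Words} : v ∈ inv q n ↔
    v ∈ wtSp (List.replicate n 1) 0 ∧ actE q (List.replicate n 1) v = 0 := Iff.rfl

theorem mem_hwSpace_replicate (q : ℂ) (hq0 : q ≠ 0) (hq : ∀ m : ℤ, m ≠ 0 → q ^ m ≠ 1) (n : ℕ)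
    (v : Words) : v ∈ hwSpace q (List.replicate n 1) 0 ↔ v ∈ inv q n := by
  rw [mem_hwSpace_iff q hq0 hq, mem_inv, Nat.cast_zero]

theorem capProj_mem_inv (q : ℂ) (hq0 : q ≠ 0) (hq : ∀ m : ℤ, m ≠ 0 → q ^ m ≠ 1) {n j : ℕ}
    (h1 : 1 ≤ j) (h2 : j ≤ n + 1) {v : Words} (hv : v ∈ inv q (n + 2)) :
    capProj q j v ∈ inv q n := by
  obtain ⟨h3, h4⟩ := mem_inv.mp hv
  exact mem_inv.mpr ⟨capProj_mem q h1 h2 h3, by rw [← capProj_actE q hq0 hq h1 h2 h3, h4, map_zero]⟩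

/-- By induction all neighbour projections vanish, since every pairing of the remaining points
extends by a link at the projected position. -/
theorem eq_zero_of_capAll (q : ℂ) (hq0 : q ≠ 0) (hq : ∀ m : ℤ, m ≠ 0 → q ^ m ≠ 1) {N : ℕ}
    {v : Words} (hv : v ∈ inv q (2 * N))
    (h : ∀ M, IsPattern (pts (2 * N)) M → capAll q M v = 0) : v = 0 := by
  induction N generalizing v with
  | zero =>
    have h1 := h 0 ⟨by simp, by simp [ends, pts], by simp⟩
    have h2 : v = Finsupp.single [] (v []) := by
      ext w
      rw [Finsupp.single_apply]
      split_ifs with hw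
      · rw [hw]
      · by_contra hne
        have := ((mem_inv.mp hv).1 (Finsupp.mem_support_iff.mpr hne)).1
        simp at this
        exact hw this.symm
    rw [h2, capAll, Finsupp.linearCombination_single] at h1
    rw [h2]
    simpa using h1
  | succ N ih =>
    rw [show 2 * (N + 1) = 2 * N + 2 by ring] at hv h
    obtain ⟨h3, h4⟩ := mem_inv.mp hv
    refine eq_zero_of_capProj q hq0 hq (by omega) h3 h4 fun j hj1 hj2 => ?_
    refine ih (capProj_mem_inv q hq0 hq hj1 (by omega) hv) fun M hM => ?_
    rw [← capAll_insertLink q hj1 (by omega) hM h3]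
    exact h _ ((isPattern_insertLink hj1 (by omega)).mpr hM)

/-! ### Triangularity of the functionals -/

/-- The label `0` on left endpoints of links and `1` on all other points. -/
def label (M : Multiset (ℕ × ℕ)) (x : ℕ) : ℕ := if x ∈ M.map Prod.fst then 0 else 1

/-- The word of the labels of the points `1, …, n`. -/
def labelWord (M : Multiset (ℕ × ℕ)) (n : ℕ) : List ℕ :=
  (List.range n).map fun i => label M (i + 1)

theorem label_fst {M : Multiset (ℕ × ℕ)} {L : ℕ × ℕ} (h : L ∈ M) : label M L.1 = 0 :=
  if_pos (Multiset.mem_map_of_mem _ h)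

theorem disjoint_fst_snd {n : ℕ} {M : Multiset (ℕ × ℕ)} (h : IsPattern (pts n) M) {x : ℕ}
    (h1 : x ∈ M.map Prod.fst) (h2 : x ∈ M.map Prod.snd) : False := by
  have hnd := h.ends_eq.symm ▸ nodup_pts n
  rw [ends, Multiset.nodup_add] at hnd
  exact Multiset.disjoint_left.mp hnd.2.2 h1 h2

theorem label_snd {n : ℕ} {M : Multiset (ℕ × ℕ)} (h : IsPattern (pts n) M) {L : ℕ × ℕ}
    (hL : L ∈ M) : label M L.2 = 1 :=
  if_neg fun h1 => disjoint_fst_snd h h1 (Multiset.mem_map_of_mem _ hL)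

theorem label_le (M : Multiset (ℕ × ℕ)) (x : ℕ) : label M x ≤ 1 := by
  unfold label; split_ifs <;> omega

theorem sum_pts_map {n : ℕ} {M : Multiset (ℕ × ℕ)} (h : IsPattern (pts n) M) (f : ℕ → ℕ) :
    ((pts n).map f).sum = (M.map fun L => f L.1 + f L.2).sum := by
  rw [← h.ends_eq, ends, Multiset.map_add, Multiset.sum_add, Multiset.map_map, Multiset.map_map,
    Multiset.sum_map_add]
  rfl

theorem sum_labelWord (M : Multiset (ℕ × ℕ)) (n : ℕ) :
    (labelWord M n).sum = ((pts n).map (label M)).sum := by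
  rw [pts, Multiset.map_map, labelWord]
  rfl

theorem getD_labelWord (M : Multiset (ℕ × ℕ)) {n x : ℕ} (h1 : 1 ≤ x) (h2 : x ≤ n) :
    (labelWord M n).getD (x - 1) 0 = label M x := by
  have : x - 1 < (labelWord M n).length := by simp [labelWord]; omega
  rw [List.getD_eq_getElem _ _ this]
  simp [labelWord, Nat.sub_add_cancel h1]

theorem labelWord_mem {n : ℕ} {M : Multiset (ℕ × ℕ)} (h : IsPattern (pts n) M) :
    Finsupp.single (labelWord M n) 1 ∈ wtSp (List.replicate n 1) 0 := by
  have hl : (labelWord M n).length = n := by simp [labelWord]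
  refine single_mem_wtSp ?_ ?_ 1
  · refine List.forall₂_iff_get.mpr ⟨by simp [hl], fun i h1 h2 => ?_⟩
    simp [labelWord, label_le]
  · rw [weight_replicate n _ hl, sum_labelWord, sum_pts_map h]
    have h1 : (M.map fun L => label M L.1 + label M L.2) = M.map fun _ => 1 :=
      Multiset.map_congr rfl fun L hL => by rw [label_fst hL, label_snd h hL]
    have h2 := two_mul_card h
    rw [h1, Multiset.map_const', Multiset.sum_replicate]
    simp only [smul_eq_mul, mul_one]
    omega

theorem capAll_labelWord (q : ℂ) {n : ℕ} {M M' : Multiset (ℕ × ℕ)} (h' : IsPattern (pts n) M') :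
    capAll q M' (Finsupp.single (labelWord M n) 1) =
      (M'.map fun L => capCoef q (label M L.1) (label M L.2)).prod := by
  rw [capAll_single]
  congr 1
  refine Multiset.map_congr rfl fun L hL => ?_
  have e1 := mem_pts.mp (h'.ends_eq ▸ fst_mem_ends hL)
  have e2 := mem_pts.mp (h'.ends_eq ▸ snd_mem_ends hL)
  rw [getD_labelWord M e1.1 e1.2, getD_labelWord M e2.1 e2.2]

theorem capAll_labelWord_self (q : ℂ) (hq0 : q ≠ 0) (hq : ∀ m : ℤ, m ≠ 0 → q ^ m ≠ 1) {n : ℕ}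
    {M : Multiset (ℕ × ℕ)} (h : IsPattern (pts n) M) :
    capAll q M (Finsupp.single (labelWord M n) 1) ≠ 0 := by
  rw [capAll_labelWord q h]
  refine Multiset.prod_ne_zero fun h0 => ?_
  obtain ⟨L, hL, h1⟩ := Multiset.mem_map.mp h0
  rw [label_fst hL, label_snd h hL] at h1
  have hd := qInt_den_ne q hq0 hq
  have h2 := qInt_ne_zero q hq0 hq 2 (by norm_num)
  exact div_ne_zero hd (mul_ne_zero hq0 h2) h1

/-- A nonzero product forces opposite labels on the ends of every link of $M'$. The sum of the
points labelled $0$ is then at least the sum of left endpoints of $M'$, and equality would give $M'$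
the left endpoints of $M$, hence $M'=M$. -/
theorem sum_fst_lt (q : ℂ) {n : ℕ} {M M' : Multiset (ℕ × ℕ)} (h : IsPattern (pts n) M)
    (h' : IsPattern (pts n) M') (hne : capAll q M' (Finsupp.single (labelWord M n) 1) ≠ 0)
    (hMM : M' ≠ M) : (M'.map Prod.fst).sum < (M.map Prod.fst).sum := by
  rw [capAll_labelWord q h'] at hne
  have hcase : ∀ L ∈ M', label M L.1 = 0 ∧ label M L.2 = 1 ∨
      label M L.1 = 1 ∧ label M L.2 = 0 := by
    intro L hL
    have h0 : capCoef q (label M L.1) (label M L.2) ≠ 0 := by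
      intro h0
      exact hne (Multiset.prod_eq_zero (h0 ▸ Multiset.mem_map_of_mem _ hL))
    have e1 := label_le M L.1
    have e2 := label_le M L.2
    generalize label M L.1 = a at *
    generalize label M L.2 = b at *
    interval_cases a <;> interval_cases b <;> simp_all [capCoef]
  -- As labels are at most $1$, the factor `1 - label` is the indicator of label $0$. The sum of
  -- these points is computed once along $M$ and once along $M'$.
  have hsum : (M.map Prod.fst).sum =
      (M'.map fun L => (1 - label M L.1) * L.1 + (1 - label M L.2) * L.2).sum := by
    rw [← sum_pts_map h' fun x => (1 - label M x) * x, sum_pts_map h fun x => (1 - label M x) * x]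
    congr 1
    refine Multiset.map_congr rfl fun L hL => ?_
    rw [label_fst hL, label_snd h hL]; simp
  have hle : ∀ L ∈ M', L.1 ≤ (1 - label M L.1) * L.1 + (1 - label M L.2) * L.2 := by
    intro L hL
    have := h'.lt L hL
    rcases hcase L hL with ⟨e1, e2⟩ | ⟨e1, e2⟩ <;> rw [e1, e2] <;> simp
    omega
  by_cases hall : ∀ L ∈ M', label M L.1 = 0
  · exfalso
    apply hMM
    have hsub : ∀ {x}, x ∈ M'.map Prod.fst → x ∈ M.map Prod.fst := by
      intro x hx
      obtain ⟨L, hL, rfl⟩ := Multiset.mem_map.mp hx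
      have := hall L hL
      unfold label at this
      by_contra hn
      rw [if_neg hn] at this
      omega
    have hnd' := h'.ends_eq.symm ▸ nodup_pts n
    have hnd := h.ends_eq.symm ▸ nodup_pts n
    rw [ends, Multiset.nodup_add] at hnd hnd'
    have hcard : Multiset.card M' = Multiset.card M := by
      have e1 := two_mul_card h
      have e2 := two_mul_card h'
      omega
    have h1 : M'.map Prod.fst = M.map Prod.fst :=
      Multiset.eq_of_le_of_card_le ((Multiset.le_iff_subset hnd'.1).mpr @hsub)
        (by rw [Multiset.card_map, Multiset.card_map, hcard])
    refine h'.eq_of_map_eq h h1 ?_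
    have h2 : ends M' = ends M := h'.ends_eq.trans h.ends_eq.symm
    rw [ends, ends, h1] at h2
    exact add_left_cancel h2
  · push Not at hall
    obtain ⟨L₀, hL₀, hne0⟩ := hall
    rw [hsum]
    obtain ⟨N, rfl⟩ := Multiset.exists_cons_of_mem hL₀
    rw [Multiset.map_cons, Multiset.map_cons, Multiset.sum_cons, Multiset.sum_cons]
    refine add_lt_add_of_lt_of_le ?_ (Multiset.sum_map_le_sum_map _ _ fun L hL =>
      hle L (Multiset.mem_cons_of_mem hL))
    have := h'.lt _ hL₀
    rcases hcase _ hL₀ with ⟨e1, -⟩ | ⟨e1, e2⟩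
    · exact absurd e1 hne0
    · rw [e1, e2]; simpa using this

/-! ### The dual basis of the functionals -/

/-- Inversion of a triangular system by strong induction on the sum of left endpoints: start from
the label word of $M$, make it invariant modulo the image of $F$, and subtract the dual vectors
already found for smaller sums. -/
theorem exists_dual (q : ℂ) (hq0 : q ≠ 0) (hq : ∀ m : ℤ, m ≠ 0 → q ^ m ≠ 1) {N : ℕ}
    {M : Multiset (ℕ × ℕ)} (hM : IsPattern (pts (2 * N)) M) :
    ∃ v ∈ inv q (2 * N), capAll q M v = 1 ∧
      ∀ M', IsPattern (pts (2 * N)) M' → M' ≠ M → capAll q M' v = 0 := by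
  classical
  induction hk : (M.map Prod.fst).sum using Nat.strong_induction_on generalizing M with
  | _ k ih =>
    set e : Words := Finsupp.single (labelWord M (2 * N)) 1 with he
    obtain ⟨u, hu, hE⟩ := exists_actE_sub_actF q hq0 hq (labelWord_mem hM)
    have hx : e - actF q (List.replicate (2 * N) 1) u ∈ inv q (2 * N) :=
      mem_inv.mpr ⟨Submodule.sub_mem _ (labelWord_mem hM) (by simpa using actF_mem q hu), hE⟩
    set x := e - actF q (List.replicate (2 * N) 1) u with hxdef
    -- The correction lies in the image of $F$, so the functionals may still be computed on the
    -- single word $e$.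
    have hcap : ∀ M', IsPattern (pts (2 * N)) M' → capAll q M' x = capAll q M' e := by
      intro M' hM'
      rw [hxdef, map_sub, capAll_actF q hq0 hq hM' hu, sub_zero]
    have hc0 : capAll q M x ≠ 0 := by rw [hcap M hM]; exact capAll_labelWord_self q hq0 hq hM
    let I := (finite_isPattern N).toFinset.filter fun M' => (M'.map Prod.fst).sum < k
    have hI : ∀ M', M' ∈ I ↔ IsPattern (pts (2 * N)) M' ∧ (M'.map Prod.fst).sum < k := by
      intro M'; simp [I]
    have hex : ∀ M', ∃ v ∈ inv q (2 * N), M' ∈ I → capAll q M' v = 1 ∧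
        ∀ M'', IsPattern (pts (2 * N)) M'' → M'' ≠ M' → capAll q M'' v = 0 := by
      intro M'
      by_cases h : M' ∈ I
      · obtain ⟨v, h1, h2⟩ := ih _ ((hI M').mp h).2 ((hI M').mp h).1 rfl
        exact ⟨v, h1, fun _ => h2⟩
      · exact ⟨0, Submodule.zero_mem _, fun h' => absurd h' h⟩
    choose b hb hb' using hex
    have hval : ∀ M', IsPattern (pts (2 * N)) M' →
        capAll q M' (x - ∑ B ∈ I, capAll q B x • b B) = if M' = M then capAll q M x else 0 := by
      intro M' hM'
      have hterm : ∀ B ∈ I, capAll q M' (capAll q B x • b B) =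
          if B = M' then capAll q M' x else 0 := by
        intro B hB
        rw [map_smul, smul_eq_mul]
        split_ifs with h
        · rw [← h, (hb' B hB).1, mul_one]
        · rw [(hb' B hB).2 M' hM' (Ne.symm h), mul_zero]
      rw [map_sub, map_sum, Finset.sum_congr rfl hterm, Finset.sum_ite_eq']
      by_cases h1 : M' = M
      · have h2 : M' ∉ I := fun h => absurd ((hI M').mp h).2 (by rw [h1, hk]; exact lt_irrefl k)
        rw [if_neg h2, if_pos h1, sub_zero, h1]
      · rw [if_neg h1]
        split_ifs with h2
        · rw [sub_self]
        · by_contra hne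
          rw [sub_zero, hcap M' hM'] at hne
          exact h2 ((hI M').mpr ⟨hM', hk ▸ sum_fst_lt q hM hM' hne h1⟩)
    refine ⟨(capAll q M x)⁻¹ • (x - ∑ B ∈ I, capAll q B x • b B),
      Submodule.smul_mem _ _ (Submodule.sub_mem _ hx
        (Submodule.sum_mem _ fun B _ => Submodule.smul_mem _ _ (hb B))), ?_, fun M' hM' h => ?_⟩
    · rw [map_smul, hval M hM, if_pos rfl, smul_eq_mul, inv_mul_cancel₀ hc0]
    · rw [map_smul, hval M' hM', if_neg h, smul_zero]

/-- A pair partition is determined, with its number of points, by its links. -/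
theorem isPattern_unique {N N' : ℕ} {M : Multiset (ℕ × ℕ)} (h : IsPattern (pts (2 * N)) M)
    (h' : IsPattern (pts (2 * N')) M) : N = N' := by
  have := two_mul_card h
  have := two_mul_card h'
  omega

/-- Take the dual basis for $v_\alpha$. Each equation is between invariants, so it may be tested by
the functionals, where insertion of $(j,j+1)$ turns it into the duality relations. -/
theorem exists_isPairFamily (q : ℂ) (hq0 : q ≠ 0) (hq : ∀ m : ℤ, m ≠ 0 → q ^ m ≠ 1) :
    ∃ v, IsPairFamily q v := by
  classical
  have hex : ∀ α : Diagram, ∃ v : Words, ((∀ N, α ∉ PP N) → v = 0) ∧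
      ∀ N, α ∈ PP N → v ∈ inv q (2 * N) ∧ capAll q α.links v = 1 ∧
        ∀ M', IsPattern (pts (2 * N)) M' → M' ≠ α.links → capAll q M' v = 0 := by
    intro α
    by_cases h : ∃ N, α ∈ PP N
    · obtain ⟨N, hN⟩ := h
      obtain ⟨v, h1, h2⟩ := exists_dual q hq0 hq (mem_PP_iff.mp hN).2
      refine ⟨v, fun h => absurd hN (h N), fun N' hN' => ?_⟩
      obtain rfl := isPattern_unique (mem_PP_iff.mp hN).2 (mem_PP_iff.mp hN').2
      exact ⟨h1, h2⟩
    · push Not at h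
      exact ⟨0, fun _ => rfl, fun N hN => absurd hN (h N)⟩
  choose v hoff hv using hex
  refine ⟨v, hoff, fun N α hα => (mem_hwSpace_replicate q hq0 hq _ _).mpr (hv α N hα).1,
    ?_, ?_, ?_⟩
  · intro N α hα j hj1 hj2 hj
    obtain ⟨M, rfl⟩ : ∃ M, α = ⟨M, 0⟩ := ⟨α.links, Diagram.ext rfl (mem_PP_iff.mp hα).1⟩
    obtain ⟨N, rfl⟩ : ∃ K, N = K + 1 := ⟨N - 1, by omega⟩
    obtain ⟨-, h2, M, hM', rfl⟩ := (mem_PP_iff.mp hα).2.exists_insertLink hj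
    rw [removeLink_insertLink]
    obtain ⟨a1, a2, a3⟩ := hv _ _ hα
    obtain ⟨b1, b2, b3⟩ := hv ⟨M, 0⟩ N (mem_PP_iff.mpr ⟨rfl, hM'⟩)
    refine sub_eq_zero.mp (eq_zero_of_capAll q hq0 hq
      (Submodule.sub_mem _ (capProj_mem_inv q hq0 hq hj1 h2 a1) b1) fun M' hM'' => ?_)
    rw [map_sub, ← capAll_insertLink q hj1 h2 hM'' (mem_inv.mp a1).1]
    by_cases he : M' = M
    · rw [he, a2, b2, sub_self]
    · rw [a3 _ ((isPattern_insertLink hj1 h2).mpr hM'')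
        (fun h => he (insertLink_injective j h)), b3 M' hM'' he, sub_self]
  · intro N α hα j hj1 hj2 hj
    obtain ⟨N, rfl⟩ : ∃ K, N = K + 1 := ⟨N - 1, by omega⟩
    obtain ⟨a1, a2, a3⟩ := hv _ _ hα
    have h2 : j ≤ 2 * N + 1 := by omega
    refine eq_zero_of_capAll q hq0 hq (capProj_mem_inv q hq0 hq hj1 h2 a1) fun M' hM'' => ?_
    rw [← capAll_insertLink q hj1 h2 hM'' (mem_inv.mp a1).1]
    exact a3 _ ((isPattern_insertLink hj1 h2).mpr hM'') fun h => hj (h ▸ mem_insertLink j M')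
  · have h0 : IsPattern (pts (2 * 0)) 0 := ⟨by simp, by simp [ends, pts], by simp⟩
    obtain ⟨a1, a2, -⟩ := hv ⟨0, 0⟩ 0 (mem_PP_iff.mpr ⟨rfl, h0⟩)
    have hs : Finsupp.single [] 1 ∈ inv q (2 * 0) :=
      mem_inv.mpr ⟨single_mem_wtSp List.Forall₂.nil rfl 1, by simp [eWord]⟩
    refine sub_eq_zero.mp (eq_zero_of_capAll q hq0 hq (Submodule.sub_mem _ a1 hs) fun M' hM' => ?_)
    have : M' = 0 := by simpa using two_mul_card hM'
    rw [this, map_sub, a2, capAll_single]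
    simp

/-- By induction on the number of links, the difference of two solutions is invariant with all
projections zero. -/
theorem IsPairFamily.eq {q : ℂ} (hq0 : q ≠ 0) (hq : ∀ m : ℤ, m ≠ 0 → q ^ m ≠ 1)
    {v v' : Diagram → Words} (h : IsPairFamily q v) (h' : IsPairFamily q v') : v = v' := by
  have key : ∀ N, ∀ α ∈ PP N, v α = v' α := by
    intro N
    induction N with
    | zero =>
      intro α hα
      obtain ⟨h1, h2⟩ := mem_PP_iff.mp hα
      have h3 : α = ⟨0, 0⟩ := Diagram.ext (by simpa using two_mul_card h2) h1
      rw [h3, h.empty, h'.empty]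
    | succ N ih =>
      intro α hα
      have h1 := (mem_hwSpace_replicate q hq0 hq _ _).mp (h.mem _ α hα)
      have h2 := (mem_hwSpace_replicate q hq0 hq _ _).mp (h'.mem _ α hα)
      obtain ⟨h3, h4⟩ := mem_inv.mp (Submodule.sub_mem _ h1 h2)
      refine sub_eq_zero.mp (eq_zero_of_capProj q hq0 hq (by omega) h3 h4 fun j hj1 hj2 => ?_)
      rw [map_sub]
      by_cases hj : (j, j + 1) ∈ α.links
      · rw [h.proj_of_mem _ α hα j hj1 hj2 hj, h'.proj_of_mem _ α hα j hj1 hj2 hj]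
        obtain ⟨M, rfl⟩ : ∃ M, α = ⟨M, 0⟩ := ⟨α.links, Diagram.ext rfl (mem_PP_iff.mp hα).1⟩
        obtain ⟨-, -, M, hM', rfl⟩ := (mem_PP_iff.mp hα).2.exists_insertLink hj
        rw [removeLink_insertLink, ih _ (mem_PP_iff.mpr ⟨rfl, hM'⟩), sub_self]
      · rw [h.proj_of_notMem _ α hα j hj1 hj2 hj, h'.proj_of_notMem _ α hα j hj1 hj2 hj, sub_self]
  funext α
  by_cases hα : ∃ N, α ∈ PP N
  · obtain ⟨N, hN⟩ := hα
    exact key N α hN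
  · push Not at hα
    rw [h.off α hα, h'.off α hα]

theorem isPairFamily_pairVec (q : ℂ) (hq0 : q ≠ 0) (hq : ∀ m : ℤ, m ≠ 0 → q ^ m ≠ 1) :
    IsPairFamily q (pairVec q) := Classical.epsilon_spec (exists_isPairFamily q hq0 hq)

/-! ### Rotation of tensor components -/

/-- The last (leftmost) tensor component is moved to the right. -/
def shift : Words →ₗ[ℂ] Words :=
  Finsupp.lmapDomain ℂ ℂ fun w : List ℕ => w.getLastD 0 :: w.dropLast

/-- The last (leftmost) tensor component, of valence `s`, is moved to the right after the action
of `(-1) ^ s K⁻¹`. -/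
def rot (q : ℂ) (s : ℕ) : Words →ₗ[ℂ] Words :=
  Finsupp.linearCombination ℂ fun w =>
    ((-1 : ℂ) ^ s * q ^ (2 * (w.getLastD 0 : ℤ) - s)) • shift (Finsupp.single w 1)

theorem shift_tensLeft (x : ℕ) (u : Words) : shift (tensLeft x u) = tensRight x u :=
  eq_of_eq_single (shift ∘ₗ tensLeft x) (tensRight x)
    (by simp [shift, Finsupp.lmapDomain_apply]) u

theorem rot_tensLeft (q : ℂ) (s x : ℕ) (u : Words) :
    rot q s (tensLeft x u) = ((-1 : ℂ) ^ s * q ^ (2 * (x : ℤ) - s)) • tensRight x u := by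
  refine eq_of_eq_single (rot q s ∘ₗ tensLeft x)
    (((-1 : ℂ) ^ s * q ^ (2 * (x : ℤ) - s)) • tensRight x) (fun w => ?_) u
  rw [LinearMap.comp_apply, LinearMap.smul_apply, ← shift_tensLeft, tensLeft_single, rot,
    Finsupp.linearCombination_single, one_smul]
  simp only [List.getLastD_concat]

theorem Adm.exists_concat {s : ℕ} {ς w : List ℕ} (h : Adm w (ς ++ [s])) :
    ∃ w' x, w = w' ++ [x] ∧ Adm w' ς ∧ x ≤ s := by
  obtain ⟨w', w₂, rfl, h1, h2⟩ := h.append_inv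
  obtain ⟨x, w₃, rfl, hx, h3⟩ := h2.exists_cons
  have : w₃ = [] := by simpa using h3
  exact ⟨w', x, by rw [this], h1, hx⟩

theorem weight_concat {ς w : List ℕ} (h : Adm w ς) (s x : ℕ) :
    weight (ς ++ [s]) (w ++ [x]) = weight ς w + (s - 2 * x) := by
  rw [weight_append h.length_eq]
  simp [weight]

theorem eWord_concat (q : ℂ) (hq0 : q ≠ 0) {ς w : List ℕ} (h : Adm w ς) (s x : ℕ) :
    eWord q (ς ++ [s]) (w ++ [x]) =
      (q ^ weight ς w * if x = 0 then 0 else qInt q x * qInt q ((s : ℤ) - x + 1)) •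
        tensLeft (x - 1) (Finsupp.single w 1) + tensLeft x (eWord q ς w) := by
  rw [eWord_append q hq0 h.length_eq, appendLeft_singleton]
  congr 1
  simp only [eWord]
  split_ifs <;> simp [-Finsupp.single_mul]

theorem fWord_concat (q : ℂ) (hq0 : q ≠ 0) {ς w : List ℕ} (h : Adm w ς) (s x : ℕ) :
    fWord q (ς ++ [s]) (w ++ [x]) =
      (if x < s then 1 else 0 : ℂ) • tensLeft (x + 1) (Finsupp.single w 1) +
        q ^ (2 * (x : ℤ) - s) • tensLeft x (fWord q ς w) := by
  rw [fWord_append q hq0 h.length_eq, appendLeft_singleton]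
  congr 1
  · simp only [fWord]
    split_ifs <;> simp [weight]
  · simp [weight]

theorem rot_mem {q : ℂ} {s : ℕ} {ς : List ℕ} {n : ℤ} {v : Words} (hv : v ∈ wtSp (ς ++ [s]) n) :
    rot q s v ∈ wtSp (s :: ς) n := by
  refine mapsTo_supported _ _ _ ?_ hv
  rintro w ⟨hw, rfl⟩
  obtain ⟨w, x, rfl, h1, hx⟩ := hw.exists_concat
  rw [← tensLeft_single, rot_tensLeft]
  refine Submodule.smul_mem _ _ (tensRight_mem_wtSp hx (single_mem_wtSp h1 rfl 1) ?_)
  rw [weight_concat h1, add_comm]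

/-- At total weight zero the moved component and the rest have opposite weights. The scalar from
$K^{-1}$ therefore supplies the factor lost from one term of $\Delta(E)$ and cancels the one gained
in the other. -/
theorem actE_rot (q : ℂ) (hq0 : q ≠ 0) {s : ℕ} {ς : List ℕ} {v : Words}
    (hv : v ∈ wtSp (ς ++ [s]) 0) :
    actE q (s :: ς) (rot q s v) = (-1 : ℂ) ^ s • shift (actE q (ς ++ [s]) v) := by
  refine eqOn_wtSp (actE q (s :: ς) ∘ₗ rot q s) ((-1 : ℂ) ^ s • (shift ∘ₗ actE q (ς ++ [s]))) hv
    fun w hw h0 => ?_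
  obtain ⟨w, x, rfl, h1, hx⟩ := hw.exists_concat
  rw [weight_concat h1] at h0
  have hwt : weight ς w = 2 * x - s := by linarith
  rw [LinearMap.comp_apply, LinearMap.smul_apply, LinearMap.comp_apply, actE_single, one_smul,
    eWord_concat q hq0 h1, ← tensLeft_single, rot_tensLeft, map_add, map_smul, map_smul,
    shift_tensLeft, shift_tensLeft, actE_tensRight, actE_single, one_smul, hwt, smul_add, smul_add,
    smul_smul, smul_smul, smul_smul, mul_assoc, mul_assoc, ← zpow_add₀ hq0,
    show (2 * (x : ℤ) - s) + (s - 2 * x) = 0 by ring, zpow_zero, mul_one, add_comm]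

/-- The coefficient of `e_x` in the last (leftmost) tensor component. -/
def lastSlice (x : ℕ) : Words →ₗ[ℂ] Words :=
  Finsupp.lcomapDomain (fun w : List ℕ => w ++ [x]) (List.append_left_injective [x])

theorem lastSlice_tensLeft (x y : ℕ) (v : Words) :
    lastSlice x (tensLeft y v) = if x = y then v else 0 := by
  have : lastSlice x ∘ₗ tensLeft y = if x = y then LinearMap.id else 0 := by
    refine LinearMap.ext (eq_of_eq_single _ _ fun w => ?_)
    ext w'
    have h1 : lastSlice x (tensLeft y (Finsupp.single w 1)) w' =
        (Finsupp.single (w ++ [y]) (1 : ℂ)) (w' ++ [x]) := by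
      rw [tensLeft_single]; rfl
    rw [LinearMap.comp_apply, h1, Finsupp.single_apply]
    by_cases hxy : x = y
    · simp [hxy, Finsupp.single_apply]
    · simp [hxy, Ne.symm hxy]
  rw [← LinearMap.comp_apply, this]
  split_ifs <;> rfl

theorem lastSlice_mem {ς : List ℕ} {s x : ℕ} {n : ℤ} {v : Words} (hv : v ∈ wtSp (ς ++ [s]) n) :
    lastSlice x v ∈ wtSp ς (n - (s - 2 * x)) := by
  refine mapsTo_supported _ _ _ ?_ hv
  rintro w ⟨hw, rfl⟩
  obtain ⟨w, y, rfl, h1, hy⟩ := hw.exists_concat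
  rw [← tensLeft_single, lastSlice_tensLeft]
  split_ifs with h
  · subst h
    exact single_mem_wtSp h1 (by rw [weight_concat h1]; ring) 1
  · exact Submodule.zero_mem _

theorem eq_sum_tensLeft {ς : List ℕ} {s : ℕ} {n : ℤ} {v : Words} (hv : v ∈ wtSp (ς ++ [s]) n) :
    v = ∑ l ∈ Finset.range (s + 1), tensLeft l (lastSlice l v) := by
  have := eqOn_wtSp LinearMap.id (∑ l ∈ Finset.range (s + 1), tensLeft l ∘ₗ lastSlice l) hv
    fun w hw _ => ?_
  · simpa using this
  obtain ⟨w, x, rfl, h1, hx⟩ := hw.exists_concat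
  rw [← tensLeft_single, LinearMap.id_apply, LinearMap.sum_apply, Finset.sum_eq_single x]
  · rw [LinearMap.comp_apply, lastSlice_tensLeft, if_pos rfl]
  · intro l _ hl
    rw [LinearMap.comp_apply, lastSlice_tensLeft, if_neg hl, map_zero]
  · intro h
    exact absurd (Finset.mem_range.mpr (by omega)) h

/-- $E$ only lowers the leftmost label, so nothing enters the top slice from other slices; this
makes it a highest weight vector. -/
theorem lastSlice_actE (q : ℂ) (hq0 : q ≠ 0) {ς : List ℕ} {s : ℕ} {n : ℤ} {v : Words}
    (hv : v ∈ wtSp (ς ++ [s]) n) :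
    lastSlice s (actE q (ς ++ [s]) v) = actE q ς (lastSlice s v) := by
  refine eqOn_wtSp (lastSlice s ∘ₗ actE q (ς ++ [s])) (actE q ς ∘ₗ lastSlice s) hv
    fun w hw h0 => ?_
  obtain ⟨w, x, rfl, h1, hx⟩ := hw.exists_concat
  rw [LinearMap.comp_apply, LinearMap.comp_apply, actE_single, one_smul, eWord_concat q hq0 h1,
    ← tensLeft_single, map_add, map_smul, lastSlice_tensLeft, lastSlice_tensLeft,
    lastSlice_tensLeft]
  by_cases h3 : x = 0
  · subst h3
    by_cases h2 : s = 0 <;> simp [h2]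
  · rw [if_neg (show s ≠ x - 1 by omega)]
    by_cases h2 : s = x <;> simp [h2]

theorem lastSlice_actF (q : ℂ) (hq0 : q ≠ 0) {ς : List ℕ} {s l : ℕ} (hl : l < s) {n : ℤ}
    {v : Words} (hv : v ∈ wtSp (ς ++ [s]) n) :
    lastSlice (l + 1) (actF q (ς ++ [s]) v) =
      lastSlice l v + q ^ (2 * ((l : ℤ) + 1) - s) • actF q ς (lastSlice (l + 1) v) := by
  refine eqOn_wtSp (lastSlice (l + 1) ∘ₗ actF q (ς ++ [s]))
    (lastSlice l + q ^ (2 * ((l : ℤ) + 1) - s) • (actF q ς ∘ₗ lastSlice (l + 1))) hv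
    fun w hw h0 => ?_
  obtain ⟨w, x, rfl, h1, hx⟩ := hw.exists_concat
  rw [LinearMap.comp_apply, LinearMap.add_apply, LinearMap.smul_apply, LinearMap.comp_apply,
    actF_single, one_smul, fWord_concat q hq0 h1,
    ← tensLeft_single, map_add, map_smul, map_smul, lastSlice_tensLeft, lastSlice_tensLeft,
    lastSlice_tensLeft, lastSlice_tensLeft]
  congr 1
  · by_cases h2 : l = x
    · subst h2; simp [hl]
    · simp [h2]
  · by_cases h2 : l + 1 = x
    · subst h2; simp
    · simp [h2]

/-- The preimage is the top slice of $v$: by $F.v=0$, `lastSlice_actF` determines each lower slice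
from the one above. -/
theorem exists_rPlusInv (q : ℂ) (hq0 : q ≠ 0) (hq : ∀ m : ℤ, m ≠ 0 → q ^ m ≠ 1) {ς : List ℕ}
    {s : ℕ} {v : Words} (hv : v ∈ hwSpace q (ς ++ [s]) 0) :
    ∃ τ ∈ hwSpace q ς s, v = rPlusInv q ς s τ := by
  obtain ⟨h1, h2⟩ := (mem_hwSpace_iff q hq0 hq _ _ _).mp hv
  rw [Nat.cast_zero] at h1
  have hF := actF_eq_zero q hq0 hq h1 h2
  refine ⟨lastSlice s v, (mem_hwSpace_iff q hq0 hq _ _ _).mpr ⟨?_, ?_⟩, ?_⟩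
  · have := lastSlice_mem (x := s) h1
    rwa [show (0 : ℤ) - (s - 2 * s) = s by ring] at this
  · rw [← lastSlice_actE q hq0 h1, h2, map_zero]
  · have hslice : ∀ k ≤ s, lastSlice (s - k) v =
        ((-1 : ℂ) ^ k * q ^ ((s - k + 1) * k)) • (actF q ς ^ k) (lastSlice s v) := by
      intro k hk
      induction k with
      | zero => simp
      | succ k ih =>
        have h3 := lastSlice_actF q hq0 (l := s - (k + 1)) (by omega) h1
        rw [hF, map_zero, show s - (k + 1) + 1 = s - k by omega, ih (by omega), map_smul,
          ← Module.End.mul_apply, ← pow_succ', smul_smul] at h3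
        rw [eq_neg_of_add_eq_zero_left h3.symm, ← neg_smul]
        congr 1
        -- With $s=k+1+d$ the exponents add up as $2(d+1)-s+(d+2)k=(d+1)(k+1)$.
        obtain ⟨d, rfl⟩ := Nat.exists_eq_add_of_le hk
        have e1 : k + 1 + d - (k + 1) = d := by omega
        have e2 : k + 1 + d - k = d + 1 := by omega
        rw [e1, e2, pow_succ, mul_left_comm, ← zpow_natCast q, ← zpow_natCast q, ← zpow_add₀ hq0]
        rw [show (2 * ((d : ℤ) + 1) - (k + 1 + d : ℕ)) + ((d + 1 + 1) * k : ℕ) =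
          ((d + 1) * (k + 1) : ℕ) by push_cast; ring]
        ring
    conv_lhs => rw [eq_sum_tensLeft h1]
    refine Finset.sum_congr rfl fun l hl => ?_
    have hl' := Finset.mem_range.mp hl
    have h3 := hslice (s - l) (by omega)
    rw [show s - (s - l) = l by omega] at h3
    rw [h3, map_smul]

/-- The two expansions agree term by term for every $\tau$ that represents $v$, so any value chosen
by `rPlus` serves. -/
theorem smul_cyc (q : ℂ) (hq0 : q ≠ 0) (hq : ∀ m : ℤ, m ≠ 0 → q ^ m ≠ 1) {ς : List ℕ}
    {s : ℕ} {v : Words} (hv : v ∈ hwSpace q (ς ++ [s]) 0) :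
    (-q) ^ s • cyc q ς s v = rot q s v := by
  obtain ⟨τ, hτ⟩ := exists_rPlusInv q hq0 hq hv
  have h1 : v = rPlusInv q ς s (rPlus q ς s v) :=
    (Classical.epsilon_spec (p := fun τ => τ ∈ hwSpace q ς s ∧ v = rPlusInv q ς s τ) ⟨τ, hτ⟩).2
  conv_rhs => rw [h1]
  rw [cyc]
  generalize rPlus q ς s v = t
  rw [rMinusInv, rPlusInv, map_sum, Finset.smul_sum]
  refine Finset.sum_congr rfl fun l hl => ?_
  obtain ⟨d, rfl⟩ := Nat.exists_eq_add_of_le (Nat.lt_succ_iff.mp (Finset.mem_range.mp hl))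
  rw [map_smul, rot_tensLeft, smul_smul, smul_smul, Nat.add_sub_cancel_left, neg_pow]
  congr 1
  -- This is $s+(l-1)(s-l)=(l+1)(s-l)+(2l-s)$ with $s=l+d$.
  have h2 : q ^ (l + d) * q ^ (((l : ℤ) - 1) * (((l + d : ℕ) : ℤ) - l)) =
      q ^ ((l + 1) * d) * q ^ (2 * (l : ℤ) - (l + d : ℕ)) := by
    rw [← zpow_natCast q, ← zpow_natCast q, ← zpow_add₀ hq0, ← zpow_add₀ hq0]
    congr 1
    push_cast
    ring
  linear_combination (-1 : ℂ) ^ (l + d) * (-1 : ℂ) ^ d * h2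

/-! ### Rotation of the vectors of pair partitions -/

theorem rot_mem_inv (q : ℂ) (hq0 : q ≠ 0) {n : ℕ} {v : Words} (hv : v ∈ inv q (n + 1)) :
    rot q 1 v ∈ inv q (n + 1) := by
  obtain ⟨h1, h2⟩ := mem_inv.mp hv
  rw [List.replicate_succ'] at h1 h2
  rw [mem_inv, List.replicate_succ]
  exact ⟨rot_mem h1, by rw [actE_rot q hq0 h1, h2, map_zero, smul_zero]⟩

theorem capProj_concat (q : ℂ) {j : ℕ} {w : List ℕ} (hj : j + 1 ≤ w.length) (hj1 : 1 ≤ j) (x : ℕ) :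
    capProj q j (Finsupp.single (w ++ [x]) 1) = tensLeft x (capProj q j (Finsupp.single w 1)) := by
  rw [capProj_single, capProj_single, tensLeft_single, List.take_append_of_le_length (by omega),
    List.drop_append_of_le_length (by omega), List.getD_append _ _ _ _ (by omega),
    List.getD_append _ _ _ _ (by omega), List.append_assoc]

/-- For $j\le n$ the projected components do not include the last one, which is the one that moves.
-/
theorem capProj_rot (q : ℂ) {n j : ℕ} (h1 : 1 ≤ j) (h2 : j ≤ n) {m : ℤ} {v : Words}
    (hv : v ∈ wtSp (List.replicate (n + 2) 1) m) :
    capProj q (j + 1) (rot q 1 v) = rot q 1 (capProj q j v) := by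
  rw [List.replicate_succ'] at hv
  rw [← LinearMap.comp_apply, ← LinearMap.comp_apply]
  refine eqOn_wtSp _ _ hv fun w hw _ => ?_
  obtain ⟨w, x, rfl, h3, hx⟩ := hw.exists_concat
  have hl : w.length = n + 1 := by simpa using h3.length_eq
  rw [LinearMap.comp_apply, LinearMap.comp_apply, capProj_concat q (by omega) h1,
    ← tensLeft_single, rot_tensLeft, rot_tensLeft, map_smul, capProj_tensRight q j x h1]

/-- On $e_1\otimes e_0-q\,e_0\otimes e_1$ the twisted rotation exchanges the two terms. -/
theorem rot_of_mem_inv_two (q : ℂ) (hq0 : q ≠ 0) (hq : ∀ m : ℤ, m ≠ 0 → q ^ m ≠ 1) {v : Words}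
    (hv : v ∈ inv q 2) : rot q 1 v = v := by
  obtain ⟨h1, h2⟩ := mem_inv.mp hv
  have h3 : v = v [0, 1] • tensLeft 1 (Finsupp.single [0] 1) +
      v [1, 0] • tensLeft 0 (Finsupp.single [1] 1) := by
    refine eqOn_wtSp LinearMap.id
      ((Finsupp.lapply [0, 1]).smulRight (tensLeft 1 (Finsupp.single [0] 1)) +
        (Finsupp.lapply [1, 0]).smulRight (tensLeft 0 (Finsupp.single [1] 1))) h1 fun w hw h0 => ?_
    simp only [List.replicate_succ, List.replicate_zero] at hw h0
    obtain ⟨a, w, rfl, ha, hw⟩ := hw.exists_cons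
    obtain ⟨b, w, rfl, hb, hw⟩ := hw.exists_cons
    have : w = [] := by simpa using hw
    subst this
    simp only [weight] at h0
    have hab : a + b = 1 := by omega
    interval_cases a
    · obtain rfl : b = 1 := by omega
      simp
    · obtain rfl : b = 0 := by omega
      simp
  have hd := qInt_den_ne q hq0 hq
  have h4 : v [1, 0] = -q * v [0, 1] := by
    rw [h3] at h2
    have h5 := DFunLike.congr_fun h2 [0, 0]
    simp [eWord, qInt_one q hd, -Finsupp.single_mul] at h5
    linear_combination h5
  rw [h3, map_add, map_smul, map_smul, rot_tensLeft, rot_tensLeft, h4]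
  have e1 : q ^ (2 * ((1 : ℕ) : ℤ) - ((1 : ℕ) : ℤ)) = q := by norm_num
  have e2 : q ^ (2 * ((0 : ℕ) : ℤ) - ((1 : ℕ) : ℤ)) = q⁻¹ := by norm_num
  rw [e1, e2, add_comm, smul_smul, smul_smul]
  simp only [tensRight_single, tensLeft_single, List.cons_append, List.nil_append]
  congr 2
  · field_simp
  · ring

/-- The theorem for valence one. The empty partition is left out because `shift` sends the empty
word to a word of length one. -/
theorem pairVec_twist (q : ℂ) (hq0 : q ≠ 0) (hq : ∀ m : ℤ, m ≠ 0 → q ^ m ≠ 1) {N : ℕ}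
    {M : Multiset (ℕ × ℕ)} (hM : IsPattern (pts (2 * (N + 1))) M) :
    pairVec q ⟨twist (cycPt (2 * (N + 1))) M, 0⟩ = rot q 1 (pairVec q ⟨M, 0⟩) := by
  have hfam := isPairFamily_pairVec q hq0 hq
  have hmem : ∀ {K : ℕ} {M : Multiset (ℕ × ℕ)}, IsPattern (pts (2 * K)) M →
      pairVec q ⟨M, 0⟩ ∈ inv q (2 * K) := fun {K M} h =>
    (mem_hwSpace_replicate q hq0 hq _ _).mp (hfam.mem K ⟨M, 0⟩ (mem_PP_iff.mpr ⟨rfl, h⟩))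
  induction N generalizing M with
  | zero =>
    have hv := hmem hM
    rw [rot_of_mem_inv_two q hq0 hq hv]
    obtain ⟨j, hj⟩ := hM.exists_neighbour_link (by omega)
    obtain ⟨h1, h2, M', hM', rfl⟩ := IsPattern.exists_insertLink (n := 0) hM hj
    obtain rfl : M' = 0 := by simpa using two_mul_card hM'
    obtain rfl : j = 1 := by omega
    rfl
  | succ N ih =>
    have h1 := hmem hM
    have h2 := hmem hM.twist_pts
    rw [show 2 * (N + 1 + 1) = 2 * N + 2 + 2 by ring] at h1 h2 ⊢
    have hd := Submodule.sub_mem _ h2 (rot_mem_inv q hq0 h1)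
    obtain ⟨h3, h4⟩ := mem_inv.mp hd
    -- The first projection of the rotated vector would involve the component that wraps around; it
    -- is never computed.
    refine sub_eq_zero.mp (eq_zero_of_capProj_of_two_le q hq0 hq (by omega) h3 h4
      fun j hj1 hj2 => ?_)
    obtain ⟨j, rfl⟩ : ∃ i, j = i + 1 := ⟨j - 1, by omega⟩
    have hP : (⟨M, 0⟩ : Diagram) ∈ PP (N + 1 + 1) := mem_PP_iff.mpr ⟨rfl, hM⟩
    have hP' : (⟨twist (cycPt (2 * N + 2 + 2)) M, 0⟩ : Diagram) ∈ PP (N + 1 + 1) :=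
      mem_PP_iff.mpr ⟨rfl, hM.twist_pts⟩
    rw [map_sub, capProj_rot q (by omega) (by omega) (mem_inv.mp h1).1]
    by_cases hj : (j, j + 1) ∈ M
    · have hrem := hfam.proj_of_mem _ _ hP j (by omega) (by omega) hj
      obtain ⟨-, -, B, hB, rfl⟩ := IsPattern.exists_insertLink (n := 2 * N + 2) hM hj
      rw [twist_insertLink (by omega) (by omega) hB] at hP' ⊢
      rw [hfam.proj_of_mem _ _ hP' (j + 1) (by omega) (by omega) (mem_insertLink _ _), hrem,
        removeLink_insertLink, removeLink_insertLink]
      exact sub_eq_zero.mpr (ih hB)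
    · rw [hfam.proj_of_notMem _ _ hP j (by omega) (by omega) hj, map_zero, sub_zero]
      refine hfam.proj_of_notMem _ _ hP' (j + 1) (by omega) (by omega) fun h => hj ?_
      have := mem_of_mem_twist (n := 2 * N + 2 + 2) hj1 hM h
      simpa using this

theorem pairVec_iterate_twist (q : ℂ) (hq0 : q ≠ 0) (hq : ∀ m : ℤ, m ≠ 0 → q ^ m ≠ 1) {n : ℕ}
    (hn : n ≠ 0) {M : Multiset (ℕ × ℕ)} (hM : IsPattern (pts n) M) (k : ℕ) :
    pairVec q ⟨(twist (cycPt n))^[k] M, 0⟩ = (rot q 1 ^ k) (pairVec q ⟨M, 0⟩) := by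
  induction k with
  | zero => rfl
  | succ k ih =>
    have hk := hM.iterate_twist_pts k
    obtain ⟨N, rfl⟩ : ∃ N, n = 2 * (N + 1) :=
      ⟨Multiset.card M - 1, by have := two_mul_card hM; omega⟩
    rw [Function.iterate_succ_apply', pairVec_twist q hq0 hq hk, ih, pow_succ',
      Module.End.mul_apply]

/-! ### The projection to the tensor product of irreducible representations -/

theorem blockProj_single (q : ℂ) (ς w : List ℕ) :
    blockProj q ς (Finsupp.single w 1) = blockWord q ς w := by simp [blockProj]

theorem blockProj_appendRight (q : ℂ) (ς : List ℕ) (w : List ℕ) (u : Words) :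
    blockProj q (w.length :: ς) (appendRight w u) =
      topCoef q w • tensRight w.sum (blockProj q ς u) := by
  refine eq_of_eq_single (blockProj q (w.length :: ς) ∘ₗ appendRight w)
    (topCoef q w • (tensRight w.sum ∘ₗ blockProj q ς)) (fun w' => ?_) u
  simp [blockProj_single, blockWord]

theorem blockProj_appendLeft (q : ℂ) {s m : ℕ} (ς w : List ℕ) {u : Words}
    (hu : u ∈ Finsupp.supported ℂ ℂ {l : List ℕ | l.length = s ∧ l.sum = m}) :
    blockProj q (s :: ς) (appendLeft w u) = topFun q u • tensRight m (blockWord q ς w) := by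
  refine eqOn_supported (blockProj q (s :: ς) ∘ₗ appendLeft w)
    ((topFun q).smulRight (tensRight m (blockWord q ς w))) _ ?_ hu
  rintro l ⟨rfl, rfl⟩
  simp [blockProj_single, blockWord, topFun]

theorem blockWord_cons (q : ℂ) (ς w₁ w₂ : List ℕ) :
    blockWord q (w₁.length :: ς) (w₁ ++ w₂) =
      topCoef q w₁ • tensRight w₁.sum (blockWord q ς w₂) := by
  simp [blockWord]

theorem exists_append_of_adm_replicate {s n : ℕ} {w : List ℕ}
    (h : Adm w (List.replicate (s + n) 1)) :
    ∃ w₁ w₂, w = w₁ ++ w₂ ∧ Adm w₁ (List.replicate s 1) ∧ Adm w₂ (List.replicate n 1) ∧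
      w₁.length = s ∧ w₂.length = n := by
  rw [← List.replicate_append_replicate] at h
  obtain ⟨w₁, w₂, rfl, h1, h2⟩ := h.append_inv
  exact ⟨w₁, w₂, rfl, h1, h2, by simpa using h1.length_eq, by simpa using h2.length_eq⟩

theorem sum_le_of_adm_replicate {s : ℕ} {w : List ℕ} (h : Adm w (List.replicate s 1)) :
    w.sum ≤ s := by
  have := abs_weight_le h
  rw [weight_replicate s w (by simpa using h.length_eq), List.sum_replicate, abs_le] at this
  simp only [smul_eq_mul, mul_one] at this
  omega

theorem blockWord_mem (q : ℂ) {ς w : List ℕ} (h : Adm w (List.replicate ς.sum 1)) :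
    blockWord q ς w ∈ wtSp ς (weight (List.replicate ς.sum 1) w) := by
  induction ς generalizing w with
  | nil =>
    obtain rfl : w = [] := by simpa using h
    exact single_mem_wtSp List.Forall₂.nil rfl 1
  | cons s ς ih =>
    rw [List.sum_cons] at h ⊢
    obtain ⟨w₁, w₂, rfl, h1, h2, h3, -⟩ := exists_append_of_adm_replicate h
    rw [← List.replicate_append_replicate, weight_append h1.length_eq,
      weight_replicate s w₁ h3]
    have hle := sum_le_of_adm_replicate h1
    subst h3
    rw [blockWord_cons]
    exact Submodule.smul_mem _ _ (tensRight_mem_wtSp hle (ih h2) rfl)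

theorem blockProj_mem (q : ℂ) {ς : List ℕ} {n : ℤ} {v : Words}
    (hv : v ∈ wtSp (List.replicate ς.sum 1) n) : blockProj q ς v ∈ wtSp ς n := by
  refine mapsTo_supported _ _ _ ?_ hv
  rintro w ⟨hw, rfl⟩
  rw [blockProj_single]
  exact blockWord_mem q hw

/-- The coproduct splits $E$ between the first block and the rest; `topFun_eWord` treats the block
and the induction hypothesis the rest. -/
theorem blockProj_eWord (q : ℂ) (hq0 : q ≠ 0) (hd : q - q⁻¹ ≠ 0) {ς w : List ℕ}
    (h : Adm w (List.replicate ς.sum 1)) :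
    blockProj q ς (eWord q (List.replicate ς.sum 1) w) = actE q ς (blockWord q ς w) := by
  induction ς generalizing w with
  | nil => simp [eWord, blockWord]
  | cons s ς ih =>
    rw [List.sum_cons] at h ⊢
    obtain ⟨w₁, w₂, rfl, h1, h2, h3, -⟩ := exists_append_of_adm_replicate h
    have hs := eWord_supported q (List.replicate s 1) w₁ h1.length_eq
    have hs' := Finsupp.supported_mono (M := ℂ) (R := ℂ)
      (t := {l : List ℕ | l.length = s ∧ l.sum = w₁.sum - 1})
      (by
        rintro l ⟨e1, e2⟩
        rw [List.length_replicate] at e1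
        exact ⟨e1, by omega⟩) hs
    have htop := (topFun_eWord q hq0 hd s w₁ h1).2
    rw [← List.replicate_append_replicate, eWord_append q hq0 h1.length_eq, map_add, map_smul,
      weight_replicate s w₁ h3, blockProj_appendLeft q ς w₂ hs', htop]
    subst h3
    rw [blockProj_appendRight, ih h2, blockWord_cons, map_smul, actE_tensRight, smul_add,
      smul_smul, smul_smul, smul_smul, mul_comm (q ^ _)]
    congr 2
    split_ifs with h0
    · simp [h0, qInt_zero]
    · ring

theorem blockProj_actE (q : ℂ) (hq0 : q ≠ 0) (hd : q - q⁻¹ ≠ 0) {ς : List ℕ} {n : ℤ} {v : Words}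
    (hv : v ∈ wtSp (List.replicate ς.sum 1) n) :
    blockProj q ς (actE q (List.replicate ς.sum 1) v) = actE q ς (blockProj q ς v) := by
  rw [← LinearMap.comp_apply, ← LinearMap.comp_apply]
  refine eqOn_wtSp _ _ hv fun w hw _ => ?_
  rw [LinearMap.comp_apply, LinearMap.comp_apply, actE_single, one_smul, blockProj_single]
  exact blockProj_eWord q hq0 hd hw

theorem blockWord_concat (q : ℂ) {ς w₁ : List ℕ} (h : w₁.length = ς.sum) (w₂ : List ℕ) :
    blockWord q (ς ++ [w₂.length]) (w₁ ++ w₂) =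
      topCoef q w₂ • tensLeft w₂.sum (blockWord q ς w₁) := by
  induction ς generalizing w₁ with
  | nil =>
    obtain rfl : w₁ = [] := by simpa using h
    simp [blockWord]
  | cons s ς ih =>
    rw [List.sum_cons] at h
    have h1 : (w₁.drop s).length = ς.sum := by rw [List.length_drop]; omega
    rw [List.cons_append, blockWord, blockWord, List.take_append_of_le_length (by omega),
      List.drop_append_of_le_length (by omega), ih h1, map_smul, map_smul, smul_comm,
      ← appendLeft_singleton, appendLeft_tensRight]

/-- Components leave from the end and are put in front, so the block keeps its internal order, and
the scalars multiply to that of one component of valence `w₂.length` and label `w₂.sum`. -/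
theorem rot_pow_append (q : ℂ) (hq0 : q ≠ 0) (w₁ w₂ : List ℕ) :
    (rot q 1 ^ w₂.length) (Finsupp.single (w₁ ++ w₂) 1) =
      ((-1 : ℂ) ^ w₂.length * q ^ (2 * (w₂.sum : ℤ) - w₂.length)) •
        Finsupp.single (w₂ ++ w₁) 1 := by
  induction w₂ using List.reverseRecOn generalizing w₁ with
  | nil => simp
  | append_singleton w x ih =>
    rw [List.length_append, List.length_singleton, pow_succ, Module.End.mul_apply,
      ← List.append_assoc, ← tensLeft_single, rot_tensLeft, map_smul, tensRight_single,
      ← List.cons_append, ih, smul_smul, List.append_assoc, List.singleton_append]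
    congr 1
    rw [List.sum_append, List.sum_singleton, pow_one, pow_succ, mul_mul_mul_comm,
      ← zpow_add₀ hq0, mul_comm (-1 : ℂ)]
    congr 2
    push_cast
    ring

theorem blockProj_rot_pow (q : ℂ) (hq0 : q ≠ 0) {ς : List ℕ} {s : ℕ} {n : ℤ} {v : Words}
    (hv : v ∈ wtSp (List.replicate (ς.sum + s) 1) n) :
    blockProj q (s :: ς) ((rot q 1 ^ s) v) = rot q s (blockProj q (ς ++ [s]) v) := by
  rw [← LinearMap.comp_apply, ← LinearMap.comp_apply]
  refine eqOn_wtSp _ _ hv fun w hw _ => ?_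
  obtain ⟨w₁, w₂, rfl, -, -, h1, h2⟩ := exists_append_of_adm_replicate hw
  subst h2
  rw [LinearMap.comp_apply, LinearMap.comp_apply, rot_pow_append q hq0, map_smul,
    blockProj_single, blockProj_single, blockWord_concat q h1, map_smul, rot_tensLeft,
    blockWord_cons, smul_comm]

end QLink

end

/-! ### Assembly: from pair partitions to arbitrary valences. -/

theorem corollary4p2 (q : ℂ) (hq0 : q ≠ 0) (hq : ∀ m : ℤ, m ≠ 0 → q ^ m ≠ 1) :
    (∃! v : QLink.Diagram → QLink.Words, QLink.IsPairFamily q v) ∧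
    ∀ (ς : List ℕ) (s : ℕ), (∀ r ∈ ς, 0 < r) → 0 < s →
      ∀ ω ∈ QLink.LP (ς ++ [s]) 0,
        QLink.patCyc (ς.length + 1) ω ∈ QLink.LP (s :: ς) 0 ∧
        QLink.basisVec q (ς ++ [s]) ω ∈ QLink.hwSpace q (ς ++ [s]) 0 ∧
        QLink.basisVec q (s :: ς) (QLink.patCyc (ς.length + 1) ω) =
          (-q) ^ s • QLink.cyc q ς s (QLink.basisVec q (ς ++ [s]) ω) := by
  open QLink in
  have hd := qInt_den_ne q hq0 hq
  have hfam := isPairFamily_pairVec q hq0 hq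
  refine ⟨⟨pairVec q, hfam, fun v hv => hv.eq hq0 hq hfam⟩, fun ς s _ hs ω hω => ?_⟩
  obtain ⟨h0, hM⟩ := mem_LP_iff.mp hω
  obtain ⟨M, rfl⟩ : ∃ M, ω = ⟨M, 0⟩ := ⟨ω.links, Diagram.ext rfl h0⟩
  have hb : ∀ x ∈ degs (ς ++ [s]), 1 ≤ x ∧ x ≤ ς.length + 1 := fun x hx => by
    simpa using mem_degs hx
  have hcyc : patCyc (ς.length + 1) ⟨M, 0⟩ = ⟨twist (cycPt (ς.length + 1)) M, 0⟩ :=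
    patCyc_eq fun L hL => ⟨hM.lt L hL, (hb _ (hM.ends_eq ▸ snd_mem_ends hL)).2⟩
  have hsum : (ς ++ [s]).sum = ς.sum + s := by simp
  obtain ⟨A, hA, hAM, hopen⟩ := exists_openUp hM
  have hinv : pairVec q ⟨A, 0⟩ ∈ inv q (ς ++ [s]).sum := by
    obtain ⟨N, hN⟩ : ∃ N, (ς ++ [s]).sum = 2 * N := ⟨_, (two_mul_card hA).symm⟩
    rw [hN] at hA ⊢
    exact (mem_hwSpace_replicate q hq0 hq _ _).mp
      (hfam.mem N ⟨A, 0⟩ (mem_PP_iff.mpr ⟨rfl, hA⟩))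
  obtain ⟨hi1, hi2⟩ := mem_inv.mp hinv
  have hvec : basisVec q (ς ++ [s]) ⟨M, 0⟩ ∈ hwSpace q (ς ++ [s]) 0 := by
    rw [basisVec, hopen, mem_hwSpace_iff q hq0 hq, Nat.cast_zero]
    exact ⟨blockProj_mem q hi1, by rw [← blockProj_actE q hq0 hd hi1, hi2, map_zero]⟩
  refine ⟨?_, hvec, ?_⟩
  · rw [hcyc, mem_LP_iff, ← degs_cycPt]
    exact ⟨rfl, hM.twist hb⟩
  -- Both sides become images of the same $v_{\alpha(\omega)}$: rotated $s$ times and then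
  -- projected, or projected and then rotated once.
  · rw [smul_cyc q hq0 hq hvec, hcyc, basisVec, basisVec, hopen]
    rw [hsum] at hA hi1
    rw [openUp_twist hM hA hAM, pairVec_iterate_twist q hq0 hq (by omega) hA,
      blockProj_rot_pow q hq0 hi1]
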